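/- Conventions. For a group $G$, $x\in G$ and $K\le G$, let $x^G$ be the conjugacy class of $x$ and $K^G$ the set of $G$-conjugates of $K$. Let $G$ be a simple classical group $PSL_n(q)$, $PSp_n(q)$, $P\Omega_n(q)$ (any of the orthogonal families, with nondegenerate polar form) or $PSU_n(q)$, that is, the quotient of $\hat G=SL(V)$, $Sp(V)$, $\Omega(V)=O(V)'$ or $SU(V)$ by the scalars it contains, where the natural module $V$ has dimension $n$ over $\mathbb F_{q^\delta}$, with $\delta=2$ if $G$ is unitary and $\delta=1$ otherwise. An almost-free embedding of a finite group $A$ of order $a$ with regular module $R$ is a homomorphism $A\to\hat G$ for which $V$ decomposes as an orthogonal direct sum of $\mathbb F_{q^\delta}A$-modules $V=R^2\perp\dots\perp R^2\perp I$, with at least one summand $R^2=R\oplus R$ and with $I$ a trivial module of dimension $s$, $2\le s<2a+2$ (orthogonality is an empty condition in the linear case). Elements and subgroups of $A$ are then identified with their images in $G$. A maximal parabolic subgroup $P_m$ is a maximal subgroup of $G$ that is the stabilizer of a totally singular $m$-dimensional subspace of $V$ (any $m$-dimensional subspace in the linear case). Theorem. Let $A$ and $B$ be finite $2$-groups. (1)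 There are constants $c,c'$ depending only on $A$ and $B$ such that for every $G$ as above, all almost-free embeddings of $A$ and $B$ in $G$, every $x\in A$ of order $2$, every $y\in B$ of order $4$, every $m$ with $1\le m\le n/2$ and every maximal parabolic subgroup $M=P_m$ of $G$, $$\sum_{M'\in M^G}\frac{|x^G\cap M'|}{|x^G|}\cdot\frac{|y^G\cap M'|}{|y^G|}<q^{-f+cm}\quad\text{and}\quad -f+cm<-\frac{\delta n}{4}+c',$$ where $f=\frac14m(n-m)$ if $G=PSL_n(q)$, $f=\frac18m(2n-3m)$ if $G=PSp_n(q)$ or $P\Omega_n(q)$, and $f=\frac14m(2n-3m)$ if $G=PSU_n(q)$. (2) There are constants $c,c'$ depending only on $A$ and $B$ such that for every $G$ as above, all almost-free embeddings of $A$ and $B$ in $G$, every $x\in A$ of order $2$, every subgroup $K\le B$ with $K\cong C_2\times C_2$, every $m$ with $1\le m\le n/2$ and every maximal parabolic subgroup $M=P_m$ of $G$, $$\sum_{M'\in M^G}\frac{|x^G\cap M'|}{|x^G|}\cdot\frac{|\{L\in K^G: L\le M'\}|}{|K^G|}<q^{-f+cm}\quad\text{and}\quad -f+cm<-\frac{\delta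 n}{4}+c',$$ where $f=\frac14m(n-m)$ if $G=PSL_n(q)$, $f=\frac1{44}m(11n-21m)$ if $G=PSp_n(q)$ or $P\Omega_n(q)$, and $f=\frac1{22}m(11n-21m)$ if $G=PSU_n(q)$. -/

import Mathlib

open Module

/-- The geometry on the natural module `V` of a classical group over the field `F`: no form at all
(linear case), a nondegenerate alternating form, a quadratic form with nondegenerate polar form, or
a nondegenerate Hermitian form with respect to an involutory field automorphism `σ`. -/
inductive ClassicalSpace (F V : Type*) [Field F] [AddCommGroup V] [Module F V] where
  | linear : ClassicalSpace F V
  | symplectic (B : LinearMap.BilinForm F V) (alt : B.IsAlt) (nondeg : B.Nondegenerate) :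
      ClassicalSpace F V
  | orthogonal (Q : QuadraticForm F V)
      (nondeg : (QuadraticMap.polarBilin Q).Nondegenerate) : ClassicalSpace F V
  | unitary (σ : F →+* F) (invol : ∀ c, σ (σ c) = c) (nontriv : σ ≠ RingHom.id F)
      (h : V →ₛₗ[σ] V →ₗ[F] F) (herm : h.IsSymm) (nondeg : h.Nondegenerate) :
      ClassicalSpace F V

namespace ClassicalSpace

variable {F V : Type*} [Field F] [AddCommGroup V] [Module F V]

/-- The bilinear or sesquilinear form of the space: zero in the linear case, the polar form
`Q (v + w) - Q v - Q w` in the orthogonal case. -/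
def pairing : ClassicalSpace F V → V → V → F
  | linear => fun _ _ => 0
  | symplectic B _ _ => fun v w => B v w
  | orthogonal Q _ => fun v w => QuadraticMap.polar Q v w
  | unitary _ _ _ h _ _ => fun v w => h v w

/-- The quadratic form in the orthogonal case, and zero otherwise. -/
def quad : ClassicalSpace F V → V → F
  | orthogonal Q _ => fun v => Q v
  | _ => fun _ => 0

/-- `δ = 2` in the unitary case and `δ = 1` otherwise: the field of the natural module has
`q ^ δ` elements. -/
def delta : ClassicalSpace F V → ℕ
  | unitary _ _ _ _ _ _ => 2
  | _ => 1

/-- The full isometry group: `GL(V)`, `Sp(V)`, `O(V)` or `GU(V)`. -/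
def isometryGroup (S : ClassicalSpace F V) : Subgroup (V ≃ₗ[F] V) where
  carrier := {g | (∀ v w, S.pairing (g v) (g w) = S.pairing v w) ∧ ∀ v, S.quad (g v) = S.quad v}
  one_mem' := ⟨fun _ _ => rfl, fun _ => rfl⟩
  mul_mem' := by
    rintro a b ⟨ha, ha'⟩ ⟨hb, hb'⟩
    exact ⟨fun v w => (ha (b v) (b w)).trans (hb v w), fun v => (ha' (b v)).trans (hb' v)⟩
  inv_mem' := by
    rintro a ⟨ha, ha'⟩
    have key : ∀ v, a (a⁻¹ v) = v := fun v => a.apply_symm_apply v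
    refine ⟨fun v w => ?_, fun v => ?_⟩
    · have := ha (a⁻¹ v) (a⁻¹ w)
      rw [key, key] at this
      exact this.symm
    · have := ha' (a⁻¹ v)
      rw [key] at this
      exact this.symm

/-- The quasisimple classical group: `SL(V)`, `Sp(V)`, `Ω(V)` (the derived subgroup of `O(V)`) or
`SU(V)`. -/
noncomputable def quasiGroup (S : ClassicalSpace F V) : Subgroup (V ≃ₗ[F] V) :=
  match S with
  | linear => (LinearEquiv.det (R := F) (M := V)).ker
  | symplectic B alt nondeg => (symplectic B alt nondeg).isometryGroup
  | orthogonal Q nondeg =>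
      ⁅(orthogonal Q nondeg).isometryGroup, (orthogonal Q nondeg).isometryGroup⁆
  | unitary σ invol nontriv h herm nondeg =>
      (unitary σ invol nontriv h herm nondeg).isometryGroup ⊓
        (LinearEquiv.det (R := F) (M := V)).ker

end ClassicalSpace

/-- The subgroup of scalar transformations in `GL(V)`. -/
def scalarGroup (F V : Type*) [Field F] [AddCommGroup V] [Module F V] :
    Subgroup (V ≃ₗ[F] V) where
  carrier := {g | ∃ c : Fˣ, ∀ v, g v = c • v}
  one_mem' := ⟨1, fun v => (one_smul _ v).symm⟩
  mul_mem' := by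
    rintro a b ⟨c, hc⟩ ⟨d, hd⟩
    refine ⟨c * d, fun v => ?_⟩
    rw [LinearEquiv.mul_apply, hd, hc, mul_smul]
  inv_mem' := by
    rintro a ⟨c, hc⟩
    refine ⟨c⁻¹, fun v => a.injective ?_⟩
    have key : a (a⁻¹ v) = v := a.apply_symm_apply v
    rw [key, hc, smul_inv_smul]

instance scalarGroup_normal (F V : Type*) [Field F] [AddCommGroup V] [Module F V] :
    (scalarGroup F V).Normal where
  conj_mem := by
    rintro a ⟨c, hc⟩ g
    refine ⟨c, fun v => ?_⟩
    have key : g (g⁻¹ v) = v := g.apply_symm_apply v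
    rw [LinearEquiv.mul_apply, LinearEquiv.mul_apply, hc, Units.smul_def, map_smul, key, Units.smul_def]

namespace ClassicalSpace

variable {F V : Type*} [Field F] [AddCommGroup V] [Module F V]

/-- The projective classical group `PSL(V)`, `PSp(V)`, `PΩ(V)` or `PSU(V)`: the quasisimple group
modulo the scalars that it contains. -/
abbrev simpleGroup (S : ClassicalSpace F V) : Type _ :=
  S.quasiGroup ⧸ (scalarGroup F V).subgroupOf S.quasiGroup

/-- Reduction modulo scalars. -/
noncomputable def proj (S : ClassicalSpace F V) : S.quasiGroup →* S.simpleGroup :=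
  QuotientGroup.mk' _

/-- Totally singular subspaces (in the linear case, all subspaces). -/
def IsTotallySingular (S : ClassicalSpace F V) (W : Submodule F V) : Prop :=
  (∀ v ∈ W, ∀ w ∈ W, S.pairing v w = 0) ∧ ∀ v ∈ W, S.quad v = 0

/-- The stabilizer in the simple group of a subspace `W` of the natural module. -/
noncomputable def stabilizer (S : ClassicalSpace F V) (W : Submodule F V) : Subgroup S.simpleGroup :=
  Subgroup.map S.proj
    { carrier := {g | W.map ((g : V ≃ₗ[F] V) : V →ₗ[F] V) = W}
      one_mem' := Submodule.map_id W
      mul_mem' := by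
        intro a b ha hb
        simp only [Set.mem_ofPred_eq] at ha hb ⊢
        have : (((a * b : S.quasiGroup) : V ≃ₗ[F] V) : V →ₗ[F] V) =
            ((a : V ≃ₗ[F] V) : V →ₗ[F] V) ∘ₗ ((b : V ≃ₗ[F] V) : V →ₗ[F] V) := rfl
        rw [this, Submodule.map_comp, hb, ha]
      inv_mem' := by
        intro a ha
        simp only [Set.mem_ofPred_eq] at ha ⊢
        have key : (((a⁻¹ : S.quasiGroup) : V ≃ₗ[F] V) : V →ₗ[F] V) ∘ₗ
            ((a : V ≃ₗ[F] V) : V →ₗ[F] V) = LinearMap.id :=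
          LinearMap.ext fun v => (a : V ≃ₗ[F] V).symm_apply_apply v
        conv_lhs => rw [← ha]
        rw [← Submodule.map_comp, key, Submodule.map_id] }

/-- `M` is a maximal parabolic subgroup `P_m`: a maximal subgroup of the simple group which is the
stabilizer of a totally singular `m`-space. -/
def IsMaximalParabolic (S : ClassicalSpace F V) (m : ℕ) (M : Subgroup S.simpleGroup) : Prop :=
  IsCoatom M ∧
    ∃ W : Submodule F V, S.IsTotallySingular W ∧ finrank F W = m ∧ M = S.stabilizer W

/-- The action `ρ` of the finite group `A` makes `V` almost-free: `V = R² ⊥ ⋯ ⊥ R² ⊥ I`, an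
orthogonal direct sum of `t ≥ 1` copies of `R² = R ⊕ R`, for `R` the regular module, and of the
trivial module `I` of dimension `s`, where `2 ≤ s < 2|A| + 2`. The basis vectors `b (inl (i, j, h))`
with `h` in `A` form the standard basis of the `j`-th copy of `R` in the `i`-th copy of `R²`, and
the vectors `b (inr j)` form a basis of `I`. -/
def IsAlmostFree (S : ClassicalSpace F V) {A : Type*} [Group A] (ρ : A →* S.quasiGroup) : Prop :=
  ∃ (t s : ℕ) (b : Basis ((Fin t × Fin 2 × A) ⊕ Fin s) F V),
    1 ≤ t ∧ 2 ≤ s ∧ s < 2 * Nat.card A + 2 ∧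
    (∀ g i j h, (ρ g : V ≃ₗ[F] V) (b (Sum.inl (i, j, h))) = b (Sum.inl (i, j, g * h))) ∧
    (∀ g j, (ρ g : V ≃ₗ[F] V) (b (Sum.inr j)) = b (Sum.inr j)) ∧
    (∀ i i' j j' h h', i ≠ i' →
      S.pairing (b (Sum.inl (i, j, h))) (b (Sum.inl (i', j', h'))) = 0) ∧
    (∀ i j h j', S.pairing (b (Sum.inl (i, j, h))) (b (Sum.inr j')) = 0)

/-- The exponent `f` for involutions and elements of order 4. -/
noncomputable def exponentFour (S : ClassicalSpace F V) (n m : ℝ) : ℝ :=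
  match S with
  | linear => 1 / 4 * m * (n - m)
  | symplectic _ _ _ => 1 / 8 * m * (2 * n - 3 * m)
  | orthogonal _ _ => 1 / 8 * m * (2 * n - 3 * m)
  | unitary _ _ _ _ _ _ => 1 / 4 * m * (2 * n - 3 * m)

/-- The exponent `f` for involutions and Klein four-groups. -/
noncomputable def exponentKlein (S : ClassicalSpace F V) (n m : ℝ) : ℝ :=
  match S with
  | linear => 1 / 4 * m * (n - m)
  | symplectic _ _ _ => 1 / 44 * m * (11 * n - 21 * m)
  | orthogonal _ _ => 1 / 44 * m * (11 * n - 21 * m)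
  | unitary _ _ _ _ _ _ => 1 / 22 * m * (11 * n - 21 * m)

end ClassicalSpace

/-- The set `L^G` of conjugates of a subgroup `L` of `G`. -/
def subgroupConjugates {G : Type*} [Group G] (L : Subgroup G) : Set (Subgroup G) :=
  Set.range fun g : G => L.map (MulAut.conj g).toMonoidHom

/-- The ratio `|x^G ∩ M| / |x^G|`. -/
noncomputable def classRatio {G : Type*} [Group G] (x : G) (M : Subgroup G) : ℝ :=
  ((conjugatesOf x ∩ (M : Set G)).ncard : ℝ) / ((conjugatesOf x).ncard : ℝ)

/-- The ratio `|{K^g : g ∈ G, K^g ≤ M}| / |K^G|`. -/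
noncomputable def subgroupRatio {G : Type*} [Group G] (K M : Subgroup G) : ℝ :=
  ({L ∈ subgroupConjugates K | L ≤ M}.ncard : ℝ) / ((subgroupConjugates K).ncard : ℝ)

/-! Write `Q = |F| = q^δ`, `n = dim V`, and `ε = 1` if there is a form, `ε = 0` in the linear case.
The conjugates of `M` are the stabilizers of the subspaces in the orbit of `W`; let `N` be the
length of this orbit. Double counting of pairs (conjugate of `x`, subspace fixed by it) bounds each
ratio by `fix(x) / N`, where `fix(x)` is the number of fixed subspaces in the orbit; the same works
for `y` and for `K`. There are at most `N` conjugates of `M`, so the sum is at most `fix(x) fix(y) /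
N` (`ClassicalSpace.classRatio_le`, `ClassicalSpace.subgroupRatio_le`,
`ClassicalSpace.finsum_subgroupConjugates_le`).

Everything then rests on four estimates, each up to a factor `Q^O(m)`. The orbit satisfies `N ≥
Q^(mn - (1 + ε/2)m²)` (`ClassicalSpace.le_ncard_orbit`). The fixed subspaces number at most `Q^(mn/2
- (1/2 + ε/4)m²)` for an involution, `Q^(mn/4 - (1/4 + ε/8)m²)` for an element of order 4, and
`Q^(mn/4 - (1/4 + ε/44)m²)` for a Klein four-group. Combining the exponents gives `-f`, with a
factor `δ` from `Q = q^δ`.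

Invariant totally isotropic subspaces `U` are counted by building them from modules of decreasing
size. Let `W ≤ U` be the part already built. If some `u` in `U` generates a large module modulo `W`,
then a fixed proportion of the vectors of a suitable subspace of `U` does so, and all of these lie
in a small set, in most cases a kernel intersected with the orthogonal complement of `W`. Dividing
the two numbers bounds the choices for the next step, and `W` is enlarged by `u`
(`ncard_le_of_witness_or`). If there is no such `u`, then `U` belongs to a family that uses only
smaller modules. The total exponent is a quadratic form in the numbers of modules of each size, to
be compared with a multiple of `m²`. This is done for operators with scalar square, for nilpotent
operators with `N ^ 4 = 0`, and for two commuting operators with square zero. The last two cover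
characteristic 2; in odd characteristic the space splits under an involution and the first case
applies to each half. Almost-freeness supplies the bounds for eigenspaces and kernels
(`finrank_mul_card_le`).

For the orbit, sequences of vectors are moved one vector at a time by transvections or Eichler
transformations that fix the earlier vectors; in the orthogonal case enough Eichler transformations
must be exhibited as commutators. -/

set_option linter.unusedSectionVars false

/-! ### Powers of the order of a finite field -/

/-- The real power `|F| ^ t` of the order of `F`. -/
noncomputable def cardPow (F : Type*) (t : ℝ) : ℝ := (Nat.card F : ℝ) ^ t

section cardPow

variable {F : Type*} [Field F] [Finite F]

theorem cardPow_zero : cardPow F 0 = 1 := Real.rpow_zero _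

theorem two_le_natCard : (2 : ℝ) ≤ Nat.card F := by
  exact_mod_cast Finite.one_lt_card (α := F)

theorem cardPow_pos (t : ℝ) : 0 < cardPow F t :=
  Real.rpow_pos_of_pos (by linarith [two_le_natCard (F := F)]) t

theorem cardPow_add (s t : ℝ) : cardPow F (s + t) = cardPow F s * cardPow F t :=
  Real.rpow_add (by linarith [two_le_natCard (F := F)]) s t

theorem cardPow_mono {s t : ℝ} (h : s ≤ t) : cardPow F s ≤ cardPow F t :=
  Real.rpow_le_rpow_of_exponent_le (by linarith [two_le_natCard (F := F)]) h

theorem cardPow_one : cardPow F 1 = Nat.card F := Real.rpow_one _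

theorem cardPow_natCast (n : ℕ) : cardPow F n = (Nat.card F : ℝ) ^ n := Real.rpow_natCast _ n

theorem two_mul_cardPow_le (t : ℝ) : 2 * cardPow F t ≤ cardPow F (t + 1) := by
  rw [cardPow_add, cardPow_one, mul_comm]
  exact mul_le_mul_of_nonneg_left two_le_natCard (cardPow_pos t).le

/-- As `|F| ≥ 2`, one unit in the exponent pays for a sum of two terms. All the unit losses in the
counting below come from this. -/
theorem cardPow_add_le {a b e : ℝ} (ha : a + 1 ≤ e) (hb : b + 1 ≤ e) :
    cardPow F a + cardPow F b ≤ cardPow F e := by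
  have h1 := (cardPow_mono (F := F) (show a ≤ e - 1 by linarith))
  have h2 := (cardPow_mono (F := F) (show b ≤ e - 1 by linarith))
  have h3 := two_mul_cardPow_le (F := F) (e - 1)
  rw [sub_add_cancel] at h3
  linarith

/-- This pays for a sum over the possible values of a dimension. -/
theorem natCast_add_one_le_cardPow (n : ℕ) : (n + 1 : ℝ) ≤ cardPow F n := by
  induction n with
  | zero => simp [cardPow_zero]
  | succ k ih =>
    have h := two_mul_cardPow_le (F := F) k
    push_cast
    have : (0 : ℝ) ≤ k := k.cast_nonneg
    linarith

end cardPow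

/-! ### Counting vectors and subspaces -/

section Counting

variable {F V : Type*} [Field F] [Finite F] [AddCommGroup V] [Module F V] [FiniteDimensional F V]

theorem natCard_submodule (U : Submodule F V) :
    (Nat.card U : ℝ) = cardPow F (finrank F U) := by
  rw [Module.natCard_eq_pow_finrank (K := F) (V := U), cardPow_natCast]
  push_cast
  rfl

theorem ncard_submodule (U : Submodule F V) :
    ((U : Set V).ncard : ℝ) = cardPow F (finrank F U) := by
  rw [← natCard_submodule]
  norm_cast

variable [Finite V]

theorem ncard_submodule_le {U : Submodule F V} {t : ℝ} (h : (finrank F U : ℝ) ≤ t) :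
    ((U : Set V).ncard : ℝ) ≤ cardPow F t := by
  rw [ncard_submodule]
  exact cardPow_mono h

/-- A proper subspace contains at most `1/|F| ≤ 1/2` of the vectors of `U`, so at least `1/|F|` of
them remain. -/
theorem le_ncard_diff {U K : Submodule F V} (h : ¬ U ≤ K) :
    cardPow F (finrank F U - 1) ≤ ((U : Set V) \ K).ncard := by
  have h1 : U ⊓ K < U := inf_lt_left.2 h
  have h2 := Submodule.finrank_lt_finrank_of_lt h1
  have h3 : ((U : Set V) \ K) = (U : Set V) \ ((U ⊓ K : Submodule F V) : Set V) := by
    ext; simp +contextual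
  have h4 := Set.ncard_sdiff_add_ncard_of_subset (s := ((U ⊓ K : Submodule F V) : Set V))
    (t := (U : Set V)) (fun _ hx => hx.1) (Set.toFinite _)
  rw [← h3] at h4
  have h5 : (((U : Set V) \ K).ncard : ℝ) + ((U ⊓ K : Submodule F V) : Set V).ncard
      = (U : Set V).ncard := by exact_mod_cast h4
  rw [ncard_submodule, ncard_submodule] at h5
  have h6 : cardPow F (finrank F (U ⊓ K : Submodule F V)) ≤ cardPow F (finrank F U - 1) := by
    apply cardPow_mono
    have : ((finrank F (U ⊓ K : Submodule F V) + 1 : ℕ) : ℝ) ≤ finrank F U := by exact_mod_cast h2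
    push_cast at this
    linarith
  have h7 := two_mul_cardPow_le (F := F) (finrank F U - 1)
  rw [sub_add_cancel] at h7
  linarith

/-- The pairs `(x, u)` with `u ∈ S x` are counted in both ways. -/
theorem ncard_mul_le_ncard_mul {α β : Type*} [Finite α] [Finite β] {A : Set α} {T : Set β}
    (S : α → Set β) {a M : ℝ} (hST : ∀ x ∈ A, S x ⊆ T) (ha : ∀ x ∈ A, a ≤ (S x).ncard)
    (hM : ∀ u ∈ T, ({x ∈ A | u ∈ S x}.ncard : ℝ) ≤ M) :
    A.ncard * a ≤ T.ncard * M := by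
  classical
  have := Fintype.ofFinite α
  have := Fintype.ofFinite β
  have key := Finset.sum_card_bipartiteAbove_eq_sum_card_bipartiteBelow (fun x u => u ∈ S x)
    (s := A.toFinset) (t := T.toFinset)
  have h1 : ∀ x ∈ A.toFinset, a ≤
      ((Finset.bipartiteAbove (fun x u => u ∈ S x) T.toFinset x).card : ℝ) := by
    intro x hx
    rw [Set.mem_toFinset] at hx
    refine (ha x hx).trans (le_of_eq ?_)
    rw [← Set.ncard_coe_finset]
    congr 2
    ext u
    simpa [Finset.bipartiteAbove] using fun hu => hST x hx hu
  have h2 : ∀ u ∈ T.toFinset,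
      ((Finset.bipartiteBelow (fun x u => u ∈ S x) A.toFinset u).card : ℝ) ≤ M := by
    intro u hu
    rw [Set.mem_toFinset] at hu
    refine le_trans (le_of_eq ?_) (hM u hu)
    rw [← Set.ncard_coe_finset]
    congr 2
    ext x
    simp [Finset.bipartiteBelow]
  have h3 := Finset.card_nsmul_le_sum _ _ _ h1
  have h4 := Finset.sum_le_card_nsmul _ _ _ h2
  rw [nsmul_eq_mul, ← Set.ncard_eq_toFinset_card'] at h3 h4
  have h5 : (∑ x ∈ A.toFinset, ((Finset.bipartiteAbove (fun x u => u ∈ S x) T.toFinset x).card : ℝ))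
      = ∑ u ∈ T.toFinset, ((Finset.bipartiteBelow (fun x u => u ∈ S x) A.toFinset u).card : ℝ) := by
    exact_mod_cast key
  linarith

/-- A family of subspaces, each of which contains many good vectors from a small set `T`, is small
if each vector is good for few of them. -/
theorem ncard_le_of_witness {A : Set (Submodule F V)} {T : Set V} (S : Submodule F V → Set V)
    {t s b : ℝ} (hT : (T.ncard : ℝ) ≤ cardPow F t) (hST : ∀ U ∈ A, S U ⊆ T)
    (hS : ∀ U ∈ A, cardPow F s ≤ (S U).ncard)
    (hM : ∀ u ∈ T, ({U ∈ A | u ∈ S U}.ncard : ℝ) ≤ cardPow F b) :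
    (A.ncard : ℝ) ≤ cardPow F (t - s + b) := by
  have h1 := ncard_mul_le_ncard_mul S hST hS hM
  have h2 : (A.ncard : ℝ) * cardPow F s ≤ cardPow F (t - s + b) * cardPow F s := by
    rw [← cardPow_add]
    refine h1.trans ?_
    rw [show t - s + b + s = t + b by ring, cardPow_add]
    exact mul_le_mul_of_nonneg_right hT (cardPow_pos b).le
  exact le_of_mul_le_mul_right h2 (cardPow_pos s)

/-- `ncard_le_of_witness`, applied to the members of a family with a property `P`, together with a
bound for the other members. -/
theorem ncard_le_of_witness_or {A : Set (Submodule F V)} (P : Submodule F V → Prop) {T : Set V}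
    (S : Submodule F V → Set V) {t s b c e : ℝ} (hT : (T.ncard : ℝ) ≤ cardPow F t)
    (hST : ∀ U ∈ A, P U → S U ⊆ T)
    (hS : ∀ U ∈ A, P U → cardPow F s ≤ (S U).ncard)
    (hM : ∀ u ∈ T, (∃ U ∈ A, P U ∧ u ∈ S U) →
      ({U ∈ A | P U ∧ u ∈ S U}.ncard : ℝ) ≤ cardPow F b ∧ t - s + b + 1 ≤ e)
    (hC : ({U ∈ A | ¬ P U}.ncard : ℝ) ≤ cardPow F c) (hc : c + 1 ≤ e) :
    (A.ncard : ℝ) ≤ cardPow F e := by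
  have hsplit : A = {U ∈ A | P U} ∪ {U ∈ A | ¬ P U} := by
    ext U; simp only [Set.mem_union, Set.mem_ofPred_eq]; tauto
  have hle : (A.ncard : ℝ) ≤ ({U ∈ A | P U}.ncard : ℝ) + ({U ∈ A | ¬ P U}.ncard : ℝ) := by
    conv_lhs => rw [hsplit]
    exact_mod_cast Set.ncard_union_le _ _
  have hA : ({U ∈ A | P U}.ncard : ℝ) ≤ cardPow F (e - 1) := by
    have h1 := ncard_le_of_witness (A := {U ∈ A | P U}) (b := e - 1 - t + s) S hT
      (fun U hU => hST U hU.1 hU.2) (fun U hU => hS U hU.1 hU.2) (fun u hu => ?_)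
    · rwa [show t - s + (e - 1 - t + s) = e - 1 by ring] at h1
    · have hset : {U ∈ {U ∈ A | P U} | u ∈ S U} = {U ∈ A | P U ∧ u ∈ S U} := by
        ext U; simp only [Set.mem_ofPred_eq]; tauto
      rw [hset]
      by_cases hex : ∃ U ∈ A, P U ∧ u ∈ S U
      · obtain ⟨h2, h3⟩ := hM u hu hex
        exact h2.trans (cardPow_mono (by linarith))
      · have : {U ∈ A | P U ∧ u ∈ S U} = ∅ := by
          ext U
          simp only [Set.mem_ofPred_eq, Set.mem_empty_iff_false, iff_false]
          exact fun h => hex ⟨U, h⟩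
        rw [this, Set.ncard_empty, Nat.cast_zero]
        exact (cardPow_pos _).le
  exact hle.trans ((add_le_add hA hC).trans (cardPow_add_le (by linarith) hc))

theorem ncard_le_one_of_finrank_eq {A : Set (Submodule F V)} {W : Submodule F V}
    (h : ∀ U ∈ A, W ≤ U ∧ finrank F U = finrank F W) : (A.ncard : ℝ) ≤ 1 := by
  have : A ⊆ {W} := fun U hU =>
    (Submodule.eq_of_le_of_finrank_eq (h U hU).1 (h U hU).2.symm).symm
  exact_mod_cast (Set.ncard_le_ncard this).trans (Set.ncard_singleton _).le

theorem finrank_sup_span_singleton {W : Submodule F V} {v : V} (h : v ∉ W) :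
    finrank F (W ⊔ F ∙ v : Submodule F V) = finrank F W + 1 := by
  have hv : v ≠ 0 := fun h0 => h (h0 ▸ W.zero_mem)
  have h1 := Submodule.finrank_sup_add_finrank_inf_eq W (F ∙ v)
  have h2 : W ⊓ F ∙ v = ⊥ := by
    rw [Submodule.eq_bot_iff]
    rintro x ⟨hx, hx'⟩
    obtain ⟨c, rfl⟩ := Submodule.mem_span_singleton.1 hx'
    by_cases hc : c = 0
    · simp [hc]
    · exact absurd ((W.smul_mem_iff hc).1 hx) h
  rw [h2, finrank_bot, finrank_span_singleton hv] at h1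
  simpa using h1

/-- The number of subspaces of dimension `m` between `W` and `K`. -/
theorem ncard_between_le {K : Submodule F V} {k : ℝ} (hK : (finrank F K : ℝ) ≤ k) (d : ℕ) :
    ∀ (W : Submodule F V) (m : ℕ), finrank F W + d = m →
      ({U : Submodule F V | W ≤ U ∧ U ≤ K ∧ finrank F U = m}.ncard : ℝ) ≤
        cardPow F (d * (k - m + 1)) := by
  induction d with
  | zero =>
    intro W m hm
    rw [Nat.cast_zero, zero_mul, cardPow_zero]
    refine ncard_le_one_of_finrank_eq (W := W) ?_
    rintro U ⟨h1, -, h2⟩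
    exact ⟨h1, by omega⟩
  | succ d ih =>
    intro W m hm
    -- The witnesses are the vectors of `U` outside `W`; each one reduces the codimension of `W` in
    -- `U` by one.
    have h := ncard_le_of_witness (A := {U : Submodule F V | W ≤ U ∧ U ≤ K ∧ finrank F U = m})
      (T := (K : Set V) \ W) (fun U => (U : Set V) \ W) (t := k) (s := m - 1)
      (b := d * (k - m + 1)) ?_ ?_ ?_ ?_
    · refine h.trans (le_of_eq ?_)
      congr 1
      push_cast
      ring
    · exact le_trans (by exact_mod_cast Set.ncard_le_ncard Set.sdiff_subset) (ncard_submodule_le hK)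
    · rintro U ⟨-, h2, -⟩
      exact Set.sdiff_subset_sdiff_left h2
    · rintro U ⟨h1, -, h2⟩
      have h3 : ¬ U ≤ W := fun h3 => by
        have := Submodule.finrank_mono h3
        omega
      simpa [h2] using le_ncard_diff h3
    · rintro u ⟨hu, huW⟩
      refine le_trans ?_ (ih (W ⊔ F ∙ u) m (by rw [finrank_sup_span_singleton huW]; omega))
      refine Nat.cast_le.2 (Set.ncard_le_ncard fun U hU => ?_)
      exact ⟨sup_le hU.1.1 ((Submodule.span_singleton_le_iff_mem _ _).2 hU.2.1), hU.1.2⟩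

end Counting

/-! ### Orthogonal complements for a sesquilinear form -/

section Perp

variable {F V : Type*} [Field F] [AddCommGroup V] [Module F V] {σ : F →+* F}

/-- The vectors that are right orthogonal to all vectors of `W`. -/
def rightPerp (B : V →ₛₗ[σ] V →ₗ[F] F) (W : Submodule F V) : Submodule F V where
  carrier := {v | ∀ w ∈ W, B w v = 0}
  add_mem' ha hb w hw := by rw [map_add, ha w hw, hb w hw, add_zero]
  zero_mem' w _ := map_zero _
  smul_mem' c v hv w hw := by rw [map_smul, hv w hw, smul_zero]

/-- The vectors that are left orthogonal to all vectors of `K`. -/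
def leftPerp (B : V →ₛₗ[σ] V →ₗ[F] F) (K : Submodule F V) : Submodule F V where
  carrier := {w | ∀ v ∈ K, B w v = 0}
  add_mem' ha hb v hv := by rw [map_add, LinearMap.add_apply, ha v hv, hb v hv, add_zero]
  zero_mem' v _ := by rw [map_zero, LinearMap.zero_apply]
  smul_mem' c w hw v hv := by rw [LinearMap.map_smulₛₗ, LinearMap.smul_apply, hw v hv, smul_zero]

/-- The form maps `W` to the dual of `K`, with kernel `W ⊓ leftPerp B K`, and `K ⊓ rightPerp B W` is
the annihilator of the image. The map is only `σ`-semilinear, so its rank is found from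
cardinalities. -/
theorem finrank_inf_rightPerp_le [Finite F] [FiniteDimensional F V] (B : V →ₛₗ[σ] V →ₗ[F] F)
    (K W : Submodule F V) :
    finrank F (K ⊓ rightPerp B W : Submodule F V) + finrank F W ≤
      finrank F K + finrank F (W ⊓ leftPerp B K : Submodule F V) := by
  have : RingHomSurjective σ := ⟨Finite.surjective_of_injective σ.injective⟩
  have : Finite V := Module.finite_of_finite F
  have hfin : Finite (Dual F K) := Module.finite_of_finite F
  -- the image of `W` in the dual of `K`
  let R : Dual F V →ₗ[F] Dual F K := K.dualRestrict
  let φ : W →+ Dual F K :=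
    (R.toAddMonoidHom.comp B.toAddMonoidHom).comp W.toAddSubgroup.subtype
  have hφ : ∀ (w : W) (v : K), φ w v = B w v := fun _ _ => rfl
  -- The image is closed under scalars because `σ`, being injective on a finite field, is
  -- surjective.
  let Φ : Submodule F (Dual F K) :=
    { φ.range with
      smul_mem' := by
        rintro c _ ⟨w, rfl⟩
        obtain ⟨d, rfl⟩ := RingHomSurjective.is_surjective (σ := σ) c
        refine ⟨d • w, ?_⟩
        ext v
        rw [hφ, LinearMap.smul_apply, hφ, Submodule.coe_smul, LinearMap.map_smulₛₗ,
          LinearMap.smul_apply] }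
  have h1 : Nat.card W = Nat.card φ.range * Nat.card φ.ker := by
    rw [AddSubgroup.card_eq_card_quotient_mul_card_addSubgroup φ.ker,
      Nat.card_congr (QuotientAddGroup.quotientKerEquivRange φ).toEquiv]
  have h2 : Nat.card φ.ker = Nat.card (W ⊓ leftPerp B K : Submodule F V) := by
    refine Nat.card_congr
      { toFun := fun w => ⟨w.1.1, w.1.2, fun v hv => ?_⟩
        invFun := fun w => ⟨⟨w.1, w.2.1⟩, ?_⟩
        left_inv := fun _ => rfl
        right_inv := fun _ => rfl }
    · have := w.2
      rw [AddMonoidHom.mem_ker] at this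
      exact DFunLike.congr_fun this (⟨v, hv⟩ : K)
    · rw [AddMonoidHom.mem_ker]
      ext v
      exact w.2.2 v v.2
  have h3 : Nat.card φ.range = Nat.card Φ := rfl
  rw [h2, h3, Module.natCard_eq_pow_finrank (K := F) (V := W),
    Module.natCard_eq_pow_finrank (K := F) (V := Φ),
    Module.natCard_eq_pow_finrank (K := F) (V := (W ⊓ leftPerp B K : Submodule F V)),
    ← pow_add] at h1
  have h4 := Nat.pow_right_injective (Finite.one_lt_card (α := F)) h1
  have h5 := Subspace.finrank_add_finrank_dualCoannihilator_eq Φ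
  have h6 : finrank F (K ⊓ rightPerp B W : Submodule F V) ≤
      finrank F (Submodule.dualCoannihilator Φ) := by
    refine LinearMap.finrank_le_finrank_of_injective
      (f := { toFun := fun v => ⟨⟨v.1, v.2.1⟩, ?_⟩
              map_add' := fun _ _ => rfl
              map_smul' := fun _ _ => rfl }) ?_
    · rw [Submodule.mem_dualCoannihilator]
      rintro _ ⟨w, rfl⟩
      exact v.2.2 w w.2
    · intro v w h
      exact Subtype.ext (congrArg (fun z => z.1.1) h)
  omega

end Perp

/-! ### Invariant totally isotropic subspaces of an operator with scalar square -/

section Quadratic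

variable {F V : Type*} [Field F] [Finite F] [AddCommGroup V] [Module F V] [FiniteDimensional F V]

/-- Totally isotropic subspaces for a sesquilinear form. -/
def TotallyIsotropic {σ : F →+* F} (B : V →ₛₗ[σ] V →ₗ[F] F) (U : Submodule F V) : Prop :=
  ∀ u ∈ U, ∀ v ∈ U, B u v = 0

/-- `finrank_inf_rightPerp_le`, for `ε = 1`, and a trivial bound, for `ε = 0`. -/
theorem finrank_inf_rightPerp_add_le {σ : F →+* F} (B : V →ₛₗ[σ] V →ₗ[F] F)
    (K W : Submodule F V) {ε z : ℕ}
    (hε : ε = 0 ∨ ε = 1 ∧ finrank F (W ⊓ leftPerp B K : Submodule F V) ≤ z) :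
    finrank F (K ⊓ rightPerp B W : Submodule F V) + ε * finrank F W ≤ finrank F K + ε * z := by
  rcases hε with rfl | ⟨rfl, h⟩
  · simpa using Submodule.finrank_mono inf_le_left
  · have := finrank_inf_rightPerp_le B K W
    omega

theorem finrank_inf_rightPerp_le_sub {σ : F →+* F} (B : V →ₛₗ[σ] V →ₗ[F] F)
    (K W : Submodule F V) {ε z : ℕ}
    (hε : ε = 0 ∨ ε = 1 ∧ finrank F (W ⊓ leftPerp B K : Submodule F V) ≤ z) {k : ℝ}
    (hK : (finrank F K : ℝ) ≤ k) :
    (finrank F (K ⊓ rightPerp B W : Submodule F V) : ℝ) ≤ k - ε * (finrank F W - z) := by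
  have h : ((finrank F (K ⊓ rightPerp B W : Submodule F V) + ε * finrank F W : ℕ) : ℝ) ≤
      (finrank F K + ε * z : ℕ) := by
    exact_mod_cast finrank_inf_rightPerp_add_le B K W hε
  push_cast at h
  linarith

theorem TotallyIsotropic.le_rightPerp {σ : F →+* F} {B : V →ₛₗ[σ] V →ₗ[F] F}
    {U W : Submodule F V} (h : TotallyIsotropic B U) (hW : W ≤ U) : U ≤ rightPerp B W :=
  fun u hu w hw => h w (hW hw) u hu

variable [Finite V]

/-- Each of two distinct proper subspaces may take `1/|F|` of `U`; something of the right size is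
left when `|F| ≥ 3`. -/
theorem le_ncard_diff_union {U K₁ K₂ : Submodule F V} (h₁ : ¬ U ≤ K₁) (h₂ : ¬ U ≤ K₂)
    (h : K₁ = K₂ ∨ 3 ≤ Nat.card F) :
    cardPow F (finrank F U - 1) ≤ ((U : Set V) \ (K₁ ∪ K₂ : Set V)).ncard := by
  rcases h with rfl | h
  · rw [Set.union_self]
    exact le_ncard_diff h₁
  · have aux : ∀ K : Submodule F V, ¬ U ≤ K →
        (((U ⊓ K : Submodule F V) : Set V).ncard : ℝ) ≤ cardPow F (finrank F U - 1) := by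
      intro K hK
      rw [ncard_submodule]
      apply cardPow_mono
      have h2 := Submodule.finrank_lt_finrank_of_lt (inf_lt_left.2 hK)
      have : ((finrank F (U ⊓ K : Submodule F V) + 1 : ℕ) : ℝ) ≤ finrank F U := by
        exact_mod_cast h2
      push_cast at this
      linarith
    have h3 : (U : Set V) = ((U : Set V) \ (K₁ ∪ K₂ : Set V)) ∪
        (((U ⊓ K₁ : Submodule F V) : Set V) ∪ ((U ⊓ K₂ : Submodule F V) : Set V)) := by
      ext x
      simp only [SetLike.mem_coe, Set.mem_union, Set.mem_sdiff, Submodule.mem_inf]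
      tauto
    have h4 : ((U : Set V).ncard : ℝ) ≤ ((U : Set V) \ (K₁ ∪ K₂ : Set V)).ncard +
        (((U ⊓ K₁ : Submodule F V) : Set V).ncard + ((U ⊓ K₂ : Submodule F V) : Set V).ncard) := by
      conv_lhs => rw [h3]
      exact_mod_cast (Set.ncard_union_le _ _).trans
        (Nat.add_le_add_left (Set.ncard_union_le _ _) _)
    have h5 : 3 * cardPow F (finrank F U - 1) ≤ (U : Set V).ncard := by
      rw [ncard_submodule]
      conv_rhs => rw [← sub_add_cancel (finrank F U : ℝ) 1, cardPow_add, cardPow_one]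
      rw [mul_comm]
      exact mul_le_mul_of_nonneg_left (by exact_mod_cast h) (cardPow_pos _).le
    linarith [aux K₁ h₁, aux K₂ h₂]

theorem le_or_le_of_subset_union {U K₁ K₂ : Submodule F V} (h : (U : Set V) ⊆ K₁ ∪ K₂) :
    U ≤ K₁ ∨ U ≤ K₂ := by
  by_contra! hc
  obtain ⟨⟨a, ha, ha'⟩, b, hb, hb'⟩ :=
    And.intro (SetLike.not_le_iff_exists.1 hc.1) (SetLike.not_le_iff_exists.1 hc.2)
  have ha2 : a ∈ K₂ := (h ha).resolve_left ha'
  have hb1 : b ∈ K₁ := (h hb).resolve_right hb'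
  rcases h (U.add_mem ha hb) with h1 | h1
  · exact ha' ((K₁.add_mem_iff_left hb1).1 h1)
  · exact hb' ((K₂.add_mem_iff_right ha2).1 h1)

theorem finrank_map_add_finrank_inf_ker {V' : Type*} [AddCommGroup V'] [Module F V']
    (f : V →ₗ[F] V') (W : Submodule F V) :
    finrank F (W.map f) + finrank F (W ⊓ LinearMap.ker f : Submodule F V) = finrank F W := by
  have h := LinearMap.finrank_range_add_finrank_ker (f.domRestrict W)
  have h1 : LinearMap.range (f.domRestrict W) = W.map f := by
    rw [LinearMap.domRestrict, LinearMap.range_comp, Submodule.range_subtype]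
  have h2 : finrank F (LinearMap.ker (f.domRestrict W)) =
      finrank F (W ⊓ LinearMap.ker f : Submodule F V) := by
    rw [LinearMap.domRestrict, LinearMap.ker_comp, ← Submodule.map_comap_subtype,
      Submodule.finrank_map_subtype_eq]
  rw [← h1, ← h2, h]

variable {σ : F →+* F} (B : V →ₛₗ[σ] V →ₗ[F] F) (y : V →ₗ[F] V) (η : F)

/-- Since `(y + a)(y - a) = η - a²`, a vector that is an eigenvector modulo `W` for `a` with `a² ≠
η` is already in `W`. Hence only the square roots of `η` matter; when there are none, `l = 0`
serves. -/
theorem exists_root_of_sq_eq_smul (hy : ∀ v, y (y v) = η • v) :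
    ∃ l : F, ∀ W : Submodule F V, (∀ w ∈ W, y w ∈ W) → ∀ u, (∃ a : F, y u - a • u ∈ W) →
      y u - l • u ∈ W ∨ y u - (-l) • u ∈ W := by
  have aux : ∀ a : F, a * a ≠ η → ∀ W : Submodule F V, (∀ w ∈ W, y w ∈ W) →
      ∀ u, y u - a • u ∈ W → u ∈ W := by
    intro a ha W hW u hu
    have h1 : (η - a * a) • u ∈ W := by
      have h2 := W.add_mem (hW _ hu) (W.smul_mem a hu)
      rw [map_sub, map_smul, hy] at h2
      convert h2 using 1
      rw [smul_sub, sub_smul, mul_smul]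
      abel
    exact (W.smul_mem_iff (sub_ne_zero.2 ha.symm)).1 h1
  by_cases hl : ∃ l : F, l * l = η
  · obtain ⟨l, hl⟩ := hl
    refine ⟨l, fun W hW u ⟨a, ha⟩ => ?_⟩
    by_cases ha2 : a * a = η
    · rcases mul_self_eq_mul_self_iff.1 (ha2.trans hl.symm) with rfl | rfl
      · exact Or.inl ha
      · exact Or.inr ha
    · have := aux a ha2 W hW u ha
      exact Or.inl (W.sub_mem (hW u this) (W.smul_mem _ this))
  · refine ⟨0, fun W hW u ⟨a, ha⟩ => Or.inl ?_⟩
    have := aux a (fun h => hl ⟨a, h⟩) W hW u ha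
    exact W.sub_mem (hW u this) (W.smul_mem _ this)

/-- The number of invariant totally isotropic subspaces of dimension `m` that contain `W`. -/
def quadFamily (W : Submodule F V) (m : ℕ) : Set (Submodule F V) :=
  {U | W ≤ U ∧ (∀ u ∈ U, y u ∈ U) ∧ TotallyIsotropic B U ∧ finrank F U = m}

variable {η} {ε : ℕ} {k : ℝ}

/-- The remaining case, in which `y` acts on `U / W` as the scalar `l`. Such a `U` is `W ⊔ (U ⊓ E)`
for the eigenspace `E` of `l`, so it is enough to count the subspaces `U ⊓ E` between `W ⊓ E` and `E
⊓ rightPerp B W`. -/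
theorem ncard_quadFamily_of_le_comap (hy : ∀ v, y (y v) = η • v)
    (hε : ε = 0 ∨ ε = 1 ∧ (∀ w, (∀ v, B w v = 0) → w = 0) ∧
      ∀ a : F, ∃ b : F, ∀ w, (∀ v, B w (y v - a • v) = 0) → y w = b • w)
    (hE : ∀ a : F, (finrank F (End.eigenspace y a) : ℝ) ≤ k)
    {W : Submodule F V} {i d m : ℕ} (hW : finrank F W = 2 * i) (hm : 2 * i + d = m) (hd : 0 < d)
    (hWy : ∀ w ∈ W, y w ∈ W)
    (hWE : ∀ a : F, finrank F (W ⊓ End.eigenspace y a : Submodule F V) ≤ i) (l : F) :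
    ({U ∈ quadFamily B y W m | ∀ u ∈ U, y u - l • u ∈ W}.ncard : ℝ) ≤
      cardPow F (d * (k - (1 + ε) * i - d + 1)) := by
  set E := End.eigenspace y l with hEdef
  have hmemE : ∀ v, v ∈ E ↔ y v = l • v := fun v => End.mem_eigenspace_iff
  by_cases hne : {U ∈ quadFamily B y W m | ∀ u ∈ U, y u - l • u ∈ W} = ∅
  · rw [hne, Set.ncard_empty, Nat.cast_zero]
    exact (cardPow_pos _).le
  obtain ⟨U₀, ⟨hU₀, hU₀y, -, hU₀m⟩, hU₀l⟩ := Set.nonempty_iff_ne_empty.2 hne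
  have hl : l * l = η := by
    by_contra hl
    have : U₀ ≤ W := by
      intro u hu
      have h2 := W.add_mem (hWy _ (hU₀l u hu)) (W.smul_mem l (hU₀l u hu))
      rw [map_sub, map_smul, hy] at h2
      have h1 : (η - l * l) • u ∈ W := by
        convert h2 using 1
        rw [smul_sub, sub_smul, mul_smul]
        abel
      exact (W.smul_mem_iff (sub_ne_zero.2 (Ne.symm hl))).1 h1
    have := Submodule.finrank_mono this
    omega
  -- the image of `W` under `y - l`
  let f : V →ₗ[F] V := y - l • LinearMap.id
  have hf : ∀ v, f v = y v - l • v := fun _ => rfl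
  have hfE : LinearMap.ker f = E := by
    ext v
    rw [LinearMap.mem_ker, hf, hmemE, sub_eq_zero]
  have hfW : W.map f ≤ W ⊓ End.eigenspace y (-l) := by
    rintro _ ⟨w, hw, rfl⟩
    refine ⟨W.sub_mem (hWy w hw) (W.smul_mem _ hw), ?_⟩
    rw [SetLike.mem_coe, End.mem_eigenspace_iff, hf, map_sub, map_smul, hy, ← hl, smul_sub, neg_smul,
      neg_smul, mul_smul]
    abel
  -- The kernel and the image of `y - l` on `W` have dimension at most `i` each and `2 * i`
  -- together, so both bounds are attained and `(y - l) W` is all of `W ⊓ eigenspace (-l)`.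
  have hrank := finrank_map_add_finrank_inf_ker f W
  rw [hfE] at hrank
  have hle1 := Submodule.finrank_mono hfW
  have hle2 := hWE (-l)
  have hle3 : finrank F (W ⊓ E : Submodule F V) ≤ i := hWE l
  have hWEi : finrank F (W ⊓ E : Submodule F V) = i := by omega
  have hmap : W.map f = W ⊓ End.eigenspace y (-l) :=
    Submodule.eq_of_le_of_finrank_le hfW (by omega)
  have hdecomp : ∀ U ∈ {U ∈ quadFamily B y W m | ∀ u ∈ U, y u - l • u ∈ W}, U = W ⊔ (U ⊓ E) := by
    rintro U ⟨⟨hWU, hUy, -, -⟩, hUl⟩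
    refine le_antisymm (fun u hu => ?_) (sup_le hWU inf_le_left)
    have h1 : f u ∈ W ⊓ End.eigenspace y (-l) := by
      refine ⟨hUl u hu, ?_⟩
      rw [SetLike.mem_coe, End.mem_eigenspace_iff, hf, map_sub, map_smul, hy, ← hl, smul_sub,
        neg_smul, neg_smul, mul_smul]
      abel
    rw [← hmap] at h1
    obtain ⟨w, hw, hwu⟩ := h1
    have h2 : u - w ∈ U ⊓ E := by
      refine ⟨U.sub_mem hu (hWU hw), ?_⟩
      rw [SetLike.mem_coe, ← hfE, LinearMap.mem_ker, map_sub, hwu, sub_self]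
    rw [← add_sub_cancel w u]
    exact Submodule.add_mem_sup hw h2
  have hinj : Set.InjOn (fun U => U ⊓ E)
      {U ∈ quadFamily B y W m | ∀ u ∈ U, y u - l • u ∈ W} := by
    intro U hU U' hU' h
    rw [hdecomp U hU, hdecomp U' hU']
    exact congrArg _ h
  have hK : (finrank F (E ⊓ rightPerp B W : Submodule F V) : ℝ) ≤ k - ε * i := by
    refine (finrank_inf_rightPerp_le_sub B E W (ε := ε) (z := i) ?_ (hE l)).trans (le_of_eq ?_)
    · rcases hε with h | ⟨h, -, h2⟩
      · exact Or.inl h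
      · refine Or.inr ⟨h, ?_⟩
        -- The image of `y + l` lies in `E`, so vectors left orthogonal to `E` satisfy the
        -- hypothesis for `a = -l` and are eigenvectors.
        obtain ⟨b, hb⟩ := h2 (-l)
        refine le_trans (Submodule.finrank_mono (inf_le_inf_left W fun w hw => ?_)) (hWE b)
        rw [End.mem_eigenspace_iff]
        refine hb w fun v => hw _ ?_
        rw [hmemE, map_sub, map_smul, hy, ← hl]
        module
    · rw [hW]
      push_cast
      ring
  have hcard := ncard_between_le hK d (W ⊓ E) (m - i) (by omega)
  rw [← hinj.ncard_image]
  refine le_trans (Nat.cast_le.2 (Set.ncard_le_ncard ?_)) (hcard.trans (le_of_eq ?_))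
  · rintro _ ⟨U, hU, rfl⟩
    have hd := hdecomp U hU
    obtain ⟨⟨hWU, hUy, hUB, hUm⟩, hUl⟩ := hU
    refine ⟨inf_le_inf_right _ hWU, le_inf inf_le_right
      (inf_le_left.trans (hUB.le_rightPerp hWU)), ?_⟩
    have h1 := Submodule.finrank_sup_add_finrank_inf_eq W (U ⊓ E)
    rw [← hd, ← inf_assoc, inf_eq_left.2 hWU] at h1
    simp only
    omega
  · congr 1
    have : ((m - i : ℕ) : ℝ) = i + d := by
      rw [show m - i = i + d by omega]
      push_cast
      ring
    rw [this]
    ring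

/-- A good `u` is one that is not an eigenvector modulo `W`; it adds the plane of `u` and `y u`. The
quadratic part of the exponent is the total cost when `U` consists of such planes only. -/
theorem ncard_quadFamily_le (hy : ∀ v, y (y v) = η • v)
    (hε : ε = 0 ∨ ε = 1 ∧ (∀ w, (∀ v, B w v = 0) → w = 0) ∧
      ∀ a : F, ∃ b : F, ∀ w, (∀ v, B w (y v - a • v) = 0) → y w = b • w)
    (hV : (finrank F V : ℝ) ≤ 2 * k)
    (hE : ∀ a : F, (finrank F (End.eigenspace y a) : ℝ) ≤ k) (d : ℕ) :
    ∀ (W : Submodule F V) (i m : ℕ), finrank F W = 2 * i → 2 * i + d = m →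
      (∀ w ∈ W, y w ∈ W) →
      (∀ a : F, finrank F (W ⊓ End.eigenspace y a : Submodule F V) ≤ i) →
      ((quadFamily B y W m).ncard : ℝ) ≤
        cardPow F (d * (k - (1 + ε) * i) - (1 / 2 + ε / 4) * d ^ 2 + 3 * d) := by
  induction d using Nat.strong_induction_on with
  | _ d ih =>
  intro W i m hW hm hWy hWE
  have hεle : (ε : ℝ) ≤ 1 := by
    rcases hε with rfl | ⟨rfl, -⟩ <;> norm_num
  have hε0 : (0 : ℝ) ≤ ε := ε.cast_nonneg
  rcases Nat.eq_zero_or_pos d with rfl | hd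
  · refine (ncard_le_one_of_finrank_eq (W := W) ?_).trans (le_of_eq ?_)
    · rintro U ⟨h1, -, -, h2⟩
      exact ⟨h1, by omega⟩
    · simp [cardPow_zero]
  have hd1 : (1 : ℝ) ≤ d := by exact_mod_cast hd
  have hmR : (m : ℝ) = 2 * i + d := by exact_mod_cast hm.symm
  obtain ⟨l, hl⟩ := exists_root_of_sq_eq_smul y η hy
  let K : F → Submodule F V := fun a => W.comap (y - a • LinearMap.id)
  have hKmem : ∀ a u, u ∈ K a ↔ y u - a • u ∈ W := fun _ _ => Iff.rfl
  refine ncard_le_of_witness_or (A := quadFamily B y W m)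
    (P := fun U => ∃ u ∈ U, ∀ a : F, y u - a • u ∉ W)
    (T := ((⊤ ⊓ rightPerp B W : Submodule F V) : Set V))
    (fun U => {u | u ∈ U ∧ ∀ a : F, y u - a • u ∉ W})
    (t := 2 * k - ε * (2 * i)) (s := m - 1)
    (b := (d - 2 : ℝ) * (k - (1 + ε) * (i + 1)) - (1 / 2 + ε / 4) * (d - 2 : ℝ) ^ 2 + 3 * (d - 2))
    (c := d * (k - (1 + ε) * i - d + 1) + 1) ?_ ?_ ?_ ?_ ?_ ?_
  · rw [ncard_submodule]
    apply cardPow_mono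
    refine (finrank_inf_rightPerp_le_sub B ⊤ W (ε := ε) (z := 0) ?_
      (k := 2 * k) (by rw [finrank_top]; exact hV)).trans (le_of_eq ?_)
    · rcases hε with h | ⟨h, h2, -⟩
      · exact Or.inl h
      · refine Or.inr ⟨h, ?_⟩
        have : W ⊓ leftPerp B ⊤ = ⊥ := by
          rw [Submodule.eq_bot_iff]
          rintro w ⟨-, hw⟩
          exact h2 w fun v => hw v trivial
        rw [this, finrank_bot]
    · rw [hW]
      push_cast
      ring
  · rintro U ⟨hWU, -, hUB, -⟩ - u ⟨hu, -⟩
    exact ⟨trivial, hUB.le_rightPerp hWU hu⟩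
  · rintro U ⟨hWU, hUy, hUB, hUm⟩ ⟨u₀, hu₀, hu₀'⟩
    -- The bad vectors form `K l ∪ K (-l)`. If `l ≠ -l`, then `0`, `l`, `-l` are three elements of
    -- `F`.
    have h1 : (K l = K (-l)) ∨ 3 ≤ Nat.card F := by
      by_cases hll : l = -l
      · exact Or.inl (congrArg K hll)
      · right
        have hl0 : l ≠ 0 := fun h => hll (by simp [h])
        have hc : ({0, l, -l} : Set F).ncard = 3 := by
          rw [Set.ncard_eq_three]
          exact ⟨0, l, -l, hl0.symm, (neg_ne_zero.2 hl0).symm, hll, rfl⟩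
        rw [← hc, ← Set.ncard_univ]
        exact Set.ncard_le_ncard (Set.subset_univ _)
    have h2 := le_ncard_diff_union (U := U) (K₁ := K l) (K₂ := K (-l))
      (fun h => hu₀' l (h hu₀)) (fun h => hu₀' (-l) (h hu₀)) h1
    rw [hUm] at h2
    refine h2.trans (Nat.cast_le.2 (Set.ncard_le_ncard ?_))
    rintro u ⟨hu, hu'⟩
    refine ⟨hu, fun a ha => hu' ?_⟩
    exact hl W hWy u ⟨a, ha⟩
  · rintro u - ⟨U, ⟨hWU, hUy, hUB, hUm⟩, -, hu, hu'⟩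
    have hu1 : u ∉ W := fun h => hu' 0 (by simpa using hWy u h)
    have hu2 : y u ∉ W ⊔ F ∙ u := by
      intro h
      obtain ⟨w, hw, z, hz, hwz⟩ := Submodule.mem_sup.1 h
      obtain ⟨a, rfl⟩ := Submodule.mem_span_singleton.1 hz
      refine hu' a ?_
      rw [← hwz, add_sub_cancel_right]
      exact hw
    set W' := W ⊔ F ∙ u ⊔ F ∙ y u with hW'
    have hrW' : finrank F W' = 2 * (i + 1) := by
      rw [hW', finrank_sup_span_singleton hu2, finrank_sup_span_singleton hu1]
      omega
    have hWW' : W ≤ W' := le_sup_left.trans le_sup_left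
    have huW' : u ∈ W' :=
      Submodule.mem_sup_left (Submodule.mem_sup_right (Submodule.mem_span_singleton_self u))
    have hyuW' : y u ∈ W' := Submodule.mem_sup_right (Submodule.mem_span_singleton_self _)
    have hleW' : ∀ U' : Submodule F V, W ≤ U' → (∀ v ∈ U', y v ∈ U') → u ∈ U' → W' ≤ U' :=
      fun U' h1 h2 h3 => sup_le (sup_le h1 ((Submodule.span_singleton_le_iff_mem _ _).2 h3))
        ((Submodule.span_singleton_le_iff_mem _ _).2 (h2 _ h3))
    have hle := Submodule.finrank_mono (hleW' U hWU hUy hu)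
    have hd2 : 2 ≤ d := by omega
    have hyW' : ∀ w ∈ W', y w ∈ W' := by
      have : W' ≤ W'.comap y := by
        refine sup_le (sup_le (fun w hw => hWW' (hWy w hw)) ?_) ?_
        · exact (Submodule.span_singleton_le_iff_mem _ _).2 hyuW'
        · refine (Submodule.span_singleton_le_iff_mem _ _).2 ?_
          rw [Submodule.mem_comap, hy]
          exact W'.smul_mem _ huW'
      exact this
    -- An increase by two would give `W' = W ⊔ (W' ⊓ E)`, and then `u` would be an eigenvector
    -- modulo `W`.
    have hEW' : ∀ a : F, finrank F (W' ⊓ End.eigenspace y a : Submodule F V) ≤ i + 1 := by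
      intro a
      have h1 := Submodule.finrank_sup_add_finrank_inf_eq W (W' ⊓ End.eigenspace y a)
      have h2 : W ⊔ W' ⊓ End.eigenspace y a < W' := by
        refine lt_of_le_of_ne (sup_le hWW' inf_le_left) fun h => hu' a ?_
        rw [← h] at huW'
        obtain ⟨w, hw, z, hz, rfl⟩ := Submodule.mem_sup.1 huW'
        have hz2 := End.mem_eigenspace_iff.1 hz.2
        rw [map_add, hz2, smul_add, add_sub_add_right_eq_sub]
        exact W.sub_mem (hWy w hw) (W.smul_mem _ hw)
      have h3 := Submodule.finrank_lt_finrank_of_lt h2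
      rw [← inf_assoc, inf_eq_left.2 hWW'] at h1
      have h4 := hWE a
      omega
    have hih := ih (d - 2) (by omega) W' (i + 1) m hrW' (by omega) hyW' hEW'
    rw [Nat.cast_sub hd2] at hih
    push_cast at hih
    constructor
    · refine le_trans (Nat.cast_le.2 (Set.ncard_le_ncard ?_)) hih
      rintro U' ⟨⟨h1, h2, h3, h4⟩, -, h5, -⟩
      exact ⟨hleW' U' h1 h2 h5, h2, h3, h4⟩
    · rw [hmR]
      nlinarith
  · have hsub : {U ∈ quadFamily B y W m | ¬ ∃ u ∈ U, ∀ a : F, y u - a • u ∉ W} ⊆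
        {U ∈ quadFamily B y W m | ∀ u ∈ U, y u - l • u ∈ W} ∪
        {U ∈ quadFamily B y W m | ∀ u ∈ U, y u - (-l) • u ∈ W} := by
      rintro U ⟨hU, hU'⟩
      push Not at hU'
      -- A subspace covered by two subspaces lies in one of them, so one of `l` and `-l` serves for
      -- all of `U`.
      have h1 : (U : Set V) ⊆ (K l : Set V) ∪ K (-l) := fun u hu => hl W hWy u (hU' u hu)
      rcases le_or_le_of_subset_union h1 with h | h
      · exact Or.inl ⟨hU, h⟩
      · exact Or.inr ⟨hU, h⟩
    have h1 := ncard_quadFamily_of_le_comap B y hy hε hE hW hm hd hWy hWE l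
    have h2 := ncard_quadFamily_of_le_comap B y hy hε hE hW hm hd hWy hWE (-l)
    refine le_trans (Nat.cast_le.2 (Set.ncard_le_ncard hsub)) ?_
    refine le_trans (Nat.cast_le.2 (Set.ncard_union_le _ _)) ?_
    push_cast
    refine le_trans (add_le_add h1 h2) ?_
    rw [← two_mul]
    exact two_mul_cardPow_le _
  · nlinarith

/-- The bound for the number of invariant totally isotropic subspaces of dimension `m` of an
operator `y` whose square is a scalar and whose eigenspaces are not larger than half of the
space. -/
theorem ncard_invariant_of_sq_eq_smul (hy : ∀ v, y (y v) = η • v)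
    (hε : ε = 0 ∨ ε = 1 ∧ (∀ w, (∀ v, B w v = 0) → w = 0) ∧
      ∀ a : F, ∃ b : F, ∀ w, (∀ v, B w (y v - a • v) = 0) → y w = b • w)
    (hV : (finrank F V : ℝ) ≤ 2 * k)
    (hE : ∀ a : F, (finrank F (End.eigenspace y a) : ℝ) ≤ k) (m : ℕ) :
    ({U : Submodule F V | (∀ u ∈ U, y u ∈ U) ∧ TotallyIsotropic B U ∧
      finrank F U = m}.ncard : ℝ) ≤
        cardPow F (m * k - (1 / 2 + ε / 4) * m ^ 2 + 3 * m) := by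
  have h := ncard_quadFamily_le B y hy hε hV hE m ⊥ 0 m (by simp) (by simp)
    (by simp) (by simp)
  simpa [quadFamily] using h

end Quadratic

/-! ### Invariant totally isotropic subspaces of a nilpotent operator -/

section Nilpotent

variable {F V : Type*} [Field F] [Finite F] [AddCommGroup V] [Module F V] [FiniteDimensional F V]
  [Finite V]

/-- The smallest subspace that contains `u` and is invariant under `N`. -/
def cyclicSpan (N : End F V) (u : V) : Submodule F V :=
  Submodule.span F (Set.range fun i : ℕ => (N ^ i) u)

theorem pow_apply_mem_cyclicSpan (N : End F V) (u : V) (i : ℕ) : (N ^ i) u ∈ cyclicSpan N u :=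
  Submodule.subset_span ⟨i, rfl⟩

theorem pow_apply_mem_of_invariant {N : End F V} {U : Submodule F V} (hU : ∀ v ∈ U, N v ∈ U)
    {u : V} (hu : u ∈ U) (i : ℕ) : (N ^ i) u ∈ U := by
  induction i with
  | zero => exact hu
  | succ i ih => rw [pow_succ', Module.End.mul_apply]; exact hU _ ih

theorem cyclicSpan_le {N : End F V} {U : Submodule F V} (hU : ∀ v ∈ U, N v ∈ U) {u : V}
    (hu : u ∈ U) : cyclicSpan N u ≤ U := by
  refine Submodule.span_le.2 ?_
  rintro _ ⟨i, rfl⟩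
  exact pow_apply_mem_of_invariant hU hu i

theorem map_pow_cyclicSpan (N : End F V) (u : V) (a : ℕ) :
    (cyclicSpan N u).map (N ^ a) = cyclicSpan N ((N ^ a) u) := by
  rw [cyclicSpan, cyclicSpan, Submodule.map_span, ← Set.range_comp]
  congr 2
  ext i
  simp only [Function.comp_apply, ← Module.End.mul_apply, ← pow_add, add_comm]

theorem cyclicSpan_eq (N : End F V) (u : V) : cyclicSpan N u = cyclicSpan N (N u) ⊔ F ∙ u := by
  apply le_antisymm
  · refine Submodule.span_le.2 ?_
    rintro _ ⟨i, rfl⟩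
    cases i with
    | zero => exact Submodule.mem_sup_right (Submodule.mem_span_singleton_self u)
    | succ i =>
      refine Submodule.mem_sup_left ?_
      simp only [pow_succ, Module.End.mul_apply]
      exact pow_apply_mem_cyclicSpan N (N u) i
  · refine sup_le (Submodule.span_le.2 ?_) ?_
    · rintro _ ⟨i, rfl⟩
      simp only [← Module.End.mul_apply, ← pow_succ]
      exact pow_apply_mem_cyclicSpan N u (i + 1)
    · exact (Submodule.span_singleton_le_iff_mem _ _).2 (pow_apply_mem_cyclicSpan N u 0)

theorem invariant_sup_cyclicSpan {N : End F V} {W : Submodule F V} (hW : ∀ v ∈ W, N v ∈ W) (u : V) :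
    ∀ v ∈ W ⊔ cyclicSpan N u, N v ∈ W ⊔ cyclicSpan N u := by
  have : W ⊔ cyclicSpan N u ≤ (W ⊔ cyclicSpan N u).comap N := by
    refine sup_le (fun v hv => Submodule.mem_sup_left (hW v hv)) (Submodule.span_le.2 ?_)
    rintro _ ⟨i, rfl⟩
    refine Submodule.mem_sup_right ?_
    simp only [← Module.End.mul_apply, ← pow_succ']
    exact pow_apply_mem_cyclicSpan N u (i + 1)
  exact this

/-- If `a` is the first exponent with `N ^ a u` in `W`, then `u, N u, …, N ^ (a - 1) u` are
independent modulo `W`: the power `N ^ (a - 1)` sends the span of `W` and of the later ones into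
`W`, but not `u`. -/
theorem finrank_sup_cyclicSpan {N : End F V} {W : Submodule F V} (hW : ∀ v ∈ W, N v ∈ W) (a : ℕ) :
    ∀ u, (N ^ a) u ∈ W → (a = 0 ∨ (N ^ (a - 1)) u ∉ W) →
      finrank F (W ⊔ cyclicSpan N u : Submodule F V) = finrank F W + a := by
  induction a with
  | zero =>
    intro u hu _
    rw [sup_eq_left.2 (cyclicSpan_le hW (show u ∈ W from hu)), add_zero]
  | succ a ih =>
    intro u hu hu'
    replace hu' := hu'.resolve_left (Nat.succ_ne_zero a)
    rw [Nat.add_sub_cancel] at hu'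
    rw [pow_succ, Module.End.mul_apply] at hu
    have h1 := ih (N u) hu (by
      rcases Nat.eq_zero_or_pos a with h | h
      · exact Or.inl h
      · right
        rw [← Module.End.mul_apply, ← pow_succ, Nat.sub_add_cancel h]
        exact hu')
    rw [cyclicSpan_eq, ← sup_assoc, finrank_sup_span_singleton, h1, add_assoc]
    intro hmem
    have h2 : W ⊔ cyclicSpan N (N u) ≤ W.comap (N ^ a) := by
      refine sup_le (fun v hv => pow_apply_mem_of_invariant hW hv a) (Submodule.span_le.2 ?_)
      rintro _ ⟨i, rfl⟩
      rw [SetLike.mem_coe, Submodule.mem_comap, ← Module.End.mul_apply, ← pow_add, add_comm,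
        pow_add, Module.End.mul_apply]
      exact pow_apply_mem_of_invariant hW hu i
    exact hu' (h2 hmem)

theorem invariant_map_pow {N : End F V} {W : Submodule F V} (hW : ∀ v ∈ W, N v ∈ W) (i : ℕ) :
    ∀ v ∈ W.map (N ^ i), N v ∈ W.map (N ^ i) := by
  rintro _ ⟨w, hw, rfl⟩
  refine ⟨N w, hW w hw, ?_⟩
  rw [← Module.End.mul_apply, ← Module.End.mul_apply, ← pow_succ, ← pow_succ']

theorem map_pow_le {N : End F V} {W : Submodule F V} (hW : ∀ v ∈ W, N v ∈ W) (i : ℕ) :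
    W.map (N ^ i) ≤ W := by
  rintro _ ⟨w, hw, rfl⟩
  exact pow_apply_mem_of_invariant hW hw i

theorem finrank_map_sup_cyclicSpan {N : End F V} {W : Submodule F V} (hW : ∀ v ∈ W, N v ∈ W)
    {a : ℕ} {u : V} (hu : (N ^ a) u = 0) (hu' : (N ^ (a - 1)) u ∉ W) (i : ℕ) :
    finrank F ((W ⊔ cyclicSpan N u).map (N ^ i)) = finrank F (W.map (N ^ i)) + (a - i) := by
  rw [Submodule.map_sup, map_pow_cyclicSpan]
  refine finrank_sup_cyclicSpan (invariant_map_pow hW i) (a - i) _ ?_ ?_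
  · rw [← Module.End.mul_apply, ← pow_add]
    rw [show a - i + i = (i - a) + a by omega, pow_add, Module.End.mul_apply, hu, map_zero]
    exact Submodule.zero_mem _
  · by_cases h : a ≤ i
    · exact Or.inl (by omega)
    · right
      rw [← Module.End.mul_apply, ← pow_add, show a - i - 1 + i = a - 1 by omega]
      exact fun h => hu' (map_pow_le hW i h)

variable {σ : F →+* F} (B : V →ₛₗ[σ] V →ₗ[F] F) (N : End F V)

/-- The invariant totally isotropic subspaces of dimension `m` that contain `W` and have the same
image as `W` under `N ^ a`. -/
def nilFamily (W : Submodule F V) (a m : ℕ) : Set (Submodule F V) :=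
  {U | W ≤ U ∧ (∀ u ∈ U, N u ∈ U) ∧ TotallyIsotropic B U ∧ finrank F U = m ∧
    U.map (N ^ a) ≤ W.map (N ^ a)}

variable {B N} {ε : ℕ} {k : ℝ}

/-- The kernel of `N ^ a` contains the image of `N ^ (e - a)`, so the vectors of `W` orthogonal to
it are killed by `N ^ (e - a)`. The loss of dimension is therefore at least that of `N ^ (e - a) W`.
-/
theorem finrank_ker_pow_inf_rightPerp_le {e : ℕ}
    (hε : ε = 0 ∨ ε = 1 ∧ ∀ a w, (∀ v, B w ((N ^ a) v) = 0) → (N ^ a) w = 0)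
    (hN : N ^ e = 0) {a : ℕ} (ha : a ≤ e)
    (hk : (finrank F (LinearMap.ker (N ^ a)) : ℝ) ≤ a * k) (W : Submodule F V) :
    (finrank F (LinearMap.ker (N ^ a) ⊓ rightPerp B W : Submodule F V) : ℝ) ≤
      a * k - ε * finrank F (W.map (N ^ (e - a))) := by
  have hr := finrank_map_add_finrank_inf_ker (N ^ (e - a)) W
  refine (finrank_inf_rightPerp_le_sub B _ W (ε := ε)
    (z := finrank F (W ⊓ LinearMap.ker (N ^ (e - a)) : Submodule F V)) ?_ hk).trans (le_of_eq ?_)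
  · rcases hε with h | ⟨h, h2⟩
    · exact Or.inl h
    · refine Or.inr ⟨h, Submodule.finrank_mono (inf_le_inf_left W fun w hw => ?_)⟩
      refine h2 _ w fun v => hw _ ?_
      rw [LinearMap.mem_ker, ← Module.End.mul_apply, ← pow_add, Nat.add_sub_cancel' ha, hN,
        LinearMap.zero_apply]
  · rw [← hr]
    push_cast
    ring

/-- What the absence of good vectors means. The hypothesis `hdim` says that all blocks of `W` have
size at least `a + 1`, so that the kernel of `N` on `W` lies in `N ^ a W`. If `N ^ (a + 1)` agrees
on `u` and `w`, then `N ^ a (u - w)` is in this kernel. -/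
theorem map_pow_le_map_pow_of_forall {W U : Submodule F V} {a : ℕ} (hWU : W ≤ U)
    (hWN : ∀ v ∈ W, N v ∈ W)
    (hdim : finrank F W + finrank F (W.map (N ^ (a + 1))) =
      finrank F (W.map N) + finrank F (W.map (N ^ a)))
    (hU : U.map (N ^ (a + 1)) ≤ W.map (N ^ (a + 1)))
    (h : ∀ u ∈ U, (N ^ (a + 1)) u = 0 → (N ^ a) u ∈ W) : U.map (N ^ a) ≤ W.map (N ^ a) := by
  have h1 := finrank_map_add_finrank_inf_ker N W
  have h2 := finrank_map_add_finrank_inf_ker N (W.map (N ^ a))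
  have h3 : (W.map (N ^ a)).map N = W.map (N ^ (a + 1)) := by
    rw [← Submodule.map_comp, pow_succ']
    rfl
  rw [h3] at h2
  have h4 : W.map (N ^ a) ⊓ LinearMap.ker N = W ⊓ LinearMap.ker N :=
    Submodule.eq_of_le_of_finrank_le (inf_le_inf_right _ (map_pow_le hWN a)) (by omega)
  rintro _ ⟨u, hu, rfl⟩
  obtain ⟨w, hw, hwu⟩ := hU ⟨u, hu, rfl⟩
  have h5 : (N ^ (a + 1)) (u - w) = 0 := by rw [map_sub, hwu, sub_self]
  have h6 : (N ^ a) (u - w) ∈ W ⊓ LinearMap.ker N := by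
    refine ⟨h _ (U.sub_mem hu (hWU hw)) h5, ?_⟩
    rw [SetLike.mem_coe, LinearMap.mem_ker, ← Module.End.mul_apply, ← pow_succ']
    exact h5
  rw [← h4] at h6
  rw [← sub_add_cancel u w, map_add]
  exact Submodule.add_mem _ h6.1 ⟨w, hw, rfl⟩

theorem finrank_inf_ker_pow {W U : Submodule F V} {a : ℕ} (hWU : W ≤ U)
    (hU : U.map (N ^ a) ≤ W.map (N ^ a)) :
    finrank F (W.map (N ^ a)) + finrank F (U ⊓ LinearMap.ker (N ^ a) : Submodule F V) =
      finrank F U := by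
  rw [← finrank_map_add_finrank_inf_ker (N ^ a) U, le_antisymm hU (Submodule.map_mono hWU)]

/-- One step of the count: a good `u` starts a block of size `a + 1` independent of `W`, and the
subspaces without good `u` have only smaller blocks outside `W`. The good vectors of `U` are those
of `U ⊓ ker (N ^ (a + 1))` outside a proper subspace. -/
theorem ncard_nilFamily_le_of_step {n : ℕ}
    (hε : ε = 0 ∨ ε = 1 ∧ ∀ a w, (∀ v, B w ((N ^ a) v) = 0) → (N ^ a) w = 0)
    (hN : N ^ n = 0) {a : ℕ} (ha : a + 1 ≤ n)
    (hk : (finrank F (LinearMap.ker (N ^ (a + 1))) : ℝ) ≤ (a + 1 : ℕ) * k) {W : Submodule F V}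
    {m : ℕ} (hWN : ∀ v ∈ W, N v ∈ W)
    (hdim : finrank F W + finrank F (W.map (N ^ (a + 1))) =
      finrank F (W.map N) + finrank F (W.map (N ^ a))) {b c e : ℝ}
    (hb : ∀ u, (N ^ (a + 1)) u = 0 → (N ^ a) u ∉ W →
      finrank F (W ⊔ cyclicSpan N u : Submodule F V) ≤ m →
      ((nilFamily B N (W ⊔ cyclicSpan N u) (a + 1) m).ncard : ℝ) ≤ cardPow F b ∧
      (a + 1 : ℕ) * k - ε * finrank F (W.map (N ^ (n - (a + 1)))) -
        (m - finrank F (W.map (N ^ (a + 1))) - 1) + b + 1 ≤ e)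
    (hc : ((nilFamily B N W a m).ncard : ℝ) ≤ cardPow F c) (hce : c + 1 ≤ e) :
    ((nilFamily B N W (a + 1) m).ncard : ℝ) ≤ cardPow F e := by
  refine ncard_le_of_witness_or (A := nilFamily B N W (a + 1) m)
    (P := fun U => ∃ u ∈ U, (N ^ (a + 1)) u = 0 ∧ (N ^ a) u ∉ W)
    (T := ((LinearMap.ker (N ^ (a + 1)) ⊓ rightPerp B W : Submodule F V) : Set V))
    (fun U => {u | u ∈ U ∧ (N ^ (a + 1)) u = 0 ∧ (N ^ a) u ∉ W})
    (ncard_submodule_le (finrank_ker_pow_inf_rightPerp_le hε hN ha hk W))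
    (s := m - finrank F (W.map (N ^ (a + 1))) - 1) (b := b) (c := c) ?_ ?_ ?_ ?_ hce
  · rintro U ⟨hWU, -, hUB, -, -⟩ - u ⟨hu, hu', -⟩
    exact ⟨hu', hUB.le_rightPerp hWU hu⟩
  · rintro U ⟨hWU, hUN, hUB, hUm, hUa⟩ ⟨u, hu, hu1, hu2⟩
    have h1 := finrank_inf_ker_pow hWU hUa
    have h2 := le_ncard_diff (U := U ⊓ LinearMap.ker (N ^ (a + 1))) (K := W.comap (N ^ a))
      (fun h => hu2 (h ⟨hu, hu1⟩))
    have h3 : ((finrank F (W.map (N ^ (a + 1))) +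
        finrank F (U ⊓ LinearMap.ker (N ^ (a + 1)) : Submodule F V) : ℕ) : ℝ) = m := by
      rw [h1, hUm]
    push_cast at h3
    rw [show (m : ℝ) - finrank F (W.map (N ^ (a + 1))) =
      finrank F (U ⊓ LinearMap.ker (N ^ (a + 1)) : Submodule F V) by linarith]
    refine h2.trans (Nat.cast_le.2 (Set.ncard_le_ncard ?_))
    rintro v ⟨⟨hv, hv'⟩, hv2⟩
    exact ⟨hv, hv', hv2⟩
  · rintro u - ⟨U, ⟨hWU, hUN, hUB, hUm, hUa⟩, -, hu, hu1, hu2⟩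
    have hle : W ⊔ cyclicSpan N u ≤ U := sup_le hWU (cyclicSpan_le hUN hu)
    obtain ⟨h1, h2⟩ := hb u hu1 hu2 (hUm ▸ Submodule.finrank_mono hle)
    refine ⟨le_trans (Nat.cast_le.2 (Set.ncard_le_ncard ?_)) h1, h2⟩
    rintro U' ⟨⟨hWU', hUN', hUB', hUm', hUa'⟩, -, hu', -, -⟩
    exact ⟨sup_le hWU' (cyclicSpan_le hUN' hu'), hUN', hUB', hUm',
      hUa'.trans (Submodule.map_mono le_sup_left)⟩
  · refine le_trans (Nat.cast_le.2 (Set.ncard_le_ncard ?_)) hc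
    rintro U ⟨⟨hWU, hUN, hUB, hUm, hUa⟩, hU⟩
    refine ⟨hWU, hUN, hUB, hUm, map_pow_le_map_pow_of_forall hWU hWN hdim hUa ?_⟩
    intro u hu hu'
    by_contra h
    exact hU ⟨u, hu, hu', h⟩

/-- Here `N U = N W`, so `U` is determined by its intersection with the kernel of `N`. -/
theorem ncard_nilFamily_one_le {n : ℕ}
    (hε : ε = 0 ∨ ε = 1 ∧ ∀ a w, (∀ v, B w ((N ^ a) v) = 0) → (N ^ a) w = 0)
    (hN : N ^ n = 0) (hn : 1 ≤ n) (hk : (finrank F (LinearMap.ker N) : ℝ) ≤ k)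
    {W : Submodule F V} {m d : ℕ} (hm : finrank F W + d = m) :
    ((nilFamily B N W 1 m).ncard : ℝ) ≤ cardPow F
      (d * (k - ε * finrank F (W.map (N ^ (n - 1))) - (m - finrank F (W.map N)) + 1)) := by
  set E := LinearMap.ker N with hE
  have hdecomp : ∀ U ∈ nilFamily B N W 1 m, U = W ⊔ (U ⊓ E) := by
    rintro U ⟨hWU, hUN, hUB, hUm, hUa⟩
    refine le_antisymm (fun u hu => ?_) (sup_le hWU inf_le_left)
    obtain ⟨w, hw, hwu⟩ := hUa ⟨u, hu, rfl⟩
    rw [pow_one] at hwu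
    have h2 : u - w ∈ U ⊓ E := ⟨U.sub_mem hu (hWU hw), by
      rw [SetLike.mem_coe, hE, LinearMap.mem_ker, map_sub, hwu, sub_self]⟩
    rw [← add_sub_cancel w u]
    exact Submodule.add_mem_sup hw h2
  have hinj : Set.InjOn (fun U => U ⊓ E) (nilFamily B N W 1 m) := by
    intro U hU U' hU' h
    rw [hdecomp U hU, hdecomp U' hU']
    exact congrArg _ h
  have hr := finrank_map_add_finrank_inf_ker N W
  have hK := finrank_ker_pow_inf_rightPerp_le (k := k) hε hN hn
    (by rw [pow_one, Nat.cast_one, one_mul]; exact hk) W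
  rw [pow_one, Nat.cast_one, one_mul] at hK
  have hle := Submodule.finrank_mono (inf_le_left : W ⊓ E ≤ W)
  have hcard := ncard_between_le hK d (W ⊓ E) (m - finrank F (W.map N)) (by
    change finrank F (W.map N) + finrank F (W ⊓ E : Submodule F V) = _ at hr
    omega)
  rw [← hinj.ncard_image]
  refine le_trans (Nat.cast_le.2 (Set.ncard_le_ncard ?_)) (hcard.trans (le_of_eq ?_))
  · rintro _ ⟨U, ⟨hWU, hUN, hUB, hUm, hUa⟩, rfl⟩
    refine ⟨inf_le_inf_right _ hWU, le_inf inf_le_right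
      (inf_le_left.trans (hUB.le_rightPerp hWU)), ?_⟩
    have h1 := finrank_inf_ker_pow hWU hUa
    rw [pow_one] at h1
    simp only
    change finrank F (W.map N) + finrank F (U ⊓ E : Submodule F V) = _ at h1
    omega
  · rw [Nat.cast_sub (by omega)]

end Nilpotent

/-! ### ### The count for nilpotent operators with fourth power zero -/

section NilpotentFour

variable {F V : Type*} [Field F] [Finite F] [AddCommGroup V] [Module F V] [FiniteDimensional F V]
  [Finite V] {σ : F →+* F} {B : V →ₛₗ[σ] V →ₗ[F] F} {N : End F V} {ε : ℕ} {k : ℝ}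

/-- An invariant subspace with the image dimensions of a sum of `i`, `j` and `l` cyclic subspaces of
dimensions `4`, `3` and `2`. -/
structure HasBlocks (N : End F V) (W : Submodule F V) (i j l : ℕ) : Prop where
  invariant : ∀ v ∈ W, N v ∈ W
  finrank_zero : finrank F W = 4 * i + 3 * j + 2 * l
  finrank_one : finrank F (W.map N) = 3 * i + 2 * j + l
  finrank_two : finrank F (W.map (N ^ 2)) = 2 * i + j
  finrank_three : finrank F (W.map (N ^ 3)) = i
  
theorem HasBlocks.sup_cyclicSpan {W : Submodule F V} {i j l i' j' l' : ℕ}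
    (h : HasBlocks N W i j l) {a : ℕ} {u : V} (hu : (N ^ a) u = 0) (hu' : (N ^ (a - 1)) u ∉ W)
    (h0 : 4 * i' + 3 * j' + 2 * l' = 4 * i + 3 * j + 2 * l + a)
    (h1 : 3 * i' + 2 * j' + l' = 3 * i + 2 * j + l + (a - 1))
    (h2 : 2 * i' + j' = 2 * i + j + (a - 2)) (h3 : i' = i + (a - 3)) :
    HasBlocks N (W ⊔ cyclicSpan N u) i' j' l' := by
  have key := finrank_map_sup_cyclicSpan h.invariant hu hu'
  refine ⟨invariant_sup_cyclicSpan h.invariant u, ?_, ?_, ?_, ?_⟩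
  · have := key 0
    rw [pow_zero, show (1 : End F V) = LinearMap.id from rfl, Submodule.map_id, Submodule.map_id,
      h.finrank_zero] at this
    omega
  · have := key 1
    rw [pow_one, h.finrank_one] at this
    omega
  · have := key 2
    rw [h.finrank_two] at this
    omega
  · have := key 3
    rw [h.finrank_three] at this
    omega

/-- The exponent for the choice of `p` further dimensions in the kernel of `N`. -/
def nilCostOne (ε k i j l p : ℝ) : ℝ := p * (k - ε * i - (i + j + l + p))

/-- The exponent for the choice of `y` blocks of size `2` and then of `p` of size `1`. -/
def nilCostTwo (ε k i j l y p : ℝ) : ℝ :=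
  y * (2 * k - ε * (2 * i + j) - (2 * i + 2 * j + 2 * l + 2 * y + p)) +
    nilCostOne ε k i j (l + y) p

/-- The exponent for the choice of `x` blocks of size `3`, `y` of size `2` and `p` of size `1`. -/
def nilCostThree (ε k i j x y p : ℝ) : ℝ :=
  x * (3 * k - ε * (3 * i + 2 * j) - (3 * i + 3 * j + 3 * x + 2 * y + p)) - ε * x * (x - 1) +
    nilCostTwo ε k i (j + x) 0 y p

/-- The exponent for the choice of `r` blocks of size `4`, `x` of size `3`, `y` of size `2` and `p`
of size `1`. -/
def nilCostFour (ε k i r x y p : ℝ) : ℝ :=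
  r * (4 * k - 4 * ε * i - (4 * i + 4 * r + 3 * x + 2 * y + p)) - 2 * ε * r * (r - 1) +
    nilCostThree ε k (i + r) 0 x y p

variable (hε : ε = 0 ∨ ε = 1 ∧ ∀ a w, (∀ v, B w ((N ^ a) v) = 0) → (N ^ a) w = 0)
  (hN : N ^ 4 = 0) (hk : ∀ a : ℕ, (finrank F (LinearMap.ker (N ^ a)) : ℝ) ≤ a * k)

include hε hN hk

/-- A block of size two costs `2k - ε(2i + j) - (2i + 2j + 2l + d)`, and `θ` is lowered by this
amount in the induction; `nilCostTwo` satisfies the same recursion. The linear term absorbs the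
units lost in each step. The lemmas for sizes three and four follow the same pattern. -/
theorem ncard_nilFamily_two_le (d : ℕ) : ∀ (W : Submodule F V) (i j l m : ℕ) (θ : ℝ),
    HasBlocks N W i j l → 4 * i + 3 * j + 2 * l + d = m →
    (∀ y p : ℕ, 2 * y + p = d → nilCostTwo ε k i j l y p ≤ θ) →
    ((nilFamily B N W 2 m).ncard : ℝ) ≤ cardPow F (θ + 3 * d + 1) := by
  induction d using Nat.strong_induction_on with
  | _ d ih =>
  intro W i j l m θ hW hm hθ
  have hmR : (m : ℝ) = 4 * i + 3 * j + 2 * l + d := by exact_mod_cast hm.symm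
  refine ncard_nilFamily_le_of_step (k := k) (b := θ - (2 * k - ε * (2 * i + j) -
    (2 * i + 2 * j + 2 * l + d)) + 3 * (d - 2) + 1) (c := θ + 3 * d) hε hN (by norm_num)
    (hk 2) hW.invariant ?_ ?_ ?_ le_rfl
  · rw [hW.finrank_zero, hW.finrank_two, pow_one, hW.finrank_one]
    ring
  · intro u hu hu' hle
    have hW' := hW.sup_cyclicSpan (i' := i) (j' := j) (l' := l + 1) hu hu' (by ring) (by omega)
      (by omega) (by omega)
    rw [hW'.finrank_zero] at hle
    have hd : 2 ≤ d := by omega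
    have h := ih (d - 2) (by omega) _ i j (l + 1) m (θ - (2 * k - ε * (2 * i + j) -
      (2 * i + 2 * j + 2 * l + d))) hW' (by omega) ?_
    · rw [Nat.cast_sub hd] at h
      refine ⟨by exact_mod_cast h, ?_⟩
      norm_num
      rw [hW.finrank_two, hmR]
      push_cast
      nlinarith
    · intro y p hyp
      have h1 := hθ (y + 1) p (by omega)
      have hdR : (d : ℝ) = 2 * y + 2 + p := by
        exact_mod_cast (show d = 2 * y + 2 + p by omega)
      rw [hdR]
      simp only [nilCostTwo, nilCostOne] at h1 ⊢
      push_cast at h1 ⊢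
      ring_nf at h1 ⊢
      linarith
  · refine (ncard_nilFamily_one_le (k := k) hε hN (by norm_num) (by
      have := hk 1
      rwa [pow_one, Nat.cast_one, one_mul] at this)
      (d := d) (by rw [hW.finrank_zero]; exact hm)).trans (cardPow_mono ?_)
    have h1 := hθ 0 d (by omega)
    rw [hW.finrank_three, hW.finrank_one, hmR]
    simp only [nilCostTwo, nilCostOne] at h1
    push_cast at h1 ⊢
    have : (0 : ℝ) ≤ d := d.cast_nonneg
    nlinarith

theorem ncard_nilFamily_three_le (d : ℕ) : ∀ (W : Submodule F V) (i j m : ℕ) (θ : ℝ),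
    HasBlocks N W i j 0 → 4 * i + 3 * j + d = m →
    (∀ x y p : ℕ, 3 * x + 2 * y + p = d → nilCostThree ε k i j x y p ≤ θ) →
    ((nilFamily B N W 3 m).ncard : ℝ) ≤ cardPow F (θ + 5 * d + 2) := by
  induction d using Nat.strong_induction_on with
  | _ d ih =>
  intro W i j m θ hW hm hθ
  have hmR : (m : ℝ) = 4 * i + 3 * j + d := by exact_mod_cast hm.symm
  have hd0 : (0 : ℝ) ≤ d := d.cast_nonneg
  refine ncard_nilFamily_le_of_step (k := k) (b := θ - (3 * k - ε * (3 * i + 2 * j) -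
    (3 * i + 3 * j + d)) + 5 * (d - 3) + 2) (c := θ + 3 * d + 1) hε hN (by norm_num)
    (hk 3) hW.invariant ?_ ?_ ?_ (by linarith)
  · rw [hW.finrank_zero, hW.finrank_two, hW.finrank_one, hW.finrank_three]
    ring
  · intro u hu hu' hle
    have hW' := hW.sup_cyclicSpan (i' := i) (j' := j + 1) (l' := 0) hu hu' (by ring) (by omega)
      (by omega) (by omega)
    rw [hW'.finrank_zero] at hle
    have hd : 3 ≤ d := by omega
    have h := ih (d - 3) (by omega) _ i (j + 1) m (θ - (3 * k - ε * (3 * i + 2 * j) -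
      (3 * i + 3 * j + d))) hW' (by omega) ?_
    · rw [Nat.cast_sub hd] at h
      refine ⟨by exact_mod_cast h, ?_⟩
      rw [show 4 - (2 + 1) = 1 from rfl, pow_one, hW.finrank_three, hW.finrank_one, hmR]
      push_cast
      nlinarith
    · intro x y p hyp
      have h1 := hθ (x + 1) y p (by omega)
      have hdR : (d : ℝ) = 3 * x + 3 + 2 * y + p := by
        exact_mod_cast (show d = 3 * x + 3 + 2 * y + p by omega)
      rw [hdR]
      simp only [nilCostThree, nilCostTwo, nilCostOne] at h1 ⊢
      push_cast at h1 ⊢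
      ring_nf at h1 ⊢
      linarith
  · refine ncard_nilFamily_two_le hε hN hk d W i j 0 m θ hW (by omega) fun y p h => ?_
    have h1 := hθ 0 y p (by omega)
    simp only [nilCostThree] at h1
    push_cast at h1 ⊢
    ring_nf at h1 ⊢
    linarith

theorem ncard_nilFamily_four_le (d : ℕ) : ∀ (W : Submodule F V) (i m : ℕ) (θ : ℝ),
    HasBlocks N W i 0 0 → 4 * i + d = m →
    (∀ r x y p : ℕ, 4 * r + 3 * x + 2 * y + p = d → nilCostFour ε k i r x y p ≤ θ) →
    ((nilFamily B N W 4 m).ncard : ℝ) ≤ cardPow F (θ + 7 * d + 3) := by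
  induction d using Nat.strong_induction_on with
  | _ d ih =>
  intro W i m θ hW hm hθ
  have hmR : (m : ℝ) = 4 * i + d := by exact_mod_cast hm.symm
  have hd0 : (0 : ℝ) ≤ d := d.cast_nonneg
  have h4 : finrank F (W.map (N ^ 4)) = 0 := by
    rw [hN, Submodule.map_zero, finrank_bot]
  refine ncard_nilFamily_le_of_step (k := k) (b := θ - (4 * k - 4 * ε * i -
    (4 * i + d)) + 7 * (d - 4) + 3) (c := θ + 5 * d + 2) hε hN (by norm_num)
    (hk 4) hW.invariant ?_ ?_ ?_ (by linarith)
  · rw [hW.finrank_zero, hW.finrank_one, hW.finrank_three, h4]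
    ring
  · intro u hu hu' hle
    have hW' := hW.sup_cyclicSpan (i' := i + 1) (j' := 0) (l' := 0) hu hu' (by ring) (by omega)
      (by omega) (by omega)
    rw [hW'.finrank_zero] at hle
    have hd : 4 ≤ d := by omega
    have h := ih (d - 4) (by omega) _ (i + 1) m (θ - (4 * k - 4 * ε * i -
      (4 * i + d))) hW' (by omega) ?_
    · rw [Nat.cast_sub hd] at h
      refine ⟨by exact_mod_cast h, ?_⟩
      rw [h4, show 4 - (3 + 1) = 0 from rfl, pow_zero]
      rw [show (1 : End F V) = LinearMap.id from rfl, Submodule.map_id, hW.finrank_zero, hmR]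
      push_cast
      nlinarith
    · intro r x y p hyp
      have h1 := hθ (r + 1) x y p (by omega)
      have hdR : (d : ℝ) = 4 * r + 4 + 3 * x + 2 * y + p := by
        exact_mod_cast (show d = 4 * r + 4 + 3 * x + 2 * y + p by omega)
      rw [hdR]
      simp only [nilCostFour, nilCostThree, nilCostTwo, nilCostOne] at h1 ⊢
      push_cast at h1 ⊢
      ring_nf at h1 ⊢
      linarith
  · refine ncard_nilFamily_three_le hε hN hk d W i 0 m θ hW (by omega) fun x y p h => ?_
    have h1 := hθ 0 x y p (by omega)
    simp only [nilCostFour] at h1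
    push_cast at h1 ⊢
    ring_nf at h1 ⊢
    linarith

/-- The bound for the number of invariant totally isotropic subspaces of dimension `m` of a
nilpotent operator `N` with `N ^ 4 = 0`, when the kernels of its powers are as in a free module. -/
theorem ncard_invariant_of_pow_four_eq_zero (m : ℕ) :
    ({U : Submodule F V | (∀ u ∈ U, N u ∈ U) ∧ TotallyIsotropic B U ∧
      finrank F U = m}.ncard : ℝ) ≤
        cardPow F (m * k - (1 + ε / 2) / 4 * m ^ 2 + 8 * m + 3) := by
  have hbot : HasBlocks N (⊥ : Submodule F V) 0 0 0 := ⟨by simp, by simp, by simp, by simp, by simp⟩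
  have h := ncard_nilFamily_four_le hε hN hk m ⊥ 0 m
    (m * k - (1 + ε / 2) / 4 * m ^ 2 + m) hbot (by omega) ?_
  · have hset : nilFamily B N ⊥ 4 m = {U : Submodule F V | (∀ u ∈ U, N u ∈ U) ∧
        TotallyIsotropic B U ∧ finrank F U = m} := by
      ext U
      simp [nilFamily, hN]
    rw [hset] at h
    exact h.trans (le_of_eq (by congr 1; ring))
  · intro r x y p h
    have hmR : (m : ℝ) = 4 * r + 3 * x + 2 * y + p := by exact_mod_cast h.symm
    have hr : (0 : ℝ) ≤ r := r.cast_nonneg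
    have hx : (0 : ℝ) ≤ x := x.cast_nonneg
    have hy : (0 : ℝ) ≤ y := y.cast_nonneg
    have hp : (0 : ℝ) ≤ p := p.cast_nonneg
    rw [hmR]
    simp only [nilCostFour, nilCostThree, nilCostTwo, nilCostOne]
    push_cast
    -- The quadratic part is extremal for `m = 4 * r`, when `U` is free; the summand `m` in the
    -- bound covers the linear terms of `r * (r - 1)` and `x * (x - 1)`.
    rcases hε with rfl | ⟨rfl, -⟩
    · push_cast
      nlinarith [mul_nonneg hr hx, mul_nonneg hr hy, mul_nonneg hr hp, mul_nonneg hx hy,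
        mul_nonneg hx hp, mul_nonneg hy hp, sq_nonneg (x - p : ℝ), sq_nonneg (x : ℝ),
        sq_nonneg (y : ℝ), sq_nonneg (p : ℝ)]
    · push_cast
      nlinarith [mul_nonneg hr hx, mul_nonneg hr hy, mul_nonneg hr hp, mul_nonneg hx hy,
        mul_nonneg hx hp, mul_nonneg hy hp, sq_nonneg (x - p : ℝ), sq_nonneg (x : ℝ),
        sq_nonneg (y : ℝ), sq_nonneg (p : ℝ)]

end NilpotentFour

/-! ### Invariant totally isotropic subspaces of two commuting operators with square zero -/

section Klein

variable {F V : Type*} [Field F] [Finite F] [AddCommGroup V] [Module F V] [FiniteDimensional F V]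
  [Finite V]

theorem ncard_le_of_fibers {α β : Type*} [Finite α] [Finite β] {A : Set α} {T : Set β} (f : α → β)
    {M : ℝ} (hT : ∀ x ∈ A, f x ∈ T) (hM : ∀ u ∈ T, ({x ∈ A | f x = u}.ncard : ℝ) ≤ M) :
    (A.ncard : ℝ) ≤ T.ncard * M := by
  have h := ncard_mul_le_ncard_mul (A := A) (T := T) (fun x => {f x}) (a := 1) (M := M)
    (fun x hx => by simpa using hT x hx) (fun x _ => by simp) (fun u hu => by
      simpa [eq_comm] using hM u hu)
  linarith

theorem finrank_comap_le (f : End F V) (W : Submodule F V) :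
    finrank F (W.comap f) ≤ finrank F W + finrank F (LinearMap.ker f) := by
  rw [← finrank_map_add_finrank_inf_ker f (W.comap f)]
  exact Nat.add_le_add (Submodule.finrank_mono (Submodule.map_comap_le f W))
    (Submodule.finrank_mono inf_le_right)

/-- Take functionals `f`, `g` that vanish on `W` and are dual to `X u₀`, `Y u₀`. By Cramer's rule
`u` is good if the determinant of the matrix of `f`, `g` on `X u`, `Y u` is nonzero. On the subspace
of `U` where its trace vanishes, `u` or `u + u₀` is good; this gives half of that subspace. -/
theorem le_ncard_linearIndependent_mod (X Y : End F V) (U W : Submodule F V) {u₀ : V} (hu₀ : u₀ ∈ U)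
    (h : ∀ a b : F, a • X u₀ + b • Y u₀ ∈ W → a = 0 ∧ b = 0) :
    cardPow F (finrank F U - 2) ≤
      {u | u ∈ U ∧ ∀ a b : F, a • X u + b • Y u ∈ W → a = 0 ∧ b = 0}.ncard := by
  have aux : ∀ p q : V, (∀ a b : F, a • p + b • q ∈ W → a = 0 ∧ b = 0) →
      ∃ f : V →ₗ[F] F, (∀ w ∈ W, f w = 0) ∧ f p = 1 ∧ f q = 0 := by
    intro p q hpq
    have hp : p ∉ W ⊔ F ∙ q := by
      intro hmem
      obtain ⟨w, hw, z, hz, hwz⟩ := Submodule.mem_sup.1 hmem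
      obtain ⟨b, rfl⟩ := Submodule.mem_span_singleton.1 hz
      have := (hpq 1 (-b) (by rw [← hwz]; convert hw using 1; module)).1
      exact one_ne_zero this
    obtain ⟨f, hf, hfW⟩ := Submodule.exists_le_ker_of_notMem hp
    refine ⟨(f p)⁻¹ • f, fun w hw => ?_, ?_, ?_⟩
    · rw [LinearMap.smul_apply, hfW (Submodule.mem_sup_left hw), smul_zero]
    · rw [LinearMap.smul_apply, smul_eq_mul, inv_mul_cancel₀ hf]
    · rw [LinearMap.smul_apply,
        hfW (Submodule.mem_sup_right (Submodule.mem_span_singleton_self q)), smul_zero]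
  obtain ⟨f, hfW, hfX, hfY⟩ := aux _ _ h
  obtain ⟨g, hgW, hgY, hgX⟩ := aux (Y u₀) (X u₀) fun a b hab => (h b a (by rwa [add_comm])).symm
  have hgood : ∀ u, f (X u) * g (Y u) - f (Y u) * g (X u) ≠ 0 →
      ∀ a b : F, a • X u + b • Y u ∈ W → a = 0 ∧ b = 0 := by
    intro u hu a b hab
    have h1 := hfW _ hab
    have h2 := hgW _ hab
    simp only [map_add, map_smul, smul_eq_mul] at h1 h2
    constructor
    · refine (mul_eq_zero.1 (?_ : a * (f (X u) * g (Y u) - f (Y u) * g (X u)) = 0)).resolve_right hu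
      linear_combination g (Y u) * h1 - f (Y u) * h2
    · refine (mul_eq_zero.1 (?_ : b * (f (X u) * g (Y u) - f (Y u) * g (X u)) = 0)).resolve_right hu
      linear_combination f (X u) * h2 - g (X u) * h1
  set G := {u | u ∈ U ∧ ∀ a b : F, a • X u + b • Y u ∈ W → a = 0 ∧ b = 0} with hG
  let q : V →ₗ[F] F := f ∘ₗ X + g ∘ₗ Y
  have hL : ((U ⊓ LinearMap.ker q : Submodule F V) : Set V) ⊆ G ∪ (fun v => v - u₀) '' G := by
    rintro u ⟨hu, hq⟩
    have hq' : f (X u) + g (Y u) = 0 := hq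
    by_cases h0 : f (X u) * g (Y u) - f (Y u) * g (X u) = 0
    · right
      -- The matrix at `u + u₀` is that at `u` plus the identity, so its determinant is `det + trace
      -- + 1 = 1`.
      refine ⟨u + u₀, ⟨U.add_mem hu hu₀, hgood _ ?_⟩, by simp⟩
      simp only [map_add, hfX, hfY, hgX, hgY]
      intro h1
      apply one_ne_zero (α := F)
      linear_combination h1 - h0 - hq'
    · exact Or.inl ⟨hu, hgood u h0⟩
  have h1 : (((U ⊓ LinearMap.ker q : Submodule F V) : Set V).ncard : ℝ) ≤ 2 * G.ncard := by
    have h2 := (Set.ncard_le_ncard hL).trans ((Set.ncard_union_le _ _).trans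
      (Nat.add_le_add_left (Set.ncard_image_le (f := fun v => v - u₀) (s := G) (Set.toFinite _)) _))
    rw [two_mul]
    exact_mod_cast h2
  have h2 := finrank_map_add_finrank_inf_ker q U
  have h3 : finrank F (U.map q) ≤ 1 := (Submodule.finrank_le _).trans (by rw [finrank_self])
  rw [ncard_submodule] at h1
  have h4 := two_mul_cardPow_le (F := F) (finrank F U - 2)
  have h5 : cardPow F (finrank F U - 2 + 1) ≤
      cardPow F (finrank F (U ⊓ LinearMap.ker q : Submodule F V)) := by
    apply cardPow_mono
    have : ((finrank F U : ℕ) : ℝ) ≤ (1 + finrank F (U ⊓ LinearMap.ker q : Submodule F V) : ℕ) := by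
      exact_mod_cast (by omega)
    push_cast at this
    linarith
  linarith

/-- The common kernel of two operators. -/
def commonKer (X Y : End F V) : Submodule F V := LinearMap.ker X ⊓ LinearMap.ker Y

theorem mem_commonKer {X Y : End F V} {v : V} : v ∈ commonKer X Y ↔ X v = 0 ∧ Y v = 0 := Iff.rfl

variable {σ : F →+* F} (B : V →ₛₗ[σ] V →ₗ[F] F) (X Y : End F V)

/-- The invariant totally isotropic subspaces of dimension `m` that contain `W`. -/
def kleinFamily (W : Submodule F V) (m : ℕ) : Set (Submodule F V) :=
  {U | W ≤ U ∧ (∀ u ∈ U, X u ∈ U ∧ Y u ∈ U) ∧ TotallyIsotropic B U ∧ finrank F U = m}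

/-- The members of `kleinFamily` with the same image as `W` under `X * Y`. -/
def kleinFamilyB (W : Submodule F V) (m : ℕ) : Set (Submodule F V) :=
  {U ∈ kleinFamily B X Y W m | U.map (X * Y) ≤ W.map (X * Y)}

/-- The members `U` of `kleinFamilyB` such that `X u` and `Y u` are linearly dependent modulo `W` for
all `u` in `U` in the kernel of `X * Y`. -/
def kleinFamilyC (W : Submodule F V) (m : ℕ) : Set (Submodule F V) :=
  {U ∈ kleinFamilyB B X Y W m | ∀ u ∈ U, X (Y u) = 0 →
    ∃ a b : F, a • X u + b • Y u ∈ W ∧ ¬ (a = 0 ∧ b = 0)}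

/-- The members `U` of `kleinFamilyB` such that `X u` and `Y u` are in `W` for all `u` in `U` in the
kernel of `X * Y`. -/
def kleinFamilyD (W : Submodule F V) (m : ℕ) : Set (Submodule F V) :=
  {U ∈ kleinFamilyB B X Y W m | ∀ u ∈ U, X (Y u) = 0 → X u ∈ W ∧ Y u ∈ W}

/-- An invariant subspace with the dimensions of a sum of `i` free modules, `j` free modules modulo
`X * Y`, and `l` modules of dimension `2`. -/
structure HasKleinBlocks (W : Submodule F V) (i j l : ℕ) : Prop where
  invariant : ∀ w ∈ W, X w ∈ W ∧ Y w ∈ W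
  finrank_eq : finrank F W = 4 * i + 3 * j + 2 * l
  finrank_inf : finrank F (W ⊓ commonKer X Y : Submodule F V) = i + 2 * j + l
  finrank_map : finrank F (W.map (X * Y)) = i

variable {B X Y}

theorem span_le_of_mem {U : Submodule F V} {u : V} (hu : u ∈ U) : F ∙ u ≤ U :=
  (Submodule.span_singleton_le_iff_mem _ _).2 hu

variable (hXX : ∀ v, X (X v) = 0) (hYY : ∀ v, Y (Y v) = 0) (hYX : ∀ v, Y (X v) = X (Y v))

include hXX hYY hYX

/-- Applying a suitable one of `X`, `Y`, `X * Y` to a relation modulo `W` between `u`, `X u`, `Y u`,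
`X (Y u)` isolates `X (Y u)`, which is not in `W`. The same device shows that the common kernel and
the image of `X * Y` grow by `X (Y u)` only. -/
theorem HasKleinBlocks.sup_free {W : Submodule F V} {i : ℕ} (hW : HasKleinBlocks X Y W i 0 0)
    {u : V} (hu : X (Y u) ∉ W) :
    HasKleinBlocks X Y (W ⊔ F ∙ X (Y u) ⊔ F ∙ X u ⊔ F ∙ Y u ⊔ F ∙ u) (i + 1) 0 0 := by
  set W' := W ⊔ F ∙ X (Y u) ⊔ F ∙ X u ⊔ F ∙ Y u ⊔ F ∙ u with hW'
  have hmem : ∀ v, v ∈ W' → ∃ w ∈ W, ∃ a b c d : F,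
      v = w + a • X (Y u) + b • X u + c • Y u + d • u := by
    intro v hv
    obtain ⟨v1, hv1, z1, hz1, rfl⟩ := Submodule.mem_sup.1 hv
    obtain ⟨v2, hv2, z2, hz2, rfl⟩ := Submodule.mem_sup.1 hv1
    obtain ⟨v3, hv3, z3, hz3, rfl⟩ := Submodule.mem_sup.1 hv2
    obtain ⟨w, hw, z4, hz4, rfl⟩ := Submodule.mem_sup.1 hv3
    obtain ⟨d, rfl⟩ := Submodule.mem_span_singleton.1 hz1
    obtain ⟨c, rfl⟩ := Submodule.mem_span_singleton.1 hz2
    obtain ⟨b, rfl⟩ := Submodule.mem_span_singleton.1 hz3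
    obtain ⟨a, rfl⟩ := Submodule.mem_span_singleton.1 hz4
    exact ⟨w, hw, a, b, c, d, rfl⟩
  have hWW' : W ≤ W' := le_sup_left.trans (le_sup_left.trans (le_sup_left.trans le_sup_left))
  have m1 : X (Y u) ∈ W' := Submodule.mem_sup_left (Submodule.mem_sup_left (Submodule.mem_sup_left
    (Submodule.mem_sup_right (Submodule.mem_span_singleton_self _))))
  have m2 : X u ∈ W' := Submodule.mem_sup_left (Submodule.mem_sup_left
    (Submodule.mem_sup_right (Submodule.mem_span_singleton_self _)))
  have m3 : Y u ∈ W' := Submodule.mem_sup_left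
    (Submodule.mem_sup_right (Submodule.mem_span_singleton_self _))
  have hXW := fun w hw => (hW.invariant w hw).1
  have hYW := fun w hw => (hW.invariant w hw).2
  refine ⟨fun v hv => ?_, ?_, ?_, ?_⟩
  · obtain ⟨w, hw, a, b, c, d, rfl⟩ := hmem v hv
    simp only [map_add, map_smul, hXX, hYY, hYX, smul_zero, add_zero, map_zero]
    exact ⟨W'.add_mem (W'.add_mem (hWW' (hXW w hw)) (W'.smul_mem _ m1)) (W'.smul_mem _ m2),
      W'.add_mem (W'.add_mem (hWW' (hYW w hw)) (W'.smul_mem _ m1)) (W'.smul_mem _ m3)⟩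
  · have h1 : X u ∉ W ⊔ F ∙ X (Y u) := by
      intro h
      obtain ⟨w, hw, z, hz, hwz⟩ := Submodule.mem_sup.1 h
      obtain ⟨a, rfl⟩ := Submodule.mem_span_singleton.1 hz
      apply hu
      rw [← hYX, ← hwz]
      simp only [map_add, map_smul, hYX, hYY, map_zero, smul_zero, add_zero]
      exact hYW w hw
    have h2 : Y u ∉ W ⊔ F ∙ X (Y u) ⊔ F ∙ X u := by
      intro h
      obtain ⟨v, hv, z, hz, hvz⟩ := Submodule.mem_sup.1 h
      obtain ⟨w, hw, z', hz', rfl⟩ := Submodule.mem_sup.1 hv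
      obtain ⟨a, rfl⟩ := Submodule.mem_span_singleton.1 hz
      obtain ⟨b, rfl⟩ := Submodule.mem_span_singleton.1 hz'
      apply hu
      rw [← hvz]
      simp only [map_add, map_smul, hXX, smul_zero, add_zero]
      exact hXW w hw
    have h3 : u ∉ W ⊔ F ∙ X (Y u) ⊔ F ∙ X u ⊔ F ∙ Y u := by
      intro h
      obtain ⟨v, hv, z, hz, hvz⟩ := Submodule.mem_sup.1 h
      obtain ⟨v', hv', z', hz', rfl⟩ := Submodule.mem_sup.1 hv
      obtain ⟨w, hw, z'', hz'', rfl⟩ := Submodule.mem_sup.1 hv'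
      obtain ⟨a, rfl⟩ := Submodule.mem_span_singleton.1 hz
      obtain ⟨b, rfl⟩ := Submodule.mem_span_singleton.1 hz'
      obtain ⟨c, rfl⟩ := Submodule.mem_span_singleton.1 hz''
      apply hu
      rw [← hvz]
      simp only [map_add, map_smul, hXX, hYX, hYY, map_zero, smul_zero, add_zero]
      exact hXW _ (hYW w hw)
    rw [hW', finrank_sup_span_singleton h3, finrank_sup_span_singleton h2,
      finrank_sup_span_singleton h1, finrank_sup_span_singleton hu, hW.finrank_eq]
    ring
  · have h1 : W' ⊓ commonKer X Y = (W ⊓ commonKer X Y) ⊔ F ∙ X (Y u) := by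
      apply le_antisymm
      · rintro v ⟨hv, hvX, hvY⟩
        obtain ⟨w, hw, a, b, c, d, rfl⟩ := hmem v hv
        simp only [SetLike.mem_coe, LinearMap.mem_ker, map_add, map_smul, hXX, hYY, hYX, smul_zero,
          add_zero, map_zero] at hvX hvY
        have hd : d = 0 := by
          by_contra hd
          have h1 := congrArg Y hvX
          simp only [map_add, map_smul, hYX, hYY, map_zero, smul_zero, add_zero] at h1
          apply hu
          rw [← W.smul_mem_iff hd, ← neg_eq_of_add_eq_zero_right h1]
          exact W.neg_mem (hXW _ (hYW w hw))
        rw [hd, zero_smul, add_zero] at hvX hvY ⊢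
        have hc : c = 0 := by
          by_contra hc
          apply hu
          rw [← W.smul_mem_iff hc, ← neg_eq_of_add_eq_zero_right hvX]
          exact W.neg_mem (hXW w hw)
        have hb : b = 0 := by
          by_contra hb
          apply hu
          rw [← W.smul_mem_iff hb, ← neg_eq_of_add_eq_zero_right hvY]
          exact W.neg_mem (hYW w hw)
        rw [hc, zero_smul, add_zero] at hvX ⊢
        rw [hb, zero_smul, add_zero] at hvY ⊢
        exact Submodule.add_mem_sup ⟨hw, hvX, hvY⟩ (Submodule.smul_mem _ _
          (Submodule.mem_span_singleton_self _))
      · refine sup_le (inf_le_inf_right _ hWW') (span_le_of_mem ⟨m1, ?_⟩)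
        exact ⟨by simp [hXX], by simp [hYX, hYY]⟩
    rw [h1, finrank_sup_span_singleton (fun h : _ ∈ W ⊓ commonKer X Y => hu h.1), hW.finrank_inf]
  · have h1 : W'.map (X * Y) = W.map (X * Y) ⊔ F ∙ X (Y u) := by
      rw [hW', Submodule.map_sup, Submodule.map_sup, Submodule.map_sup, Submodule.map_sup,
        Submodule.map_span, Submodule.map_span, Submodule.map_span, Submodule.map_span]
      simp [Module.End.mul_apply, hXX, hYX, hYY]
    rw [h1, finrank_sup_span_singleton, hW.finrank_map]
    rintro ⟨w, hw, hwu⟩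
    exact hu (hwu ▸ hXW _ (hYW w hw))

theorem HasKleinBlocks.sup_three {W : Submodule F V} {i j : ℕ} (hW : HasKleinBlocks X Y W i j 0)
    {u : V} (hu0 : X (Y u) = 0) (hu : ∀ a b : F, a • X u + b • Y u ∈ W → a = 0 ∧ b = 0) :
    HasKleinBlocks X Y (W ⊔ F ∙ X u ⊔ F ∙ Y u ⊔ F ∙ u) i (j + 1) 0 := by
  set W' := W ⊔ F ∙ X u ⊔ F ∙ Y u ⊔ F ∙ u with hW'
  have hmem : ∀ v, v ∈ W' → ∃ w ∈ W, ∃ b c d : F, v = w + b • X u + c • Y u + d • u := by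
    intro v hv
    obtain ⟨v1, hv1, z1, hz1, rfl⟩ := Submodule.mem_sup.1 hv
    obtain ⟨v2, hv2, z2, hz2, rfl⟩ := Submodule.mem_sup.1 hv1
    obtain ⟨w, hw, z3, hz3, rfl⟩ := Submodule.mem_sup.1 hv2
    obtain ⟨d, rfl⟩ := Submodule.mem_span_singleton.1 hz1
    obtain ⟨c, rfl⟩ := Submodule.mem_span_singleton.1 hz2
    obtain ⟨b, rfl⟩ := Submodule.mem_span_singleton.1 hz3
    exact ⟨w, hw, b, c, d, rfl⟩
  have hWW' : W ≤ W' := le_sup_left.trans (le_sup_left.trans le_sup_left)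
  have m2 : X u ∈ W' := Submodule.mem_sup_left (Submodule.mem_sup_left
    (Submodule.mem_sup_right (Submodule.mem_span_singleton_self _)))
  have m3 : Y u ∈ W' := Submodule.mem_sup_left
    (Submodule.mem_sup_right (Submodule.mem_span_singleton_self _))
  have hXW := fun w hw => (hW.invariant w hw).1
  have hYW := fun w hw => (hW.invariant w hw).2
  have hXu : ∀ d : F, d • X u ∈ W → d = 0 := fun d hd => (hu d 0 (by simpa using hd)).1
  have h1 : X u ∉ W := fun h => one_ne_zero (hXu 1 (by simpa using h))
  have h2 : Y u ∉ W ⊔ F ∙ X u := by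
    intro h
    obtain ⟨w, hw, z, hz, hwz⟩ := Submodule.mem_sup.1 h
    obtain ⟨b, rfl⟩ := Submodule.mem_span_singleton.1 hz
    have := (hu (-b) 1 (by rw [← hwz]; convert hw using 1; module)).2
    exact one_ne_zero this
  refine ⟨fun v hv => ?_, ?_, ?_, ?_⟩
  · obtain ⟨w, hw, b, c, d, rfl⟩ := hmem v hv
    simp only [map_add, map_smul, hXX, hYY, hYX, hu0, smul_zero, add_zero]
    exact ⟨W'.add_mem (hWW' (hXW w hw)) (W'.smul_mem _ m2),
      W'.add_mem (hWW' (hYW w hw)) (W'.smul_mem _ m3)⟩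
  · have h3 : u ∉ W ⊔ F ∙ X u ⊔ F ∙ Y u := by
      intro h
      obtain ⟨v, hv, z, hz, hvz⟩ := Submodule.mem_sup.1 h
      obtain ⟨w, hw, z', hz', rfl⟩ := Submodule.mem_sup.1 hv
      obtain ⟨a, rfl⟩ := Submodule.mem_span_singleton.1 hz
      obtain ⟨b, rfl⟩ := Submodule.mem_span_singleton.1 hz'
      apply h1
      rw [← hvz]
      simp only [map_add, map_smul, hXX, hu0, smul_zero, add_zero]
      exact hXW w hw
    rw [hW', finrank_sup_span_singleton h3, finrank_sup_span_singleton h2,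
      finrank_sup_span_singleton h1, hW.finrank_eq]
    ring
  · have h4 : W' ⊓ commonKer X Y = (W ⊓ commonKer X Y) ⊔ F ∙ X u ⊔ F ∙ Y u := by
      apply le_antisymm
      · rintro v ⟨hv, hvX, hvY⟩
        obtain ⟨w, hw, b, c, d, rfl⟩ := hmem v hv
        simp only [SetLike.mem_coe, LinearMap.mem_ker, map_add, map_smul, hXX, hYY, hYX, hu0,
          smul_zero, add_zero] at hvX hvY
        have hd : d = 0 := by
          apply hXu
          rw [← neg_eq_of_add_eq_zero_right hvX]
          exact W.neg_mem (hXW w hw)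
        rw [hd, zero_smul, add_zero] at hvX hvY ⊢
        exact Submodule.add_mem_sup (Submodule.add_mem_sup ⟨hw, hvX, hvY⟩ (Submodule.smul_mem _ _
          (Submodule.mem_span_singleton_self _))) (Submodule.smul_mem _ _
          (Submodule.mem_span_singleton_self _))
      · refine sup_le (sup_le (inf_le_inf_right _ hWW') (span_le_of_mem ⟨m2, ?_⟩))
          (span_le_of_mem ⟨m3, ?_⟩)
        · exact ⟨by simp [hXX], by simp [hYX, hu0]⟩
        · exact ⟨by simp [hu0], by simp [hYY]⟩
    have h5 : Y u ∉ (W ⊓ commonKer X Y) ⊔ F ∙ X u := fun h => 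
      h2 ((sup_le_sup inf_le_left le_rfl : W ⊓ commonKer X Y ⊔ F ∙ X u ≤ W ⊔ F ∙ X u) h)
    rw [h4, finrank_sup_span_singleton h5, finrank_sup_span_singleton (fun h : _ ∈ W ⊓ commonKer X Y => h1 h.1),
      hW.finrank_inf]
    ring
  · have h1 : W'.map (X * Y) = W.map (X * Y) := by
      rw [hW', Submodule.map_sup, Submodule.map_sup, Submodule.map_sup,
        Submodule.map_span, Submodule.map_span, Submodule.map_span]
      simp [Module.End.mul_apply, hYX, hYY, hu0]
    rw [h1, hW.finrank_map]

/-- The module generated by `u` and `W`, for `u` in the kernel of `X * Y` with `X u` and `Y u`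
dependent modulo `W`, but not both in `W`. -/
theorem HasKleinBlocks.exists_sup_two {W : Submodule F V} {i j l : ℕ}
    (hW : HasKleinBlocks X Y W i j l) {u : V} (hu0 : X (Y u) = 0)
    (hu : ∃ a b : F, a • X u + b • Y u ∈ W ∧ ¬ (a = 0 ∧ b = 0)) (hu' : ¬ (X u ∈ W ∧ Y u ∈ W)) :
    ∃ W', HasKleinBlocks X Y W' i j (l + 1) ∧ W ≤ W' ∧
      ∀ U : Submodule F V, W ≤ U → X u ∈ U → Y u ∈ U → u ∈ U → W' ≤ U := by
  have hXW := fun w hw => (hW.invariant w hw).1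
  have hYW := fun w hw => (hW.invariant w hw).2
  -- One of `X u`, `Y u` spans both modulo `W`; together with `u` it gives the two new dimensions.
  obtain ⟨v₀, hv₀, hv₀W, hXv, hYv⟩ : ∃ v₀, (v₀ = X u ∨ v₀ = Y u) ∧ v₀ ∉ W ∧
      X u ∈ W ⊔ F ∙ v₀ ∧ Y u ∈ W ⊔ F ∙ v₀ := by
    obtain ⟨a, b, hab, hne⟩ := hu
    have aux : ∀ (p q : V) (a b : F), b ≠ 0 → a • p + b • q ∈ W → q ∈ W ⊔ F ∙ p := by
      intro p q a b hb h
      rw [← Submodule.smul_mem_iff _ hb]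
      rw [show b • q = (a • p + b • q) + (-a) • p by module]
      exact Submodule.add_mem_sup h (Submodule.smul_mem _ _ (Submodule.mem_span_singleton_self _))
    have aux2 : ∀ p q : V, p ∈ W → q ∈ W ⊔ F ∙ p → q ∈ W := by
      intro p q hp hq
      rwa [sup_eq_left.2 (span_le_of_mem hp)] at hq
    by_cases hb : b = 0
    · have ha : a ≠ 0 := fun ha => hne ⟨ha, hb⟩
      have hx : X u ∈ W := by
        rw [hb, zero_smul, add_zero] at hab
        exact (W.smul_mem_iff ha).1 hab
      exact ⟨Y u, Or.inr rfl, fun h => hu' ⟨hx, h⟩, Submodule.mem_sup_left hx,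
        Submodule.mem_sup_right (Submodule.mem_span_singleton_self _)⟩
    · have hy := aux _ _ a b hb hab
      exact ⟨X u, Or.inl rfl, fun h => hu' ⟨h, aux2 _ _ h hy⟩,
        Submodule.mem_sup_right (Submodule.mem_span_singleton_self _), hy⟩
  have hX0 : X v₀ = 0 := by rcases hv₀ with rfl | rfl <;> simp [hXX, hu0]
  have hY0 : Y v₀ = 0 := by rcases hv₀ with rfl | rfl <;> simp [hYY, hYX, hu0]
  have hdW : ∀ d : F, d • X u ∈ W → d • Y u ∈ W → d = 0 := by
    intro d h1 h2
    by_contra hd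
    rcases hv₀ with rfl | rfl
    · exact hv₀W ((W.smul_mem_iff hd).1 h1)
    · exact hv₀W ((W.smul_mem_iff hd).1 h2)
  refine ⟨W ⊔ F ∙ v₀ ⊔ F ∙ u, ?_, le_sup_left.trans le_sup_left, fun U h1 h2 h3 h4 => ?_⟩
  swap
  · refine sup_le (sup_le h1 (span_le_of_mem ?_)) (span_le_of_mem h4)
    rcases hv₀ with rfl | rfl
    · exact h2
    · exact h3
  set W' := W ⊔ F ∙ v₀ ⊔ F ∙ u with hW'
  have hmem : ∀ v, v ∈ W' → ∃ w ∈ W, ∃ c d : F, v = w + c • v₀ + d • u := by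
    intro v hv
    obtain ⟨v1, hv1, z1, hz1, rfl⟩ := Submodule.mem_sup.1 hv
    obtain ⟨w, hw, z2, hz2, rfl⟩ := Submodule.mem_sup.1 hv1
    obtain ⟨d, rfl⟩ := Submodule.mem_span_singleton.1 hz1
    obtain ⟨c, rfl⟩ := Submodule.mem_span_singleton.1 hz2
    exact ⟨w, hw, c, d, rfl⟩
  have hWW' : W ≤ W' := le_sup_left.trans le_sup_left
  have hXY0 : X (Y u) = 0 ∧ Y (X u) = 0 := ⟨hu0, by rw [hYX, hu0]⟩
  refine ⟨fun v hv => ?_, ?_, ?_, ?_⟩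
  · obtain ⟨w, hw, c, d, rfl⟩ := hmem v hv
    simp only [map_add, map_smul, hX0, hY0, smul_zero, add_zero]
    exact ⟨W'.add_mem (hWW' (hXW w hw)) (W'.smul_mem _ (Submodule.mem_sup_left hXv)),
      W'.add_mem (hWW' (hYW w hw)) (W'.smul_mem _ (Submodule.mem_sup_left hYv))⟩
  · have h3 : u ∉ W ⊔ F ∙ v₀ := by
      intro h
      obtain ⟨w, hw, z, hz, hwz⟩ := Submodule.mem_sup.1 h
      obtain ⟨a, rfl⟩ := Submodule.mem_span_singleton.1 hz
      apply hu'
      rw [← hwz]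
      simp only [map_add, map_smul, hX0, hY0, smul_zero, add_zero]
      exact ⟨hXW w hw, hYW w hw⟩
    rw [hW', finrank_sup_span_singleton h3, finrank_sup_span_singleton hv₀W, hW.finrank_eq]
    ring
  · have h4 : W' ⊓ commonKer X Y = (W ⊓ commonKer X Y) ⊔ F ∙ v₀ := by
      apply le_antisymm
      · rintro v ⟨hv, hvX, hvY⟩
        obtain ⟨w, hw, c, d, rfl⟩ := hmem v hv
        simp only [SetLike.mem_coe, LinearMap.mem_ker, map_add, map_smul, hX0, hY0, smul_zero,
          add_zero] at hvX hvY
        have hd : d = 0 := by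
          apply hdW
          · rw [← neg_eq_of_add_eq_zero_right hvX]
            exact W.neg_mem (hXW w hw)
          · rw [← neg_eq_of_add_eq_zero_right hvY]
            exact W.neg_mem (hYW w hw)
        rw [hd, zero_smul, add_zero] at hvX hvY ⊢
        exact Submodule.add_mem_sup ⟨hw, hvX, hvY⟩ (Submodule.smul_mem _ _
          (Submodule.mem_span_singleton_self _))
      · exact sup_le (inf_le_inf_right _ hWW') (span_le_of_mem
          ⟨Submodule.mem_sup_left (Submodule.mem_sup_right (Submodule.mem_span_singleton_self _)),
            hX0, hY0⟩)
    rw [h4, finrank_sup_span_singleton (fun h : _ ∈ W ⊓ commonKer X Y => hv₀W h.1), hW.finrank_inf]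
    ring
  · have h1 : W'.map (X * Y) = W.map (X * Y) := by
      rw [hW', Submodule.map_sup, Submodule.map_sup, Submodule.map_span, Submodule.map_span]
      simp [Module.End.mul_apply, hu0, hY0]
    rw [h1, hW.finrank_map]

end Klein

/-! ### ### The count for two commuting operators with square zero -/

section KleinCount

variable {F V : Type*} [Field F] [Finite F] [AddCommGroup V] [Module F V] [FiniteDimensional F V]
  [Finite V] {σ : F →+* F} {B : V →ₛₗ[σ] V →ₗ[F] F} {X Y : End F V} {ε : ℕ} {k : ℝ}

/-- The exponent for the choice of `s` dimensions in the common kernel and of `p` further ones. -/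
def kleinCostD (k i j l s p : ℝ) : ℝ :=
  s * (k - (i + 2 * j + l) - s) + p * (k + 2 * (i + 2 * j + l) - (3 * i + 3 * j + 2 * l + s + p))

/-- The exponent when `y` modules of dimension `2` are chosen before. -/
noncomputable def kleinCostC (k i j l y s p : ℝ) : ℝ :=
  y * (2 * k + (i + 2 * j + l) - (3 * i + 3 * j + 2 * l + 2 * y + s + p)) + y * (y - 1) / 2 +
    kleinCostD k i j (l + y) s p

/-- The exponent when `x` modules of dimension `3` are chosen before. -/
noncomputable def kleinCostB (ε k i j x y s p : ℝ) : ℝ :=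
  x * (3 * k - ε * (3 * i + j) - (3 * i + 3 * j + 3 * x + 2 * y + s + p)) - ε * x * (x - 1) / 2 +
    kleinCostC k i (j + x) 0 y s p

/-- The exponent when `r` free modules are chosen before. -/
noncomputable def kleinCostA (ε k i r x y s p : ℝ) : ℝ :=
  r * (4 * k - 4 * ε * i - (4 * i + 4 * r + 3 * x + 2 * y + s + p)) - 2 * ε * r * (r - 1) +
    kleinCostB ε k (i + r) 0 x y s p

variable (hXX : ∀ v, X (X v) = 0) (hYY : ∀ v, Y (Y v) = 0) (hYX : ∀ v, Y (X v) = X (Y v))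
  (hk : (finrank F (commonKer X Y) : ℝ) ≤ k)

theorem mem_ker_mul {v : V} : v ∈ LinearMap.ker (X * Y) ↔ X (Y v) = 0 := Iff.rfl

include hXX hYY hYX in
-- On the kernel of `a • X + b • Y`, one of `X`, `Y` has both its kernel and its image in the common
-- kernel.
theorem finrank_ker_linearCombination_le (a b : F) (hab : ¬ (a = 0 ∧ b = 0)) :
    finrank F (LinearMap.ker (a • X + b • Y)) ≤ 2 * finrank F (commonKer X Y) := by
  have aux : ∀ Z : End F V, (∀ v, Z (Z v) = 0) →
      (∀ v, a • X v + b • Y v = 0 → Z v = 0 → v ∈ commonKer X Y) →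
      (∀ v, a • X v + b • Y v = 0 → a • X (Z v) + b • Y (Z v) = 0) →
      finrank F (LinearMap.ker (a • X + b • Y)) ≤ 2 * finrank F (commonKer X Y) := by
    intro Z h0 h1 h2
    rw [← finrank_map_add_finrank_inf_ker Z, two_mul]
    refine Nat.add_le_add (Submodule.finrank_mono ?_) (Submodule.finrank_mono ?_)
    · rintro _ ⟨v, hv, rfl⟩
      exact h1 _ (h2 v hv) (h0 v)
    · rintro v ⟨hv, hv'⟩
      exact h1 v hv hv'
  by_cases hb : b = 0
  · have ha : a ≠ 0 := fun ha => hab ⟨ha, hb⟩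
    subst hb
    simp only [zero_smul, add_zero, smul_eq_zero, ha, false_or] at aux ⊢
    refine aux Y hYY (fun v h1 h2 => ⟨h1, h2⟩) fun v h1 => ?_
    rw [← hYX, h1, map_zero]
  · refine aux X hXX (fun v h1 h2 => ⟨h2, ?_⟩) fun v h1 => ?_
    · rw [h2, smul_zero, zero_add, smul_eq_zero] at h1
      exact h1.resolve_left hb
    · have := congrArg X h1
      simpa [hYX] using this

include hXX hYY hYX in
-- `Y` maps the kernel of `X * Y` into the common kernel, and its own kernel has at most twice that
-- dimension.
theorem finrank_ker_mul_le :
    finrank F (LinearMap.ker (X * Y)) ≤ 3 * finrank F (commonKer X Y) := by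
  have h := finrank_ker_linearCombination_le hXX hYY hYX (0 : F) 1 (by simp)
  rw [zero_smul, zero_add, one_smul] at h
  rw [← finrank_map_add_finrank_inf_ker Y]
  have h1 : (LinearMap.ker (X * Y)).map Y ≤ commonKer X Y := by
    rintro _ ⟨v, hv, rfl⟩
    exact ⟨hv, hYY v⟩
  have h2 := Submodule.finrank_mono h1
  have h3 := Submodule.finrank_mono (inf_le_right : LinearMap.ker (X * Y) ⊓ LinearMap.ker Y ≤ _)
  omega

include hXX hYY hYX in
theorem finrank_le_four_mul : finrank F V ≤ 4 * finrank F (commonKer X Y) := by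
  have h := finrank_ker_mul_le hXX hYY hYX
  have h1 := LinearMap.finrank_range_add_finrank_ker (X * Y)
  have h2 : LinearMap.range (X * Y) ≤ commonKer X Y := by
    rintro _ ⟨v, rfl⟩
    refine ⟨hXX _, ?_⟩
    rw [SetLike.mem_coe, LinearMap.mem_ker, Module.End.mul_apply, hYX, hYY, map_zero]
  have h3 := Submodule.finrank_mono h2
  omega

theorem finrank_inf_ker_mul {W U : Submodule F V} {i j l m : ℕ} (hW : HasKleinBlocks X Y W i j l)
    (hU : U ∈ kleinFamilyB B X Y W m) :
    i + finrank F (U ⊓ LinearMap.ker (X * Y) : Submodule F V) = m := by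
  rw [← hW.finrank_map, ← hU.1.2.2.2, ← finrank_map_add_finrank_inf_ker (X * Y) U,
    le_antisymm hU.2 (Submodule.map_mono hU.1.1)]

theorem eq_sup_inf_ker_mul {W U : Submodule F V} {m : ℕ} (hU : U ∈ kleinFamilyB B X Y W m) :
    U = W ⊔ (U ⊓ LinearMap.ker (X * Y)) := by
  refine le_antisymm (fun u hu => ?_) (sup_le hU.1.1 inf_le_left)
  obtain ⟨w, hw, hwu⟩ := hU.2 ⟨u, hu, rfl⟩
  have h2 : u - w ∈ U ⊓ LinearMap.ker (X * Y) := ⟨U.sub_mem hu (hU.1.1 hw), by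
    rw [SetLike.mem_coe, LinearMap.mem_ker, map_sub, hwu, sub_self]⟩
  rw [← add_sub_cancel w u]
  exact Submodule.add_mem_sup hw h2

theorem mem_kleinFamilyB_of_le {W W' U : Submodule F V} {m : ℕ} (hU : U ∈ kleinFamilyB B X Y W m)
    (h : W ≤ W') (h' : W' ≤ U) : U ∈ kleinFamilyB B X Y W' m :=
  ⟨⟨h', hU.1.2⟩, hU.2.trans (Submodule.map_mono h)⟩

include hXX hYY hYX hk

/-- The subspace is chosen in two stages: first `U ⊓ S` inside the common kernel `S`, then `U ⊓ D`
inside the space `K` of all `v` in `D = ker (X * Y)` with `X v` and `Y v` in `W`. As `X Y U = X Y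
W`, the intersection with `D` determines `U`. -/
theorem ncard_kleinFamilyD_aux {W : Submodule F V} {i j l m d s p : ℕ}
    (hW : HasKleinBlocks X Y W i j l) (hm : 4 * i + 3 * j + 2 * l + d = m) (hsp : s + p = d) :
    ({U ∈ kleinFamilyD B X Y W m | finrank F (U ⊓ commonKer X Y : Submodule F V) =
      i + 2 * j + l + s}.ncard : ℝ) ≤ cardPow F (kleinCostD k i j l s p + d) := by
  have hmR : (m : ℝ) = 4 * i + 3 * j + 2 * l + s + p := by
    exact_mod_cast (show m = 4 * i + 3 * j + 2 * l + s + p by omega)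
  have hdR : (d : ℝ) = s + p := by exact_mod_cast hsp.symm
  set S := commonKer X Y with hS
  set D := LinearMap.ker (X * Y) with hD
  have hSD : S ≤ D := fun v hv => by
    rw [hD, mem_ker_mul, (mem_commonKer.1 hv).2, map_zero]
  let K : Submodule F V := D ⊓ (W.comap X ⊓ W.comap Y)
  -- `X` maps `K` to `W ⊓ S`, `Y` maps the kernel of this map to `W ⊓ S`, and what both kill is in
  -- `S`.
  have hKr : finrank F K ≤ finrank F S + 2 * (i + 2 * j + l) := by
    have h1 := finrank_map_add_finrank_inf_ker X K
    have h2 := finrank_map_add_finrank_inf_ker Y (K ⊓ LinearMap.ker X)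
    have h3 : K.map X ≤ W ⊓ S := by
      rintro _ ⟨v, ⟨hv1, hv2, hv3⟩, rfl⟩
      exact ⟨hv2, hXX v, (hYX v).trans hv1⟩
    have h4 : (K ⊓ LinearMap.ker X).map Y ≤ W ⊓ S := by
      rintro _ ⟨v, ⟨⟨hv1, hv2, hv3⟩, -⟩, rfl⟩
      exact ⟨hv3, hv1, hYY v⟩
    have h5 : K ⊓ LinearMap.ker X ⊓ LinearMap.ker Y ≤ S := fun v hv => ⟨hv.1.2, hv.2⟩
    have h3' := Submodule.finrank_mono h3
    have h4' := Submodule.finrank_mono h4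
    have h5' := Submodule.finrank_mono h5
    rw [hW.finrank_inf] at h3' h4'
    omega
  have hKk : (finrank F K : ℝ) ≤ k + 2 * (i + 2 * j + l) := by
    have : ((finrank F K : ℕ) : ℝ) ≤ (finrank F S + 2 * (i + 2 * j + l) : ℕ) := by
      exact_mod_cast hKr
    push_cast at this
    linarith
  have hWD : finrank F (W ⊓ D : Submodule F V) + i = finrank F W := by
    rw [← finrank_map_add_finrank_inf_ker (X * Y) W, hW.finrank_map, add_comm]
  have hWeq := hW.finrank_eq
  have h1 := ncard_le_of_fibers (A := {U ∈ kleinFamilyD B X Y W m |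
      finrank F (U ⊓ S : Submodule F V) = i + 2 * j + l + s})
    (T := {U₁ : Submodule F V | W ⊓ S ≤ U₁ ∧ U₁ ≤ S ∧ finrank F U₁ = i + 2 * j + l + s})
    (fun U => U ⊓ S) (M := cardPow F (p * (k + 2 * (i + 2 * j + l) - (m - i : ℕ) + 1))) ?_ ?_
  · refine h1.trans ?_
    have h2 := ncard_between_le hk s (W ⊓ S) (i + 2 * j + l + s) (by rw [hW.finrank_inf])
    refine (mul_le_mul_of_nonneg_right h2 (cardPow_pos _).le).trans ?_
    rw [← cardPow_add]
    apply cardPow_mono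
    rw [Nat.cast_sub (by omega), hmR, hdR]
    simp only [kleinCostD]
    push_cast
    apply le_of_eq
    ring
  · rintro U ⟨hU, hUs⟩
    exact ⟨inf_le_inf_right _ hU.1.1.1, inf_le_right, hUs⟩
  · rintro U₁ ⟨hU₁, hU₁S, hU₁s⟩
    set A' := {U ∈ {U ∈ kleinFamilyD B X Y W m |
      finrank F (U ⊓ S : Submodule F V) = i + 2 * j + l + s} | U ⊓ S = U₁} with hA'
    have hinj : Set.InjOn (fun U => U ⊓ D) A' := by
      intro U hU U' hU' h
      rw [eq_sup_inf_ker_mul hU.1.1.1, eq_sup_inf_ker_mul hU'.1.1.1]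
      exact congrArg _ h
    by_cases hne : A' = ∅
    · rw [hne, Set.ncard_empty, Nat.cast_zero]
      exact (cardPow_pos _).le
    obtain ⟨U₀, ⟨hU₀, -⟩, hU₀'⟩ := Set.nonempty_iff_ne_empty.2 hne
    have hdim : finrank F ((W ⊓ D) ⊔ U₁ : Submodule F V) + p = m - i := by
      have h2 := Submodule.finrank_sup_add_finrank_inf_eq (W ⊓ D) U₁
      have h3 : (W ⊓ D) ⊓ U₁ = W ⊓ S := by
        apply le_antisymm
        · exact le_inf (inf_le_left.trans inf_le_left) (inf_le_right.trans hU₁S)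
        · exact le_inf (le_inf inf_le_left (inf_le_right.trans hSD)) hU₁
      rw [h3, hW.finrank_inf, hU₁s] at h2
      omega
    have hcard := ncard_between_le hKk p _ _ hdim
    rw [← hinj.ncard_image]
    refine le_trans (Nat.cast_le.2 (Set.ncard_le_ncard ?_)) hcard
    rintro _ ⟨U, ⟨⟨hU, -⟩, hU'⟩, rfl⟩
    refine ⟨sup_le (inf_le_inf_right _ hU.1.1.1) ?_, ?_, ?_⟩
    · rw [← hU']
      exact inf_le_inf_left _ hSD
    · rintro u ⟨hu, hu'⟩
      exact ⟨hu', hU.2 u hu hu'⟩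
    · have := finrank_inf_ker_mul hW hU.1
      simp only
      change i + finrank F (U ⊓ D : Submodule F V) = m at this
      omega

theorem ncard_kleinFamilyD_le {W : Submodule F V} {i j l m d : ℕ} {θ : ℝ}
    (hW : HasKleinBlocks X Y W i j l) (hm : 4 * i + 3 * j + 2 * l + d = m)
    (hθ : ∀ s p : ℕ, s + p = d → kleinCostD k i j l s p ≤ θ) :
    ((kleinFamilyD B X Y W m).ncard : ℝ) ≤ cardPow F (θ + 2 * d) := by
  have hdim : ∀ U ∈ kleinFamilyD B X Y W m,
      i + 2 * j + l ≤ finrank F (U ⊓ commonKer X Y : Submodule F V) ∧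
      finrank F (U ⊓ commonKer X Y : Submodule F V) ≤ i + 2 * j + l + d := by
    intro U hU
    have h1 := Submodule.finrank_sup_add_finrank_inf_eq W (U ⊓ commonKer X Y)
    have h2 := Submodule.finrank_mono (sup_le hU.1.1.1 inf_le_left : W ⊔ (U ⊓ commonKer X Y) ≤ U)
    rw [← inf_assoc, inf_eq_left.2 hU.1.1.1, hW.finrank_inf, hW.finrank_eq] at h1
    have h3 := Submodule.finrank_mono (inf_le_inf_right (commonKer X Y) hU.1.1.1)
    rw [hW.finrank_inf] at h3
    rw [hU.1.1.2.2.2] at h2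
    omega
  -- The excess `s` of the dimension of `U ⊓ S` over that of `W ⊓ S` is at most `d`, so `Fin.ofNat`
  -- loses nothing, and the `d + 1` values cost a factor of at most `|F| ^ d`.
  have h := ncard_le_of_fibers (A := kleinFamilyD B X Y W m) (T := (Set.univ : Set (Fin (d + 1))))
    (fun U => Fin.ofNat (d + 1) (finrank F (U ⊓ commonKer X Y : Submodule F V) - (i + 2 * j + l)))
    (M := cardPow F (θ + d)) (fun _ _ => trivial) ?_
  · refine h.trans ?_
    rw [Set.ncard_univ, Nat.card_fin, show θ + 2 * (d : ℝ) = d + (θ + d) by ring,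
      cardPow_add (F := F) (d : ℝ)]
    refine mul_le_mul_of_nonneg_right ?_ (cardPow_pos _).le
    push_cast
    exact natCast_add_one_le_cardPow d
  · rintro s -
    have hs : (s : ℕ) + (d - s) = d := by omega
    refine le_trans ?_ ((ncard_kleinFamilyD_aux (B := B) hXX hYY hYX hk hW hm hs).trans
      (cardPow_mono (add_le_add_left (hθ _ _ hs) _)))
    refine Nat.cast_le.2 (Set.ncard_le_ncard ?_)
    rintro U ⟨hU, hUs⟩
    refine ⟨hU, ?_⟩
    obtain ⟨h1, h2⟩ := hdim U hU
    have h3 := congrArg Fin.val hUs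
    rw [Fin.val_ofNat, Nat.mod_eq_of_lt (by omega)] at h3
    omega

/-- Good vectors generate modules of dimension 2 modulo `W`. No orthogonality is used for them. Each
such module enlarges `W ⊓ commonKer X Y`, which is the source of the positive term `y * (y - 1) / 2`
in `kleinCostC`. -/
theorem ncard_kleinFamilyC_le (d : ℕ) : ∀ (W : Submodule F V) (i j l m : ℕ) (θ : ℝ),
    HasKleinBlocks X Y W i j l → 4 * i + 3 * j + 2 * l + d = m →
    (∀ y s p : ℕ, 2 * y + s + p = d → kleinCostC k i j l y s p ≤ θ) →
    ((kleinFamilyC B X Y W m).ncard : ℝ) ≤ cardPow F (θ + 4 * d + 1) := by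
  induction d using Nat.strong_induction_on with
  | _ d ih =>
  intro W i j l m θ hW hm hθ
  have hmR : (m : ℝ) = 4 * i + 3 * j + 2 * l + d := by exact_mod_cast hm.symm
  have hd0 : (0 : ℝ) ≤ d := d.cast_nonneg
  refine ncard_le_of_witness_or (A := kleinFamilyC B X Y W m)
    (P := fun U => ∃ u ∈ U, X (Y u) = 0 ∧ ¬ (X u ∈ W ∧ Y u ∈ W))
    -- For `u` in the kernel of `X * Y`, the dependence relation takes its value in the common
    -- kernel. For fixed `(a, b)` these `u` form a space of dimension at most `2k + (i + 2j + l)`;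
    -- the final `2` in `t` counts the pairs `(a, b)`.
    (T := {u | ∃ a b : F, ¬ (a = 0 ∧ b = 0) ∧ a • X u + b • Y u ∈ W ⊓ commonKer X Y})
    (fun U => {u | u ∈ U ∧ X (Y u) = 0 ∧ ¬ (X u ∈ W ∧ Y u ∈ W)})
    (t := 2 * k + (i + 2 * j + l) + 2) (s := m - i - 1)
    (b := θ - (2 * k + (i + 2 * j + l) - (3 * i + 3 * j + 2 * l + d)) + 4 * (d - 2) + 1)
    (c := θ + 2 * d) ?_ ?_ ?_ ?_ ?_ (by linarith)
  · have h1 := ncard_mul_le_ncard_mul (A := {u | ∃ a b : F, ¬ (a = 0 ∧ b = 0) ∧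
        a • X u + b • Y u ∈ W ⊓ commonKer X Y}) (T := {c : F × F | ¬ (c.1 = 0 ∧ c.2 = 0)})
      (fun u => {c : F × F | ¬ (c.1 = 0 ∧ c.2 = 0) ∧ c.1 • X u + c.2 • Y u ∈ W ⊓ commonKer X Y})
      (a := 1) (M := cardPow F (2 * k + (i + 2 * j + l))) (fun u _ c hc => hc.1) ?_ ?_
    · rw [mul_one] at h1
      refine h1.trans ?_
      rw [show 2 * k + (i + 2 * j + l) + 2 = 2 + (2 * k + (i + 2 * j + l)) by ring,
        cardPow_add (F := F) 2]
      refine mul_le_mul_of_nonneg_right ?_ (cardPow_pos _).le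
      have h2 := Set.ncard_le_ncard (Set.subset_univ {c : F × F | ¬ (c.1 = 0 ∧ c.2 = 0)})
      rw [Set.ncard_univ, Nat.card_prod] at h2
      have h3 := cardPow_natCast (F := F) 2
      push_cast at h3
      rw [h3, sq]
      exact_mod_cast h2
    · rintro u ⟨a, b, h2, h3⟩
      exact Nat.one_le_cast.2 ((Set.ncard_pos).2 ⟨(a, b), h2, h3⟩)
    · rintro ⟨a, b⟩ hab
      refine le_trans ?_ (ncard_submodule_le (U := (W ⊓ commonKer X Y).comap (a • X + b • Y)) ?_)
      · exact Nat.cast_le.2 (Set.ncard_le_ncard fun u hu => hu.2.2)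
      · have h2 := finrank_comap_le (a • X + b • Y) (W ⊓ commonKer X Y)
        have h3 := finrank_ker_linearCombination_le hXX hYY hYX a b hab
        rw [hW.finrank_inf] at h2
        have h4 : ((finrank F ((W ⊓ commonKer X Y).comap (a • X + b • Y)) : ℕ) : ℝ) ≤
            (i + 2 * j + l + 2 * finrank F (commonKer X Y) : ℕ) := by
          exact_mod_cast (by omega)
        push_cast at h4
        linarith
  · rintro U hU - u ⟨hu, hu0, hu'⟩
    obtain ⟨a, b, h1, h2⟩ := hU.2 u hu hu0
    refine ⟨a, b, h2, h1, ?_, ?_⟩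
    · simp [hXX, hu0]
    · simp [hYY, hYX, hu0]
  · rintro U hU ⟨u, hu, hu0, hu'⟩
    have h1 := finrank_inf_ker_mul hW hU.1
    have h2 := le_ncard_diff (U := U ⊓ LinearMap.ker (X * Y)) (K := W.comap X ⊓ W.comap Y)
      (fun h => hu' (h ⟨hu, hu0⟩))
    have h3 : ((i + finrank F (U ⊓ LinearMap.ker (X * Y) : Submodule F V) : ℕ) : ℝ) = m := by
      rw [h1]
    push_cast at h3
    rw [show (m : ℝ) - i = finrank F (U ⊓ LinearMap.ker (X * Y) : Submodule F V) by linarith]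
    refine h2.trans (Nat.cast_le.2 (Set.ncard_le_ncard ?_))
    rintro v ⟨⟨hv, hv'⟩, hv2⟩
    exact ⟨hv, hv', hv2⟩
  · rintro u - ⟨U, hU, -, hu, hu0, hu'⟩
    obtain ⟨W', hW', hWW', hleW'⟩ := hW.exists_sup_two hXX hYY hYX hu0 (hU.2 u hu hu0) hu'
    have hle := Submodule.finrank_mono (hleW' U hU.1.1.1 (hU.1.1.2.1 u hu).1 (hU.1.1.2.1 u hu).2 hu)
    rw [hW'.finrank_eq, hU.1.1.2.2.2] at hle
    have hd : 2 ≤ d := by omega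
    have h := ih (d - 2) (by omega) W' i j (l + 1) m
      (θ - (2 * k + (i + 2 * j + l) - (3 * i + 3 * j + 2 * l + d))) hW' (by omega) ?_
    · rw [Nat.cast_sub hd] at h
      push_cast at h
      refine ⟨le_trans (Nat.cast_le.2 (Set.ncard_le_ncard ?_)) h, ?_⟩
      · rintro U' ⟨hU', -, hu1, hu2, -⟩
        refine ⟨mem_kleinFamilyB_of_le hU'.1 hWW' (hleW' U' hU'.1.1.1 (hU'.1.1.2.1 u hu1).1
          (hU'.1.1.2.1 u hu1).2 hu1), fun v hv hv0 => ?_⟩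
        obtain ⟨a, b, h1, h2⟩ := hU'.2 v hv hv0
        exact ⟨a, b, hWW' h1, h2⟩
      · rw [hmR]
        linarith
    · intro y s p hyp
      have h1 := hθ (y + 1) s p (by omega)
      have hdR : (d : ℝ) = 2 * y + 2 + s + p := by
        exact_mod_cast (show d = 2 * y + 2 + s + p by omega)
      rw [hdR]
      simp only [kleinCostC, kleinCostD] at h1 ⊢
      push_cast at h1 ⊢
      ring_nf at h1 ⊢
      linarith
  · refine le_trans (Nat.cast_le.2 (Set.ncard_le_ncard ?_))
      (ncard_kleinFamilyD_le (B := B) (θ := θ) hXX hYY hYX hk hW hm fun s p hsp => ?_)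
    · rintro U ⟨hU, hU'⟩
      refine ⟨hU.1, fun u hu hu0 => ?_⟩
      by_contra h
      exact hU' ⟨u, hu, hu0, h⟩
    · have h1 := hθ 0 s p (by omega)
      simpa [kleinCostC] using h1

variable (hε : ε = 0 ∨ ε = 1 ∧ (∀ w, (∀ v, B w v = 0) → w = 0) ∧
  (∀ w, (∀ v, B w (X v) = 0) → X w = 0) ∧ (∀ w, (∀ v, B w (Y v) = 0) → Y w = 0))

include hε

/-- Good vectors generate modules of dimension 3 modulo `W`. They lie in the kernel of `X * Y`,
which contains the images of `X` and `Y`; with a form, only the common kernel part of `W` can be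
orthogonal to it, hence the saving `ε(3i + j)`. -/
theorem ncard_kleinFamilyB_le (d : ℕ) : ∀ (W : Submodule F V) (i j m : ℕ) (θ : ℝ),
    HasKleinBlocks X Y W i j 0 → 4 * i + 3 * j + d = m →
    (∀ x y s p : ℕ, 3 * x + 2 * y + s + p = d → kleinCostB ε k i j x y s p ≤ θ) →
    ((kleinFamilyB B X Y W m).ncard : ℝ) ≤ cardPow F (θ + 6 * d + 2) := by
  induction d using Nat.strong_induction_on with
  | _ d ih =>
  intro W i j m θ hW hm hθ
  have hmR : (m : ℝ) = 4 * i + 3 * j + d := by exact_mod_cast hm.symm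
  have hd0 : (0 : ℝ) ≤ d := d.cast_nonneg
  refine ncard_le_of_witness_or (A := kleinFamilyB B X Y W m)
    (P := fun U => ∃ u ∈ U, X (Y u) = 0 ∧ ∀ a b : F, a • X u + b • Y u ∈ W → a = 0 ∧ b = 0)
    (T := ((LinearMap.ker (X * Y) ⊓ rightPerp B W : Submodule F V) : Set V))
    -- The bad vectors are not a subspace here; the count of good ones is
    -- `le_ncard_linearIndependent_mod`, whence the `2` in `s`.
    (fun U => {u | u ∈ U ∧ X (Y u) = 0 ∧ ∀ a b : F, a • X u + b • Y u ∈ W → a = 0 ∧ b = 0})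
    (t := 3 * k - ε * (3 * i + j)) (s := m - i - 2)
    (b := θ - (3 * k - ε * (3 * i + j) - (3 * i + 3 * j + d)) + 6 * (d - 3) + 2)
    (c := θ + 4 * d + 1) ?_ ?_ ?_ ?_ ?_ (by linarith)
  · apply ncard_submodule_le
    have h1 : (finrank F (LinearMap.ker (X * Y)) : ℝ) ≤ 3 * k := by
      have : ((finrank F (LinearMap.ker (X * Y)) : ℕ) : ℝ) ≤
          (3 * finrank F (commonKer X Y) : ℕ) := by
        exact_mod_cast finrank_ker_mul_le hXX hYY hYX
      push_cast at this
      linarith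
    refine (finrank_inf_rightPerp_le_sub B _ W (ε := ε)
      (z := finrank F (W ⊓ commonKer X Y : Submodule F V)) ?_ h1).trans (le_of_eq ?_)
    · rcases hε with h | ⟨h, -, hX, hY⟩
      · exact Or.inl h
      · refine Or.inr ⟨h, Submodule.finrank_mono (inf_le_inf_left W fun w hw => ⟨?_, ?_⟩)⟩
        · exact hX w fun v => hw _ (by rw [mem_ker_mul, ← hYX, hXX, map_zero])
        · exact hY w fun v => hw _ (by rw [mem_ker_mul, hYY, map_zero])
    · rw [hW.finrank_eq, hW.finrank_inf]
      push_cast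
      ring
  · rintro U ⟨⟨hWU, -, hUB, -⟩, -⟩ - u ⟨hu, hu0, -⟩
    exact ⟨hu0, hUB.le_rightPerp hWU hu⟩
  · rintro U hU ⟨u, hu, hu0, hu'⟩
    have h1 := finrank_inf_ker_mul hW hU
    have h2 := le_ncard_linearIndependent_mod X Y (U ⊓ LinearMap.ker (X * Y)) W ⟨hu, hu0⟩ hu'
    have h3 : ((i + finrank F (U ⊓ LinearMap.ker (X * Y) : Submodule F V) : ℕ) : ℝ) = m := by
      rw [h1]
    push_cast at h3
    rw [show (m : ℝ) - i = finrank F (U ⊓ LinearMap.ker (X * Y) : Submodule F V) by linarith]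
    refine h2.trans (Nat.cast_le.2 (Set.ncard_le_ncard ?_))
    rintro v ⟨⟨hv, hv'⟩, hv2⟩
    exact ⟨hv, hv', hv2⟩
  · rintro u - ⟨U, hU, -, hu, hu0, hu'⟩
    have hW' := hW.sup_three hXX hYY hYX hu0 hu'
    set W' := W ⊔ F ∙ X u ⊔ F ∙ Y u ⊔ F ∙ u with hW'def
    have hWW' : W ≤ W' := le_sup_left.trans (le_sup_left.trans le_sup_left)
    have hleW' : ∀ U' ∈ kleinFamilyB B X Y W m, u ∈ U' → W' ≤ U' := fun U' hU' h =>
      sup_le (sup_le (sup_le hU'.1.1 (span_le_of_mem (hU'.1.2.1 u h).1))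
        (span_le_of_mem (hU'.1.2.1 u h).2)) (span_le_of_mem h)
    have hle := Submodule.finrank_mono (hleW' U hU hu)
    rw [hW'.finrank_eq, hU.1.2.2.2] at hle
    have hd : 3 ≤ d := by omega
    have h := ih (d - 3) (by omega) W' i (j + 1) m
      (θ - (3 * k - ε * (3 * i + j) - (3 * i + 3 * j + d))) hW' (by omega) ?_
    · rw [Nat.cast_sub hd] at h
      push_cast at h
      refine ⟨le_trans (Nat.cast_le.2 (Set.ncard_le_ncard ?_)) h, ?_⟩
      · rintro U' ⟨hU', -, hu1, hu2, -⟩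
        exact mem_kleinFamilyB_of_le hU' hWW' (hleW' U' hU' hu1)
      · rw [hmR]
        linarith
    · intro x y s p hyp
      have h1 := hθ (x + 1) y s p (by omega)
      have hdR : (d : ℝ) = 3 * x + 3 + 2 * y + s + p := by
        exact_mod_cast (show d = 3 * x + 3 + 2 * y + s + p by omega)
      rw [hdR]
      simp only [kleinCostB, kleinCostC, kleinCostD] at h1 ⊢
      push_cast at h1 ⊢
      ring_nf at h1 ⊢
      linarith
  · refine le_trans (Nat.cast_le.2 (Set.ncard_le_ncard ?_))
      (ncard_kleinFamilyC_le (B := B) hXX hYY hYX hk d W i j 0 m θ hW (by omega)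
        fun y s p hsp => ?_)
    · rintro U ⟨hU, hU'⟩
      refine ⟨hU, fun u hu hu0 => ?_⟩
      by_contra! h
      exact hU' ⟨u, hu, hu0, h⟩
    · have h1 := hθ 0 y s p (by omega)
      simp only [kleinCostB] at h1
      push_cast at h1 ⊢
      ring_nf at h1 ⊢
      linarith

/-- Good vectors generate free modules of dimension 4 modulo `W`; they range over the whole
orthogonal complement of `W`. -/
theorem ncard_kleinFamily_le (d : ℕ) : ∀ (W : Submodule F V) (i m : ℕ) (θ : ℝ),
    HasKleinBlocks X Y W i 0 0 → 4 * i + d = m →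
    (∀ r x y s p : ℕ, 4 * r + 3 * x + 2 * y + s + p = d → kleinCostA ε k i r x y s p ≤ θ) →
    ((kleinFamily B X Y W m).ncard : ℝ) ≤ cardPow F (θ + 8 * d + 3) := by
  induction d using Nat.strong_induction_on with
  | _ d ih =>
  intro W i m θ hW hm hθ
  have hmR : (m : ℝ) = 4 * i + d := by exact_mod_cast hm.symm
  have hd0 : (0 : ℝ) ≤ d := d.cast_nonneg
  refine ncard_le_of_witness_or (A := kleinFamily B X Y W m)
    (P := fun U => ∃ u ∈ U, X (Y u) ∉ W)
    (T := ((⊤ ⊓ rightPerp B W : Submodule F V) : Set V))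
    (fun U => {u | u ∈ U ∧ X (Y u) ∉ W})
    (t := 4 * k - 4 * ε * i) (s := m - 1)
    (b := θ - (4 * k - 4 * ε * i - (4 * i + d)) + 8 * (d - 4) + 3)
    (c := θ + 6 * d + 2) ?_ ?_ ?_ ?_ ?_ (by linarith)
  · apply ncard_submodule_le
    have h1 : (finrank F (⊤ : Submodule F V) : ℝ) ≤ 4 * k := by
      have : ((finrank F V : ℕ) : ℝ) ≤ (4 * finrank F (commonKer X Y) : ℕ) := by
        exact_mod_cast finrank_le_four_mul hXX hYY hYX
      push_cast at this
      rw [finrank_top]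
      linarith
    refine (finrank_inf_rightPerp_le_sub B _ W (ε := ε) (z := 0) ?_ h1).trans (le_of_eq ?_)
    · rcases hε with h | ⟨h, hB, -⟩
      · exact Or.inl h
      · refine Or.inr ⟨h, ?_⟩
        have : W ⊓ leftPerp B ⊤ = ⊥ := by
          rw [Submodule.eq_bot_iff]
          rintro w ⟨-, hw⟩
          exact hB w fun v => hw v trivial
        rw [this, finrank_bot]
    · rw [hW.finrank_eq]
      push_cast
      ring
  · rintro U ⟨hWU, -, hUB, -⟩ - u ⟨hu, -⟩
    exact ⟨trivial, hUB.le_rightPerp hWU hu⟩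
  · rintro U hU ⟨u, hu, hu'⟩
    have h2 := le_ncard_diff (U := U) (K := W.comap (X * Y)) (fun h => hu' (h hu))
    rw [hU.2.2.2] at h2
    exact h2.trans (Nat.cast_le.2 (Set.ncard_le_ncard fun v hv => ⟨hv.1, hv.2⟩))
  · rintro u - ⟨U, hU, -, hu, hu'⟩
    have hW' := hW.sup_free hXX hYY hYX hu'
    set W' := W ⊔ F ∙ X (Y u) ⊔ F ∙ X u ⊔ F ∙ Y u ⊔ F ∙ u with hW'def
    have hleW' : ∀ U' ∈ kleinFamily B X Y W m, u ∈ U' → W' ≤ U' := fun U' hU' h =>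
      sup_le (sup_le (sup_le (sup_le hU'.1
        (span_le_of_mem (hU'.2.1 _ (hU'.2.1 u h).2).1)) (span_le_of_mem (hU'.2.1 u h).1))
        (span_le_of_mem (hU'.2.1 u h).2)) (span_le_of_mem h)
    have hle := Submodule.finrank_mono (hleW' U hU hu)
    rw [hW'.finrank_eq, hU.2.2.2] at hle
    have hd : 4 ≤ d := by omega
    have h := ih (d - 4) (by omega) W' (i + 1) m
      (θ - (4 * k - 4 * ε * i - (4 * i + d))) hW' (by omega) ?_
    · rw [Nat.cast_sub hd] at h
      push_cast at h
      refine ⟨le_trans (Nat.cast_le.2 (Set.ncard_le_ncard ?_)) h, ?_⟩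
      · rintro U' ⟨hU', -, hu1, hu2⟩
        exact ⟨hleW' U' hU' hu1, hU'.2⟩
      · rw [hmR]
        linarith
    · intro r x y s p hyp
      have h1 := hθ (r + 1) x y s p (by omega)
      have hdR : (d : ℝ) = 4 * r + 4 + 3 * x + 2 * y + s + p := by
        exact_mod_cast (show d = 4 * r + 4 + 3 * x + 2 * y + s + p by omega)
      rw [hdR]
      simp only [kleinCostA, kleinCostB, kleinCostC, kleinCostD] at h1 ⊢
      push_cast at h1 ⊢
      ring_nf at h1 ⊢
      linarith
  · refine le_trans (Nat.cast_le.2 (Set.ncard_le_ncard ?_))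
      (ncard_kleinFamilyB_le (B := B) hXX hYY hYX hk hε d W i 0 m θ hW (by omega)
        fun x y s p hsp => ?_)
    · rintro U ⟨hU, hU'⟩
      push Not at hU'
      -- `W` consists of free blocks only, so both sides have dimension `i`. Thus if `X * Y` maps
      -- `U` into `W`, it maps `U` into its image of `W`.
      have heq : W.map (X * Y) = W ⊓ commonKer X Y := by
        refine Submodule.eq_of_le_of_finrank_eq ?_ (by rw [hW.finrank_map, hW.finrank_inf]; ring)
        rintro _ ⟨w, hw, rfl⟩
        refine ⟨(hW.invariant _ (hW.invariant w hw).2).1, hXX _, ?_⟩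
        rw [SetLike.mem_coe, LinearMap.mem_ker, Module.End.mul_apply, hYX, hYY, map_zero]
      refine ⟨hU, ?_⟩
      rw [heq]
      rintro _ ⟨u, hu, rfl⟩
      refine ⟨hU' u hu, hXX _, ?_⟩
      rw [SetLike.mem_coe, LinearMap.mem_ker, Module.End.mul_apply, hYX, hYY, map_zero]
    · have h1 := hθ 0 x y s p (by omega)
      simp only [kleinCostA] at h1
      push_cast at h1 ⊢
      ring_nf at h1 ⊢
      linarith

/-- The bound for the number of totally isotropic subspaces of dimension `m` that are invariant
under two commuting operators with square zero, when the kernels are as in a free module. -/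
theorem ncard_invariant_of_commuting_sq_eq_zero (m : ℕ) :
    ({U : Submodule F V | (∀ u ∈ U, X u ∈ U ∧ Y u ∈ U) ∧ TotallyIsotropic B U ∧
      finrank F U = m}.ncard : ℝ) ≤
        cardPow F (m * k - (1 / 4 + ε / 44) * m ^ 2 + 9 * m + 3) := by
  have hbot : HasKleinBlocks X Y (⊥ : Submodule F V) 0 0 0 :=
    ⟨by simp, by simp, by simp, by simp⟩
  have h := ncard_kleinFamily_le (B := B) hXX hYY hYX hk hε m ⊥ 0 m
    (m * k - (1 / 4 + ε / 44) * m ^ 2 + m) hbot (by omega) ?_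
  · have hset : kleinFamily B X Y ⊥ m = {U : Submodule F V | (∀ u ∈ U, X u ∈ U ∧ Y u ∈ U) ∧
        TotallyIsotropic B U ∧ finrank F U = m} := by
      ext U
      simp [kleinFamily]
    rw [hset] at h
    exact h.trans (le_of_eq (by congr 1; ring))
  · intro r x y s p h
    have hmR : (m : ℝ) = 4 * r + 3 * x + 2 * y + s + p := by exact_mod_cast h.symm
    have hr : (0 : ℝ) ≤ r := r.cast_nonneg
    have hx : (0 : ℝ) ≤ x := x.cast_nonneg
    have hy : (0 : ℝ) ≤ y := y.cast_nonneg
    have hs : (0 : ℝ) ≤ s := s.cast_nonneg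
    have hp : (0 : ℝ) ≤ p := p.cast_nonneg
    rw [hmR]
    simp only [kleinCostA, kleinCostB, kleinCostC, kleinCostD]
    push_cast
    -- For `ε = 0` the ratio `1/4` is attained by free modules, and also by `x = p`. For `ε = 1`
    -- free modules alone would allow `1/4 + 1/8`, but mixtures are worse: with `r = s = 0` and `x :
    -- y : p = 6 : 3 : 7` the ratio is `17/62`, just above `1/4 + 1/44 = 3/11`.
    rcases hε with rfl | ⟨rfl, -⟩
    · push_cast
      nlinarith only [sq_nonneg ((x : ℝ) - p), mul_nonneg hx hs, mul_nonneg hy hs, mul_nonneg hp hs,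
        sq_nonneg (y : ℝ), sq_nonneg (s : ℝ), hr, hx, hy, hs, hp]
    · push_cast
      nlinarith only [sq_nonneg ((p : ℝ) - (9 * x + r + y / 2) / 8), sq_nonneg ((x : ℝ) - 3 / 2 * y),
        sq_nonneg ((y : ℝ) - 3 / 2 * r), sq_nonneg ((r : ℝ) - s), sq_nonneg (r : ℝ),
        sq_nonneg (s : ℝ), mul_nonneg hr hx, mul_nonneg hx hs, mul_nonneg hy hs, mul_nonneg hp hs,
        hr, hx, hy, hs, hp]

end KleinCount

/-! ### ### Splitting under an involution in odd characteristic -/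

section Split

variable {F V : Type*} [Field F] [Finite F] [AddCommGroup V] [Module F V] [FiniteDimensional F V]
  [Finite V] {σ : F →+* F} {B : V →ₛₗ[σ] V →ₗ[F] F} {ε : ℕ} {k : ℝ}

/-- The bound of `ncard_invariant_of_sq_eq_smul` for isometries. -/
theorem ncard_invariant_of_isometry_sq_eq_smul (hσ : ∀ c, σ (σ c) = c) {y : End F V} {η : F}
    (hη : η ≠ 0) (hy : ∀ v, y (y v) = η • v) (hiso : ∀ v w, B (y v) (y w) = B v w)
    (hε : ε = 0 ∨ ε = 1 ∧ ∀ w, (∀ v, B w v = 0) → w = 0) (hV : (finrank F V : ℝ) ≤ 2 * k)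
    (hE : ∀ a : F, (finrank F (End.eigenspace y a) : ℝ) ≤ k) (m : ℕ) :
    ({U : Submodule F V | (∀ u ∈ U, y u ∈ U) ∧ TotallyIsotropic B U ∧
      finrank F U = m}.ncard : ℝ) ≤
        cardPow F (m * k - (1 / 2 + ε / 4) * m ^ 2 + 3 * m) := by
  refine ncard_invariant_of_sq_eq_smul B y hy ?_ hV hE m
  -- The adjoint of the isometry `y` is its inverse `η⁻¹ • y`; so `w` is orthogonal to the image of
  -- `y - a` exactly when `η⁻¹ • y w = σ a • w`.
  refine hε.imp id fun h => ⟨h.1, h.2, fun a => ⟨η * σ a, fun w hw => ?_⟩⟩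
  have h1 : η⁻¹ • y w - σ a • w = 0 := h.2 _ fun v => by
    have h2 := hiso (η⁻¹ • y w) v
    rw [map_smul y, hy, smul_smul, inv_mul_cancel₀ hη, one_smul] at h2
    have h3 := hw v
    rw [map_sub, h2, LinearMap.map_smul] at h3
    rw [map_sub, LinearMap.sub_apply, B.map_smulₛₗ (σ a), hσ, LinearMap.smul_apply, h3]
  rw [mul_smul, ← sub_eq_zero.1 h1, smul_smul, mul_inv_cancel₀ hη, one_smul]

theorem finrank_comap_subtype (P U : Submodule F V) :
    finrank F (U.comap P.subtype) = finrank F (U ⊓ P : Submodule F V) := by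
  rw [← Submodule.finrank_map_subtype_eq P (U.comap P.subtype), Submodule.map_comap_subtype,
    inf_comm]

variable {z y : End F V}

theorem inf_eigenspace_sup_eq (h2 : (2 : F) ≠ 0) (hz : ∀ v, z (z v) = v) {U : Submodule F V}
    (hU : ∀ u ∈ U, z u ∈ U) :
    (U ⊓ End.eigenspace z 1) ⊔ (U ⊓ End.eigenspace z (-1)) = U := by
  refine le_antisymm (sup_le inf_le_left inf_le_left) fun u hu => ?_
  have h : (2 : F)⁻¹ • (u + z u) + (2 : F)⁻¹ • (u - z u) = u := by
    rw [← smul_add, add_add_sub_cancel, ← two_smul F u, smul_smul, inv_mul_cancel₀ h2, one_smul]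
  rw [← h]
  refine Submodule.add_mem_sup ⟨U.smul_mem _ (U.add_mem hu (hU u hu)), ?_⟩
    ⟨U.smul_mem _ (U.sub_mem hu (hU u hu)), ?_⟩
  · rw [SetLike.mem_coe, End.mem_eigenspace_iff, map_smul, map_add, hz, one_smul, add_comm]
  · rw [SetLike.mem_coe, End.mem_eigenspace_iff, map_smul, map_sub, hz, neg_one_smul, ← smul_neg,
      neg_sub]

theorem eigenspace_inf_eigenspace_neg (h2 : (2 : F) ≠ 0) :
    End.eigenspace z 1 ⊓ End.eigenspace z (-1) = ⊥ := by
  rw [Submodule.eq_bot_iff]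
  rintro v ⟨h1, h3⟩
  rw [SetLike.mem_coe, End.mem_eigenspace_iff] at h1 h3
  rw [h1, one_smul, neg_one_smul, eq_neg_iff_add_eq_zero, ← two_smul F v, smul_eq_zero] at h3
  exact h3.resolve_left h2

theorem finrank_inf_eigenspace_add (h2 : (2 : F) ≠ 0) (hz : ∀ v, z (z v) = v)
    {U : Submodule F V} (hU : ∀ u ∈ U, z u ∈ U) :
    finrank F (U ⊓ End.eigenspace z 1 : Submodule F V) +
      finrank F (U ⊓ End.eigenspace z (-1) : Submodule F V) = finrank F U := by
  have h := Submodule.finrank_sup_add_finrank_inf_eq (U ⊓ End.eigenspace z 1)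
    (U ⊓ End.eigenspace z (-1))
  rw [inf_eigenspace_sup_eq h2 hz hU, ← inf_inf_distrib_left, eigenspace_inf_eigenspace_neg h2,
    inf_bot_eq, finrank_bot, add_zero] at h
  exact h.symm

/-- The two eigenspaces of an isometric involution are orthogonal, since `2 ≠ 0`, so the form is
nondegenerate on each. -/
theorem eq_zero_of_mem_eigenspace (h2 : (2 : F) ≠ 0) (hz : ∀ v, z (z v) = v)
    (hziso : ∀ v w, B (z v) (z w) = B v w) (hB : ∀ w, (∀ v, B w v = 0) → w = 0) {e : F}
    (he : e = 1 ∨ e = -1) {w : V} (hw : w ∈ End.eigenspace z e)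
    (h : ∀ v ∈ End.eigenspace z e, B w v = 0) : w = 0 := by
  have key : ∀ e : F, e = 1 ∨ e = -1 → ∀ w ∈ End.eigenspace z e,
      ∀ v ∈ End.eigenspace z (-e), B w v = 0 := by
    intro e he w hw v hv
    rw [End.mem_eigenspace_iff] at hw hv
    have h1 := hziso w v
    rw [hw, hv, map_smulₛₗ B e, LinearMap.smul_apply, map_smul, smul_smul] at h1
    rcases he with rfl | rfl
    · rw [map_one, one_mul, neg_one_smul, neg_eq_iff_add_eq_zero, ← two_smul F, smul_eq_zero] at h1
      exact h1.resolve_left h2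
    · rw [map_neg, map_one, neg_neg, mul_one, neg_one_smul, neg_eq_iff_add_eq_zero, ← two_smul F,
        smul_eq_zero] at h1
      exact h1.resolve_left h2
  refine hB w fun v => ?_
  have hv : v ∈ (⊤ ⊓ End.eigenspace z 1) ⊔ (⊤ ⊓ End.eigenspace z (-1)) := by
    rw [inf_eigenspace_sup_eq h2 hz (fun u _ => Submodule.mem_top)]
    trivial
  rw [top_inf_eq, top_inf_eq, Submodule.mem_sup] at hv
  obtain ⟨v₁, h1, v₂, h3, rfl⟩ := hv
  rw [map_add]
  rcases he with rfl | rfl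
  · rw [h _ h1, key 1 (Or.inl rfl) w hw _ h3, add_zero]
  · rw [h _ h3, key (-1) (Or.inr rfl) w hw _ (by rwa [neg_neg]), add_zero]

/-- The bound for one eigenspace of an involution. -/
theorem ncard_invariant_eigenspace_le (hσ : ∀ c, σ (σ c) = c) (h2 : (2 : F) ≠ 0)
    (hz : ∀ v, z (z v) = v) (hziso : ∀ v w, B (z v) (z w) = B v w)
    (hyiso : ∀ v w, B (y v) (y w) = B v w) (hyz : ∀ v, y (z v) = z (y v))
    (hε : ε = 0 ∨ ε = 1 ∧ ∀ w, (∀ v, B w v = 0) → w = 0) {e η : F} (he : e = 1 ∨ e = -1)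
    (hη : η ≠ 0) (hy : ∀ v ∈ End.eigenspace z e, y (y v) = η • v)
    (hV : (finrank F (End.eigenspace z e) : ℝ) ≤ 2 * k)
    (hE : ∀ a : F, (finrank F (End.eigenspace z e ⊓ End.eigenspace y a : Submodule F V) : ℝ) ≤ k)
    (m : ℕ) :
    ∃ y' : End F (End.eigenspace z e), (∀ v, (y' v : V) = y v) ∧
    ({U : Submodule F (End.eigenspace z e) | (∀ u ∈ U, y' u ∈ U) ∧
      TotallyIsotropic (B.domRestrict₁₂ _ _) U ∧ finrank F U = m}.ncard : ℝ) ≤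
        cardPow F (m * k - (1 / 2 + ε / 4) * m ^ 2 + 3 * m) := by
  have hP : ∀ v ∈ End.eigenspace z e, y v ∈ End.eigenspace z e := by
    intro v hv
    rw [End.mem_eigenspace_iff] at hv ⊢
    rw [← hyz, hv, map_smul]
  refine ⟨y.restrict hP, fun _ => rfl, ?_⟩
  refine ncard_invariant_of_isometry_sq_eq_smul hσ hη (fun v => Subtype.ext (hy v v.2))
    (fun v w => hyiso v w) ?_ hV (fun a => ?_) m
  · refine hε.imp id fun h => ⟨h.1, fun w hw => Subtype.ext ?_⟩
    exact eq_zero_of_mem_eigenspace h2 hz hziso h.2 he w.2 fun v hv => hw ⟨v, hv⟩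
  · refine le_trans (Nat.cast_le.2 ?_) (hE a)
    rw [inf_comm, ← finrank_comap_subtype]
    refine Submodule.finrank_mono fun v hv => ?_
    rw [End.mem_eigenspace_iff] at hv
    rw [Submodule.mem_comap, End.mem_eigenspace_iff]
    exact congrArg Subtype.val hv

/-- In odd characteristic, the bound for a pair of commuting isometries, one of them an involution
such that the square of the other is scalar on its eigenspaces. -/
theorem ncard_invariant_of_involution (hσ : ∀ c, σ (σ c) = c) (h2 : (2 : F) ≠ 0)
    (hz : ∀ v, z (z v) = v) (hziso : ∀ v w, B (z v) (z w) = B v w)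
    (hyiso : ∀ v w, B (y v) (y w) = B v w) (hyz : ∀ v, y (z v) = z (y v))
    (hε : ε = 0 ∨ ε = 1 ∧ ∀ w, (∀ v, B w v = 0) → w = 0)
    (hy : ∀ e : F, e = 1 ∨ e = -1 → ∃ η : F, η ≠ 0 ∧ ∀ v ∈ End.eigenspace z e, y (y v) = η • v)
    (hV : ∀ e : F, e = 1 ∨ e = -1 → (finrank F (End.eigenspace z e) : ℝ) ≤ 2 * k)
    (hE : ∀ e a : F, e = 1 ∨ e = -1 →
      (finrank F (End.eigenspace z e ⊓ End.eigenspace y a : Submodule F V) : ℝ) ≤ k) (m : ℕ) :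
    ({U : Submodule F V | (∀ u ∈ U, z u ∈ U ∧ y u ∈ U) ∧ TotallyIsotropic B U ∧
      finrank F U = m}.ncard : ℝ) ≤
        cardPow F (m * k - (1 / 4 + ε / 8) * m ^ 2 + 4 * m) := by
  set A := {U : Submodule F V | (∀ u ∈ U, z u ∈ U ∧ y u ∈ U) ∧ TotallyIsotropic B U ∧
      finrank F U = m} with hA
  have h := ncard_le_of_fibers (A := A) (T := (Set.univ : Set (Fin (m + 1))))
    (fun U => Fin.ofNat (m + 1) (finrank F (U ⊓ End.eigenspace z 1 : Submodule F V)))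
    (M := cardPow F (m * k - (1 / 4 + ε / 8) * m ^ 2 + 3 * m)) (fun _ _ => trivial) ?_
  · refine h.trans ?_
    rw [Set.ncard_univ, Nat.card_fin, show m * k - (1 / 4 + ε / 8) * m ^ 2 + 4 * (m : ℝ) =
      m + (m * k - (1 / 4 + ε / 8) * m ^ 2 + 3 * m) by ring, cardPow_add (F := F) (m : ℝ)]
    refine mul_le_mul_of_nonneg_right ?_ (cardPow_pos _).le
    push_cast
    exact natCast_add_one_le_cardPow m
  rintro s -
  obtain ⟨η₁, hη₁, hy₁⟩ := hy 1 (Or.inl rfl)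
  obtain ⟨η₂, hη₂, hy₂⟩ := hy (-1) (Or.inr rfl)
  obtain ⟨y₁, hyy₁, hb₁⟩ := ncard_invariant_eigenspace_le hσ h2 hz hziso hyiso hyz hε (Or.inl rfl)
    hη₁ hy₁ (hV 1 (Or.inl rfl)) (fun a => hE 1 a (Or.inl rfl)) s
  obtain ⟨y₂, hyy₂, hb₂⟩ := ncard_invariant_eigenspace_le hσ h2 hz hziso hyiso hyz hε (Or.inr rfl)
    hη₂ hy₂ (hV (-1) (Or.inr rfl)) (fun a => hE (-1) a (Or.inr rfl)) (m - s)
  -- `U` is the sum of its intersections with the eigenspaces, so it is counted by pairs of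
  -- subspaces of dimensions `s` and `m - s`.
  have hinj : Set.InjOn (fun U : Submodule F V => (U.comap (End.eigenspace z (1 : F)).subtype,
      U.comap (End.eigenspace z (-1 : F)).subtype))
      {U ∈ A | Fin.ofNat (m + 1) (finrank F (U ⊓ End.eigenspace z 1 : Submodule F V)) = s} := by
    intro U hU U' hU' h
    have h1 := congrArg (Submodule.map (End.eigenspace z (1 : F)).subtype) (congrArg Prod.fst h)
    have h3 := congrArg (Submodule.map (End.eigenspace z (-1 : F)).subtype) (congrArg Prod.snd h)
    simp only [Submodule.map_comap_subtype] at h1 h3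
    rw [← inf_eigenspace_sup_eq h2 hz (fun u hu => (hU.1.1 u hu).1),
      ← inf_eigenspace_sup_eq h2 hz (fun u hu => (hU'.1.1 u hu).1), inf_comm, h1,
      inf_comm U, h3, inf_comm (End.eigenspace z 1), inf_comm (End.eigenspace z (-1))]
  rw [← hinj.ncard_image]
  refine le_trans (Nat.cast_le.2 (Set.ncard_le_ncard (t := {U | (∀ u ∈ U, y₁ u ∈ U) ∧
      TotallyIsotropic (B.domRestrict₁₂ _ _) U ∧ finrank F U = s} ×ˢ {U | (∀ u ∈ U, y₂ u ∈ U) ∧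
      TotallyIsotropic (B.domRestrict₁₂ _ _) U ∧ finrank F U = m - s}) ?_)) ?_
  · rintro _ ⟨U, ⟨⟨hU, hUB, hUm⟩, hUs⟩, rfl⟩
    have h3 := finrank_inf_eigenspace_add h2 hz (fun u hu => (hU u hu).1)
    have h1 := congrArg Fin.val hUs
    rw [Fin.val_ofNat, Nat.mod_eq_of_lt (by omega)] at h1
    refine ⟨⟨fun u hu => ?_, fun u hu v hv => hUB u hu v hv, ?_⟩,
      fun u hu => ?_, fun u hu v hv => hUB u hu v hv, ?_⟩
    · rw [Submodule.mem_comap, Submodule.subtype_apply, hyy₁]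
      exact (hU u hu).2
    · rw [finrank_comap_subtype, h1]
    · rw [Submodule.mem_comap, Submodule.subtype_apply, hyy₂]
      exact (hU u hu).2
    · rw [finrank_comap_subtype]
      omega
  · rw [Set.ncard_prod, Nat.cast_mul]
    refine (mul_le_mul hb₁ hb₂ (Nat.cast_nonneg _) (cardPow_pos _).le).trans ?_
    rw [← cardPow_add]
    apply cardPow_mono
    rw [Nat.cast_sub (by omega)]
    -- This is `s² + (m - s)² ≥ m² / 2`: the worst case is an equal division between the
    -- eigenspaces.
    have : (0 : ℝ) ≤ (1 / 4 + ε / 8) * (m - 2 * (s : ℕ)) ^ 2 := by positivity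
    nlinarith only [this]

end Split

/-! ### ### Eigenspaces and kernels in almost-free modules -/

section AlmostFree

variable {F V : Type*} [Field F] [Finite F] [AddCommGroup V] [Module F V] [FiniteDimensional F V]
  {A : Type*} [Group A] [Finite A] {ρ : A →* (V ≃ₗ[F] V)} {t s : ℕ}
  {b : Basis ((Fin t × Fin 2 × A) ⊕ Fin s) F V}

theorem finrank_eq_of_almostFree_basis (b : Basis ((Fin t × Fin 2 × A) ⊕ Fin s) F V) :
    finrank F V = t * (2 * Nat.card A) + s := by
  rw [finrank_eq_nat_card_basis b, Nat.card_sum, Nat.card_prod, Nat.card_prod]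
  simp

theorem repr_almostFree
    (hb : ∀ g i j h, ρ g (b (Sum.inl (i, j, h))) = b (Sum.inl (i, j, g * h)))
    (hb' : ∀ g j, ρ g (b (Sum.inr j)) = b (Sum.inr j)) (g : A) (v : V) (i : Fin t) (j : Fin 2)
    (h : A) : b.repr (ρ g v) (Sum.inl (i, j, g * h)) = b.repr v (Sum.inl (i, j, h)) := by
  classical
  have h1 : (b.coord (Sum.inl (i, j, g * h))) ∘ₗ (ρ g : V →ₗ[F] V) =
      b.coord (Sum.inl (i, j, h)) := by
    refine b.ext fun x => ?_
    rcases x with ⟨i', j', h'⟩ | j'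
    · simp [hb, Finsupp.single_apply]
    · simp [hb']
  exact LinearMap.congr_fun h1 v

/-- A subspace on which a subgroup `C` acts by scalars has dimension at most `(n - s) / |C| + s`. -/
theorem finrank_mul_card_le
    (hb : ∀ g i j h, ρ g (b (Sum.inl (i, j, h))) = b (Sum.inl (i, j, g * h)))
    (hb' : ∀ g j, ρ g (b (Sum.inr j)) = b (Sum.inr j)) (C : Subgroup A) (E : Submodule F V)
    (hE : ∀ c ∈ C, ∃ l : F, ∀ v ∈ E, ρ c v = l • v) :
    finrank F E * Nat.card C ≤ finrank F V + Nat.card C * s := by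
  let R := Quotient (QuotientGroup.rightRel C)
  have hR : Nat.card R * Nat.card C = Nat.card A := by
    rw [Nat.card_congr (QuotientGroup.quotientRightRelEquivQuotientLeftRel C)]
    exact (Subgroup.card_eq_card_quotient_mul_card_subgroup C).symm
  -- `C` permutes the coordinates of the free part by left multiplication and acts on `E` by
  -- scalars. So a vector of `E` is determined by its coordinates at one representative of each
  -- right coset of `C`, and those on the trivial part.
  let f : E →ₗ[F] ((Fin t × Fin 2 × R) ⊕ Fin s → F) := LinearMap.pi fun x =>
    (b.coord (x.map (fun y => (y.1, y.2.1, y.2.2.out)) id)) ∘ₗ E.subtype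
  have hf : Function.Injective f := by
    rw [injective_iff_map_eq_zero]
    intro v hv
    have hv1 : ∀ i j (r : R), b.repr (v : V) (Sum.inl (i, j, r.out)) = 0 := fun i j r =>
      congrFun hv (Sum.inl (i, j, r))
    have hv2 : ∀ j, b.repr (v : V) (Sum.inr j) = 0 := fun j => congrFun hv (Sum.inr j)
    by_contra hv0
    refine hv0 (Subtype.ext (b.ext_elem fun x => ?_))
    rw [Submodule.coe_zero, map_zero, Finsupp.zero_apply]
    rcases x with ⟨i, j, h⟩ | j
    · have h1 : (QuotientGroup.rightRel C) h (Quotient.mk (QuotientGroup.rightRel C) h).out :=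
        (QuotientGroup.rightRel C).symm' (Quotient.mk_out (s := QuotientGroup.rightRel C) h)
      have h2 := QuotientGroup.rightRel_apply.1 h1
      obtain ⟨l, hl⟩ := hE _ h2
      have h3 := repr_almostFree hb hb' ((Quotient.mk (QuotientGroup.rightRel C) h).out * h⁻¹)
        (v : V) i j h
      rw [inv_mul_cancel_right, hl v v.2, map_smul, Finsupp.smul_apply, hv1, smul_zero] at h3
      exact h3.symm
    · exact hv2 j
  have : Fintype R := Fintype.ofFinite R
  have h := LinearMap.finrank_le_finrank_of_injective hf
  rw [finrank_fintype_fun_eq_card] at h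
  rw [finrank_eq_of_almostFree_basis b]
  have h1 : Fintype.card ((Fin t × Fin 2 × R) ⊕ Fin s) = t * (2 * Nat.card R) + s := by
    rw [Fintype.card_eq_nat_card, Nat.card_sum, Nat.card_prod, Nat.card_prod]
    simp
  rw [h1] at h
  calc finrank F E * Nat.card C ≤ (t * (2 * Nat.card R) + s) * Nat.card C :=
        Nat.mul_le_mul_right _ h
    _ = t * (2 * (Nat.card R * Nat.card C)) + Nat.card C * s := by ring
    _ ≤ _ := by rw [hR]; omega

theorem finrank_le_div_add
    (hb : ∀ g i j h, ρ g (b (Sum.inl (i, j, h))) = b (Sum.inl (i, j, g * h)))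
    (hb' : ∀ g j, ρ g (b (Sum.inr j)) = b (Sum.inr j)) (C : Subgroup A) (E : Submodule F V)
    (hE : ∀ c ∈ C, ∃ l : F, ∀ v ∈ E, ρ c v = l • v) {e : ℕ} (he : Nat.card C = e) (he0 : 0 < e) :
    (finrank F E : ℝ) ≤ finrank F V / e + s := by
  have h := finrank_mul_card_le hb hb' C E hE
  rw [he] at h
  have h1 : (finrank F E : ℝ) * e ≤ finrank F V + e * s := by exact_mod_cast h
  have h2 : (0 : ℝ) < e := by exact_mod_cast he0
  rw [← sub_le_iff_le_add, le_div_iff₀ h2]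
  linarith

theorem finrank_le_of_zpowers
    (hb : ∀ g i j h, ρ g (b (Sum.inl (i, j, h))) = b (Sum.inl (i, j, g * h)))
    (hb' : ∀ g j, ρ g (b (Sum.inr j)) = b (Sum.inr j)) (x : A) {e : ℕ} (he : orderOf x = e)
    (E : Submodule F V) (l : F) (hE : ∀ v ∈ E, ρ x v = l • v) :
    (finrank F E : ℝ) ≤ finrank F V / e + s := by
  refine finrank_le_div_add hb hb' (Subgroup.zpowers x) E (fun c hc => ?_)
    ((Nat.card_zpowers x).trans he) (he ▸ orderOf_pos x)
  obtain ⟨n, rfl⟩ := mem_powers_iff_mem_zpowers.2 hc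
  refine ⟨l ^ n, fun v hv => ?_⟩
  induction n with
  | zero => simp
  | succ n ih =>
    simp only [pow_succ', map_mul, LinearEquiv.mul_apply] at ih ⊢
    rw [ih (Subgroup.npow_mem_zpowers x n), map_smul, hE v hv, smul_smul, mul_comm]

end AlmostFree

/-! ### ### Powers of an isometry minus the identity -/

section Unipotent

variable {F V : Type*} [Field F] [Finite F] [AddCommGroup V] [Module F V] [FiniteDimensional F V]
  [Finite V]   {σ : F →+* F} {B : V →ₛₗ[σ] V →ₗ[F] F}

/-- The adjoint of `g - 1` is `g⁻¹ - 1 = -g⁻¹ (g - 1)`, so the left orthogonal of the image of `(g -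
1) ^ a` is its kernel. -/
theorem sub_one_pow_apply_eq_zero (hB : ∀ w, (∀ v, B w v = 0) → w = 0) (g : V ≃ₗ[F] V)
    (hg : ∀ v w, B (g v) (g w) = B v w) (a : ℕ) : ∀ w,
    (∀ v, B w ((((g : End F V) - 1) ^ a) v) = 0) → (((g : End F V) - 1) ^ a) w = 0 := by
  induction a with
  | zero => simpa using hB
  | succ a ih =>
    intro w hw
    have hgg : ∀ v, g (g.symm v) = v := g.apply_symm_apply
    have h := ih (g.symm w - w) fun v => by
      have h1 := hw v
      rw [pow_succ', Module.End.mul_apply, LinearMap.sub_apply, map_sub] at h1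
      have h2 := hg (g.symm w) ((((g : End F V) - 1) ^ a) v)
      rw [hgg] at h2
      rw [map_sub, LinearMap.sub_apply, ← h2]
      exact h1
    have h1 : (((g : End F V) - 1) ^ (a + 1)) w =
        - g ((((g : End F V) - 1) ^ a) (g.symm w - w)) := by
      have hc : ∀ v, g ((((g : End F V) - 1) ^ a) v) = (((g : End F V) - 1) ^ a) (g v) := by
        intro v
        have : Commute (g : End F V) (((g : End F V) - 1) ^ a) :=
          ((Commute.refl _).sub_right (Commute.one_right _)).pow_right a
        exact LinearMap.congr_fun this.eq v
      rw [hc, map_sub g, hgg, pow_succ, Module.End.mul_apply, ← map_neg, neg_sub]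
      rfl
    rw [h1, h, map_zero, neg_zero]

theorem finrank_ker_pow_le (N : End F V) (a : ℕ) :
    finrank F (LinearMap.ker (N ^ a)) ≤ a * finrank F (LinearMap.ker N) := by
  induction a with
  | zero => simp [LinearMap.ker_id, Module.End.one_eq_id]
  | succ a ih =>
    rw [← finrank_map_add_finrank_inf_ker (N ^ a) (LinearMap.ker (N ^ (a + 1))), add_mul, one_mul,
      add_comm]
    refine Nat.add_le_add ((Submodule.finrank_mono inf_le_right).trans ih)
      (Submodule.finrank_mono ?_)
    rintro _ ⟨v, hv, rfl⟩
    rw [SetLike.mem_coe, LinearMap.mem_ker, pow_succ'] at hv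
    exact hv

end Unipotent

/-! ### ### Invariant subspaces of involutions, elements of order 4 and four-groups -/

section FixedBounds

variable {F V : Type*} [Field F] [Finite F] [AddCommGroup V] [Module F V] [FiniteDimensional F V]
  [Finite V] {σ : F →+* F} {B : V →ₛₗ[σ] V →ₗ[F] F} {ε : ℕ}
  {A : Type*} [Group A] [Finite A] {ρ : A →* (V ≃ₗ[F] V)} {t s : ℕ}
  {b : Basis ((Fin t × Fin 2 × A) ⊕ Fin s) F V}
  (hb : ∀ g i j h, ρ g (b (Sum.inl (i, j, h))) = b (Sum.inl (i, j, g * h)))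
  (hb' : ∀ g j, ρ g (b (Sum.inr j)) = b (Sum.inr j)) (hσ : ∀ c, σ (σ c) = c)
  (hiso : ∀ g v w, B (ρ g v) (ρ g w) = B v w)
  (hε : ε = 0 ∨ ε = 1 ∧ ∀ w, (∀ v, B w v = 0) → w = 0)

include hb hb' hσ hiso hε

theorem ncard_fixed_of_orderOf_two {x : A} (hx : orderOf x = 2) (m : ℕ) :
    ({U : Submodule F V | (∀ u ∈ U, ρ x u ∈ U) ∧ TotallyIsotropic B U ∧
      finrank F U = m}.ncard : ℝ) ≤
        cardPow F (m * (finrank F V / 2 + s) - (1 / 2 + ε / 4) * m ^ 2 + 3 * m) := by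
  have hs : (0 : ℝ) ≤ s := s.cast_nonneg
  refine ncard_invariant_of_isometry_sq_eq_smul (y := (ρ x : End F V)) (η := 1) hσ one_ne_zero
    (fun v => ?_) (hiso x) hε (by linarith) (fun a => ?_) m
  · have h := pow_orderOf_eq_one x
    rw [hx, pow_two] at h
    rw [one_smul]
    change (ρ x * ρ x) v = v
    rw [← map_mul, h, map_one]
    rfl
  · refine (finrank_le_of_zpowers hb hb' x hx _ a fun v hv => ?_).trans (by norm_num)
    exact End.mem_eigenspace_iff.1 hv

theorem ncard_fixed_of_orderOf_four {y : A} (hy : orderOf y = 4) (m : ℕ) :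
    ({U : Submodule F V | (∀ u ∈ U, ρ y u ∈ U) ∧ TotallyIsotropic B U ∧
      finrank F U = m}.ncard : ℝ) ≤
        cardPow F (m * (finrank F V / 4 + s) - (1 / 4 + ε / 8) * m ^ 2 + 8 * m + 3) := by
  have hs : (0 : ℝ) ≤ s := s.cast_nonneg
  have hm : (0 : ℝ) ≤ m := m.cast_nonneg
  have hy4 : (ρ y : End F V) ^ 4 = 1 := by
    have h := pow_orderOf_eq_one y
    rw [hy] at h
    ext v
    change (ρ y ^ 4) v = v
    rw [← map_pow, h, map_one]
    rfl
  by_cases h2 : (2 : F) = 0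
  · have h2' : (2 : End F V) = 0 := by
      ext v
      change (2 : End F V) v = 0
      rw [← one_add_one_eq_two, LinearMap.add_apply, Module.End.one_apply, ← two_smul F, h2,
        zero_smul]
    -- Characteristic 2: `y - 1` is nilpotent, and its kernel is bounded by almost-freeness, which
    -- bounds the kernels of all powers.
    have hN : ((ρ y : End F V) - 1) ^ 4 = 0 := by
      have h : ((ρ y : End F V) - 1) ^ 4 = (ρ y : End F V) ^ 4 - 1 + 2 *
          (-2 * (ρ y : End F V) ^ 3 + 3 * (ρ y : End F V) ^ 2 - 2 * (ρ y : End F V) + 1) := by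
        noncomm_ring
      rw [h, hy4, h2', zero_mul, sub_self, zero_add]
    refine le_trans ?_ ((ncard_invariant_of_pow_four_eq_zero (B := B) (N := (ρ y : End F V) - 1)
      (ε := ε) (k := finrank F V / 4 + s) ?_ hN (fun a => ?_) m).trans (cardPow_mono ?_))
    · refine Nat.cast_le.2 (Set.ncard_le_ncard ?_)
      rintro U ⟨hU, hU'⟩
      exact ⟨fun u hu => U.sub_mem (hU u hu) hu, hU'⟩
    · exact hε.imp id fun h => ⟨h.1, sub_one_pow_apply_eq_zero h.2 (ρ y) (hiso y)⟩
    · have h1 : (finrank F (LinearMap.ker ((ρ y : End F V) - 1)) : ℝ) ≤ finrank F V / (4 : ℕ) + s := by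
        refine finrank_le_of_zpowers hb hb' y hy _ 1 fun v hv => ?_
        rw [one_smul]
        exact sub_eq_zero.1 hv
      push_cast at h1
      have h3 : ((finrank F (LinearMap.ker (((ρ y : End F V) - 1) ^ a)) : ℕ) : ℝ) ≤
          (a * finrank F (LinearMap.ker ((ρ y : End F V) - 1)) : ℕ) :=
        Nat.cast_le.2 (finrank_ker_pow_le _ a)
      push_cast at h3
      exact h3.trans (mul_le_mul_of_nonneg_left h1 a.cast_nonneg)
    · apply le_of_eq
      ring
  -- Odd characteristic: the involution is `y ^ 2`, and on its eigenspace for `e = ±1` the square of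
  -- `y` is the scalar `e`.
  · have hyy : ∀ v, ((ρ y : End F V) ^ 2) v = ρ y (ρ y v) := fun v => by
      rw [pow_two]
      rfl
    have hy2 : orderOf (y ^ 2) = 2 := by
      rw [orderOf_pow, hy]
      rfl
    refine le_trans (Nat.cast_le.2 (Set.ncard_le_ncard ?_)) ((ncard_invariant_of_involution (B := B)
      (z := (ρ y : End F V) ^ 2) (y := (ρ y : End F V)) (k := finrank F V / 4 + s) hσ h2
      (fun v => ?_) (fun v w => ?_) (hiso y) (fun v => ?_) hε (fun e he => ⟨e, ?_, fun v hv => ?_⟩)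
      (fun e he => ?_) (fun e a he => ?_) m).trans (cardPow_mono (by linarith)))
    · rintro U ⟨hU, hU'⟩
      refine ⟨fun u hu => ⟨?_, hU u hu⟩, hU'⟩
      rw [hyy]
      exact hU _ (hU u hu)
    · rw [← Module.End.mul_apply, ← pow_add, hy4]
      rfl
    · rw [hyy, hyy, hiso, hiso]
    · rw [hyy, hyy]
      rfl
    · rcases he with rfl | rfl <;> simp
    · rw [End.mem_eigenspace_iff, hyy] at hv
      exact hv
    · refine (finrank_le_of_zpowers hb hb' (y ^ 2) hy2 _ e fun v hv => ?_).trans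
        (by push_cast; linarith)
      rw [End.mem_eigenspace_iff, hyy] at hv
      rw [pow_two, map_mul]
      exact hv
    · refine (finrank_le_of_zpowers hb hb' y hy _ a fun v hv => ?_).trans (by norm_num)
      exact End.mem_eigenspace_iff.1 hv.2

theorem ncard_fixed_of_isKleinFour {K : Subgroup A} (hK : IsKleinFour K) (m : ℕ) :
    ({U : Submodule F V | (∀ g ∈ K, ∀ u ∈ U, ρ g u ∈ U) ∧ TotallyIsotropic B U ∧
      finrank F U = m}.ncard : ℝ) ≤
        cardPow F (m * (finrank F V / 4 + s) - (1 / 4 + ε / 44) * m ^ 2 + 9 * m + 3) := by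
  have hs : (0 : ℝ) ≤ s := s.cast_nonneg
  have hm : (0 : ℝ) ≤ m := m.cast_nonneg
  have hcard : Nat.card K = 4 := hK.card_four
  have hsq : ∀ g ∈ K, g * g = 1 := fun g hg => congrArg Subtype.val (hK.mul_self (⟨g, hg⟩ : K))
  obtain ⟨x, hx, y, hy, hx1, hxK⟩ : ∃ x ∈ K, ∃ y ∈ K, x ≠ 1 ∧
      ∀ g ∈ K, g = x * y ∨ g = x ∨ g = y ∨ g = 1 := by
    have : Fintype K := Fintype.ofFinite K
    classical
    obtain ⟨x, hx⟩ : ∃ x : K, x ≠ 1 := by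
      by_contra! h
      have h1 : Nat.card K ≤ 1 := Finite.card_le_one_iff_subsingleton.2
        ⟨fun a b => (h a).trans (h b).symm⟩
      omega
    obtain ⟨y, hy⟩ : ∃ y : K, y ∉ ({1, x} : Finset K) := by
      by_contra! h
      have h1 : (Finset.univ : Finset K) ⊆ {1, x} := fun y _ => h y
      have h2 := (Finset.card_le_card h1).trans Finset.card_le_two
      rw [Finset.card_univ, Fintype.card_eq_nat_card, hcard] at h2
      omega
    simp only [Finset.mem_insert, Finset.mem_singleton, not_or] at hy
    have h := IsKleinFour.eq_finset_univ hx hy.1 (Ne.symm hy.2)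
    refine ⟨x, x.2, y, y.2, fun h => hx (Subtype.ext h), fun g hg => ?_⟩
    have h1 : (⟨g, hg⟩ : K) ∈ ({x * y, x, y, 1} : Finset K) := h ▸ Finset.mem_univ _
    simp only [Finset.mem_insert, Finset.mem_singleton] at h1
    exact h1.imp (congrArg Subtype.val) (Or.imp (congrArg Subtype.val)
      (Or.imp (congrArg Subtype.val) (congrArg Subtype.val)))
  have hρ : ∀ g ∈ K, ∀ v, ρ g (ρ g v) = v := fun g hg v => by
    rw [← LinearEquiv.mul_apply, ← map_mul, hsq g hg, map_one]
    rfl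
  have hcomm : x * y = y * x := by
    have h1 := hsq (x * y) (K.mul_mem hx hy)
    calc x * y = (y * y) * (x * y) * (x * x) := by rw [hsq y hy, hsq x hx, one_mul, mul_one]
      _ = y * ((y * x) * (y * x)) * x := by simp only [mul_assoc]
      _ = y * x := by rw [hsq (y * x) (K.mul_mem hy hx), mul_one]
  have hρc : ∀ v, ρ y (ρ x v) = ρ x (ρ y v) := fun v => by
    rw [← LinearEquiv.mul_apply, ← map_mul, ← hcomm, map_mul]
    rfl
  -- The generators are scalar on `E`, hence so are all four elements of `K`. This is applied to the
  -- common kernel of `x - 1` and `y - 1` in characteristic 2, and to common eigenspaces otherwise.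
  have hscal : ∀ (E : Submodule F V) (l l' : F), (∀ v ∈ E, ρ x v = l • v) →
      (∀ v ∈ E, ρ y v = l' • v) → (finrank F E : ℝ) ≤ finrank F V / 4 + s := by
    intro E l l' h1 h2
    refine (finrank_le_div_add hb hb' K E (fun c hc => ?_) hcard (by norm_num)).trans (by norm_num)
    rcases hxK c hc with rfl | rfl | rfl | rfl
    · exact ⟨l' * l, fun v hv => by
        rw [map_mul, LinearEquiv.mul_apply, h2 v hv, map_smul, h1 v hv, smul_smul]⟩
    · exact ⟨l, h1⟩
    · exact ⟨l', h2⟩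
    · exact ⟨1, fun v _ => by rw [map_one, one_smul]; rfl⟩
  by_cases h2 : (2 : F) = 0
  · have h2' : ∀ v : V, v + v = 0 := fun v => by rw [← two_smul F, h2, zero_smul]
    have hker : ∀ g v, g ∈ K → ((ρ g : End F V) - 1) (((ρ g : End F V) - 1) v) = 0 := by
      intro g v hg
      change ρ g (ρ g v - v) - (ρ g v - v) = 0
      rw [map_sub, hρ g hg, ← h2' (v - ρ g v)]
      abel
    refine le_trans (Nat.cast_le.2 (Set.ncard_le_ncard ?_))
      (ncard_invariant_of_commuting_sq_eq_zero (B := B) (X := (ρ x : End F V) - 1)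
        (Y := (ρ y : End F V) - 1) (ε := ε) (k := finrank F V / 4 + s) (fun v => hker x v hx)
        (fun v => hker y v hy) (fun v => ?_) ?_ ?_ m)
    · rintro U ⟨hU, hU'⟩
      exact ⟨fun u hu => ⟨U.sub_mem (hU x hx u hu) hu, U.sub_mem (hU y hy u hu) hu⟩, hU'⟩
    · change ρ y (ρ x v - v) - (ρ x v - v) = ρ x (ρ y v - v) - (ρ y v - v)
      rw [map_sub, map_sub, hρc]
      abel
    · refine hscal _ 1 1 (fun v hv => ?_) (fun v hv => ?_)
      · rw [one_smul]
        exact sub_eq_zero.1 (mem_commonKer.1 hv).1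
      · rw [one_smul]
        exact sub_eq_zero.1 (mem_commonKer.1 hv).2
    · refine hε.imp id fun h => ⟨h.1, h.2, ?_, ?_⟩
      · simpa using sub_one_pow_apply_eq_zero h.2 (ρ x) (hiso x) 1
      · simpa using sub_one_pow_apply_eq_zero h.2 (ρ y) (hiso y) 1
  · have hx2 : orderOf x = 2 := orderOf_eq_prime (by rw [pow_two, hsq x hx]) hx1
    -- In odd characteristic the splitting gives the saving `ε / 8`, which is better than the `ε /
    -- 44` needed.
    have hεm : (0 : ℝ) ≤ (ε : ℝ) * m ^ 2 := by positivity
    refine le_trans (Nat.cast_le.2 (Set.ncard_le_ncard ?_)) ((ncard_invariant_of_involution (B := B)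
      (z := (ρ x : End F V)) (y := (ρ y : End F V)) (k := finrank F V / 4 + s) hσ h2
      (hρ x hx) (hiso x) (hiso y) hρc hε
      (fun e he => ⟨1, one_ne_zero, fun v hv => (hρ y hy v).trans (one_smul F v).symm⟩)
      (fun e he => ?_) (fun e a he => ?_) m).trans (cardPow_mono (by nlinarith only [hεm, hm])))
    · rintro U ⟨hU, hU'⟩
      exact ⟨fun u hu => ⟨hU x hx u hu, hU y hy u hu⟩, hU'⟩
    · refine (finrank_le_of_zpowers hb hb' x hx2 _ e fun v hv => ?_).trans
        (by push_cast; linarith)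
      exact End.mem_eigenspace_iff.1 hv
    · exact hscal _ e a (fun v hv => End.mem_eigenspace_iff.1 hv.1)
        (fun v hv => End.mem_eigenspace_iff.1 hv.2)

end FixedBounds

/-! ### ### Fixed point ratios on orbits of subspaces -/

/-- Double counting of an invariant incidence relation between two orbits. -/
theorem ncard_orbit_mul_le {H Ω X : Type*} [Group H] [Finite Ω] [Finite X]
    (α : H →* Equiv.Perm Ω) (β : H →* Equiv.Perm X) (I : Ω → X → Prop)
    (hI : ∀ h ω U, I (α h ω) (β h U) ↔ I ω U) (ω : Ω) (U : X) :
    (Set.range fun h => β h U).ncard * {ω' ∈ Set.range fun h => α h ω | I ω' U}.ncard ≤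
      (Set.range fun h => α h ω).ncard * {U' ∈ Set.range fun h => β h U | I ω U'}.ncard := by
  have hI' : ∀ h ω' U', I (α h ω') U' ↔ I ω' (β h⁻¹ U') := fun h ω' U' => by
    rw [← hI h ω' (β h⁻¹ U'), ← Equiv.Perm.mul_apply, ← map_mul, mul_inv_cancel, map_one]
    rfl
  have h := ncard_mul_le_ncard_mul (A := Set.range fun h => β h U)
    (T := Set.range fun h => α h ω) (fun U' => {ω' ∈ Set.range fun h => α h ω | I ω' U'})
    (a := {ω' ∈ Set.range fun h => α h ω | I ω' U}.ncard)
    (M := {U' ∈ Set.range fun h => β h U | I ω U'}.ncard) (fun _ _ _ h => h.1) ?_ ?_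
  · exact_mod_cast h
  · rintro _ ⟨g, rfl⟩
    rw [← Set.ncard_image_of_injective _ (α g).injective]
    refine Nat.cast_le.2 (Set.ncard_le_ncard ?_)
    rintro _ ⟨_, ⟨⟨h, rfl⟩, hω⟩, rfl⟩
    exact ⟨⟨g * h, by simp⟩, (hI _ _ _).2 hω⟩
  · rintro _ ⟨g, rfl⟩
    rw [← Set.ncard_image_of_injective _ (β g⁻¹).injective]
    refine Nat.cast_le.2 (Set.ncard_le_ncard ?_)
    rintro _ ⟨_, ⟨⟨h, rfl⟩, hU⟩, rfl⟩
    exact ⟨⟨g⁻¹ * h, by simp⟩, (hI' _ _ _).1 hU.2⟩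

theorem finsum_mem_le_ncard_mul {α : Type*} {s : Set α} (hs : s.Finite) {f : α → ℝ} {c : ℝ}
    (h : ∀ a ∈ s, f a ≤ c) : ∑ᶠ a ∈ s, f a ≤ s.ncard * c := by
  rw [finsum_mem_eq_finite_toFinset_sum f hs, Set.ncard_eq_toFinset_card s hs]
  have := Finset.sum_le_card_nsmul hs.toFinset f c (fun a ha => h a (hs.mem_toFinset.1 ha))
  simpa using this

namespace ClassicalSpace

variable {F V : Type*} [Field F] [AddCommGroup V] [Module F V] (S : ClassicalSpace F V)

/-- The action of the quasisimple group on subspaces. -/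
noncomputable def submodulePerm : S.quasiGroup →* Equiv.Perm (Submodule F V) :=
  MonoidHom.toHomPerm
    { toFun := fun g U => U.map ((g : V ≃ₗ[F] V) : V →ₗ[F] V)
      map_one' := funext fun U => Submodule.map_id U
      map_mul' := fun g h => funext fun U =>
        Submodule.map_comp ((h : V ≃ₗ[F] V) : V →ₗ[F] V) ((g : V ≃ₗ[F] V) : V →ₗ[F] V) U }

theorem submodulePerm_apply (g : S.quasiGroup) (U : Submodule F V) :
    S.submodulePerm g U = U.map ((g : V ≃ₗ[F] V) : V →ₗ[F] V) := rfl

/-- Lifts to the quasisimple group differ by scalars, and scalars fix every subspace. -/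
theorem proj_mem_stabilizer {g : S.quasiGroup} {U : Submodule F V} :
    S.proj g ∈ S.stabilizer U ↔ S.submodulePerm g U = U := by
  constructor
  · rintro ⟨g', hg', h⟩
    obtain ⟨c, hc⟩ := QuotientGroup.eq.1 h
    have h1 : S.submodulePerm (g'⁻¹ * g) U = U := by
      have h2 : (((g'⁻¹ * g : S.quasiGroup) : V ≃ₗ[F] V) : V →ₗ[F] V) = (c : F) • LinearMap.id :=
        LinearMap.ext hc
      rw [submodulePerm_apply, h2, Submodule.map_smul _ _ _ c.ne_zero, Submodule.map_id]
    rw [← mul_inv_cancel_left g' g, map_mul, Equiv.Perm.mul_apply, h1]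
    exact hg'
  · exact fun h => ⟨g, h, rfl⟩

theorem proj_surjective : Function.Surjective S.proj := QuotientGroup.mk'_surjective _

theorem mem_stabilizer_submodulePerm {h : S.quasiGroup} {ω : S.simpleGroup} {U : Submodule F V} :
    S.proj h * ω * (S.proj h)⁻¹ ∈ S.stabilizer (S.submodulePerm h U) ↔ ω ∈ S.stabilizer U := by
  obtain ⟨g, rfl⟩ := S.proj_surjective ω
  rw [← map_inv, ← map_mul, ← map_mul, proj_mem_stabilizer, proj_mem_stabilizer,
    ← Equiv.Perm.mul_apply, ← map_mul, inv_mul_cancel_right, map_mul, Equiv.Perm.mul_apply,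
    EmbeddingLike.apply_eq_iff_eq]

theorem map_conj_stabilizer (h : S.quasiGroup) (U : Submodule F V) :
    (S.stabilizer U).map (MulAut.conj (S.proj h)).toMonoidHom =
      S.stabilizer (S.submodulePerm h U) := by
  ext ω
  constructor
  · rintro ⟨ω', hω', rfl⟩
    exact S.mem_stabilizer_submodulePerm.2 hω'
  · intro hω
    refine ⟨(S.proj h)⁻¹ * ω * S.proj h, ?_, ?_⟩
    · refine S.mem_stabilizer_submodulePerm (h := h).1 ?_
      convert hω using 1
      group
    · change S.proj h * ((S.proj h)⁻¹ * ω * S.proj h) * (S.proj h)⁻¹ = ω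
      group

/-- The orbit of a subspace under the quasisimple group. -/
noncomputable def orbit (W : Submodule F V) : Set (Submodule F V) := Set.range fun h => S.submodulePerm h W

/-- Conjugation of elements of the simple group. -/
noncomputable def conjPerm : S.quasiGroup →* Equiv.Perm S.simpleGroup :=
  (MulAut.toPerm S.simpleGroup).comp (MulAut.conj.comp S.proj)

/-- Conjugation of subgroups of the simple group. -/
noncomputable def subgroupPerm : S.quasiGroup →* Equiv.Perm (Subgroup S.simpleGroup) :=
  MonoidHom.toHomPerm
    { toFun := fun g L => L.map (MulAut.conj (S.proj g)).toMonoidHom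
      map_one' := funext fun L => by
        rw [map_one, map_one]
        exact Subgroup.map_id L
      map_mul' := fun g h => funext fun L => by
        rw [map_mul, map_mul]
        exact (Subgroup.map_map L (MulAut.conj (S.proj g)).toMonoidHom
          (MulAut.conj (S.proj h)).toMonoidHom).symm }

variable {S}

theorem range_conjPerm (x : S.simpleGroup) :
    (Set.range fun h => S.conjPerm h x) = conjugatesOf x := by
  ext ω
  constructor
  · rintro ⟨h, rfl⟩
    exact isConj_iff.2 ⟨S.proj h, rfl⟩
  · intro hω
    obtain ⟨c, rfl⟩ := isConj_iff.1 hω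
    obtain ⟨h, rfl⟩ := S.proj_surjective c
    exact ⟨h, rfl⟩

theorem range_subgroupPerm (K : Subgroup S.simpleGroup) :
    (Set.range fun h => S.subgroupPerm h K) = subgroupConjugates K := by
  ext ω
  constructor
  · rintro ⟨h, rfl⟩
    exact ⟨S.proj h, rfl⟩
  · rintro ⟨c, rfl⟩
    obtain ⟨h, rfl⟩ := S.proj_surjective c
    exact ⟨h, rfl⟩

theorem orbit_eq_of_mem {W U : Submodule F V} (h : U ∈ S.orbit W) : S.orbit U = S.orbit W := by
  obtain ⟨g, rfl⟩ := h
  ext U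
  constructor
  · rintro ⟨h, rfl⟩
    exact ⟨h * g, by simp⟩
  · rintro ⟨h, rfl⟩
    exact ⟨h * g⁻¹, by simp⟩

variable [Finite F] [FiniteDimensional F V]

theorem finite_linearEquiv : Finite (V ≃ₗ[F] V) := by
  have : Finite V := Module.finite_of_finite F
  exact Finite.of_injective (fun g : V ≃ₗ[F] V => (g : V → V)) DFunLike.coe_injective

theorem orbit_ncard_pos (W : Submodule F V) : (0 : ℝ) < (S.orbit W).ncard := by
  have : Finite V := Module.finite_of_finite F
  exact Nat.cast_pos.2 ((Set.ncard_pos).2 ⟨W, 1, by simp⟩)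

/-- Both sides count the incidences between the class of `x` and the orbit of `W`, divided by the
sizes of the class and the orbit. -/
theorem classRatio_le {x : S.quasiGroup} {W U : Submodule F V} (hU : U ∈ S.orbit W) :
    classRatio (S.proj x) (S.stabilizer U) ≤
      ({U ∈ S.orbit W | S.submodulePerm x U = U}.ncard : ℝ) / (S.orbit W).ncard := by
  have : Finite V := Module.finite_of_finite F
  have := finite_linearEquiv (F := F) (V := V)
  have h := ncard_orbit_mul_le S.conjPerm S.submodulePerm (fun ω U => ω ∈ S.stabilizer U)
    (fun h ω U => S.mem_stabilizer_submodulePerm) (S.proj x) U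
  change (S.orbit U).ncard * _ ≤ _ * {U' ∈ S.orbit U | _}.ncard at h
  rw [orbit_eq_of_mem hU, range_conjPerm] at h
  simp only [proj_mem_stabilizer] at h
  have h0 : (0 : ℝ) < (conjugatesOf (S.proj x)).ncard :=
    Nat.cast_pos.2 ((Set.ncard_pos).2 ⟨_, mem_conjugatesOf_self⟩)
  rw [classRatio, div_le_div_iff₀ h0 (orbit_ncard_pos W)]
  have h1 : ((S.orbit W).ncard : ℝ) * (conjugatesOf (S.proj x) ∩ S.stabilizer U).ncard ≤
    (conjugatesOf (S.proj x)).ncard * {U ∈ S.orbit W | S.submodulePerm x U = U}.ncard := by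
    exact_mod_cast h
  linarith

theorem subgroupRatio_le {K : Subgroup S.quasiGroup} {W U : Submodule F V} (hU : U ∈ S.orbit W) :
    subgroupRatio (K.map S.proj) (S.stabilizer U) ≤
      ({U ∈ S.orbit W | ∀ g ∈ K, S.submodulePerm g U = U}.ncard : ℝ) / (S.orbit W).ncard := by
  have : Finite V := Module.finite_of_finite F
  have := finite_linearEquiv (F := F) (V := V)
  have h := ncard_orbit_mul_le S.subgroupPerm S.submodulePerm (fun L U => L ≤ S.stabilizer U)
    (fun h L U => by
      change L.map (MulAut.conj (S.proj h)).toMonoidHom ≤ _ ↔ _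
      rw [← map_conj_stabilizer]
      exact Subgroup.map_le_map_iff_of_injective (MulAut.conj (S.proj h)).injective)
    (K.map S.proj) U
  change (S.orbit U).ncard * _ ≤ _ * {U' ∈ S.orbit U | _}.ncard at h
  rw [orbit_eq_of_mem hU, range_subgroupPerm] at h
  have h2 : ∀ U, K.map S.proj ≤ S.stabilizer U ↔ ∀ g ∈ K, S.submodulePerm g U = U := fun U => by
    rw [Subgroup.map_le_iff_le_comap]
    exact forall₂_congr fun g _ => S.proj_mem_stabilizer
  simp only [h2] at h
  have h0 : (0 : ℝ) < (subgroupConjugates (K.map S.proj)).ncard :=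
    Nat.cast_pos.2 ((Set.ncard_pos).2 ⟨_, 1, rfl⟩)
  rw [subgroupRatio, div_le_div_iff₀ h0 (orbit_ncard_pos W)]
  have h1 : ((S.orbit W).ncard : ℝ) *
      {L ∈ subgroupConjugates (K.map S.proj) | L ≤ S.stabilizer U}.ncard ≤
    (subgroupConjugates (K.map S.proj)).ncard *
      {U ∈ S.orbit W | ∀ g ∈ K, S.submodulePerm g U = U}.ncard := by
    exact_mod_cast h
  linarith

/-- A sum over the conjugates of the stabilizer of `W` of products of ratios that are bounded by
proportions of fixed points on the orbit of `W`. -/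
theorem finsum_subgroupConjugates_le {W : Submodule F V} {r r' : Subgroup S.simpleGroup → ℝ}
    {a a' : ℝ} (ha : 0 ≤ a) (h0 : ∀ U, 0 ≤ r' U)
    (hr : ∀ U ∈ S.orbit W, r (S.stabilizer U) ≤ a / (S.orbit W).ncard)
    (hr' : ∀ U ∈ S.orbit W, r' (S.stabilizer U) ≤ a' / (S.orbit W).ncard) :
    ∑ᶠ M' ∈ subgroupConjugates (S.stabilizer W), r M' * r' M' ≤ a * a' / (S.orbit W).ncard := by
  have : Finite V := Module.finite_of_finite F
  have := finite_linearEquiv (F := F) (V := V)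
  have hN := orbit_ncard_pos (S := S) W
  have hsub : subgroupConjugates (S.stabilizer W) = S.stabilizer '' S.orbit W := by
    ext M
    constructor
    · rintro ⟨c, rfl⟩
      obtain ⟨h, rfl⟩ := S.proj_surjective c
      exact ⟨_, ⟨h, rfl⟩, (S.map_conj_stabilizer h W).symm⟩
    · rintro ⟨_, ⟨h, rfl⟩, rfl⟩
      exact ⟨S.proj h, S.map_conj_stabilizer h W⟩
  have h1 := finsum_mem_le_ncard_mul (s := subgroupConjugates (S.stabilizer W)) (Set.toFinite _)
    (f := fun M' => r M' * r' M')
    (c := a / (S.orbit W).ncard * (a' / (S.orbit W).ncard)) ?_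
  · have h2 : ((subgroupConjugates (S.stabilizer W)).ncard : ℝ) ≤ (S.orbit W).ncard := by
      rw [hsub]
      exact Nat.cast_le.2 (Set.ncard_image_le (Set.toFinite _))
    have ha' : 0 ≤ a' / (S.orbit W).ncard := (h0 _).trans (hr' W ⟨1, by simp⟩)
    refine h1.trans ((mul_le_mul_of_nonneg_right h2 (mul_nonneg (by positivity) ha')).trans
      (le_of_eq ?_))
    field_simp
  · rw [hsub]
    rintro _ ⟨U, hU, rfl⟩
    exact mul_le_mul (hr U hU) (hr' U hU) (h0 _) (by positivity)

end ClassicalSpace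

/-! ### ### Forms and Eichler transformations -/

theorem LinearMap.det_one_add_of_isNilpotent {F V : Type*} [Field F] [AddCommGroup V] [Module F V]
    [FiniteDimensional F V] {N : End F V} (h : IsNilpotent N) : LinearMap.det (1 + N) = 1 := by
  have h1 := LinearMap.eval_charpoly (-N) 1
  rw [IsNilpotent.charpoly_eq_X_pow_finrank h.neg, map_one, sub_neg_eq_add] at h1
  rw [← h1]
  simp

namespace ClassicalSpace

variable {F V : Type*} [Field F] [AddCommGroup V] [Module F V]

/-- The field automorphism belonging to the form. -/
def sigma : ClassicalSpace F V → (F →+* F)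
  | unitary σ _ _ _ _ _ => σ
  | _ => RingHom.id F

/-- The pairing, bundled. -/
def form : (S : ClassicalSpace F V) → V →ₛₗ[S.sigma] V →ₗ[F] F
  | linear => 0
  | symplectic B _ _ => B
  | orthogonal Q _ => QuadraticMap.polarBilin Q
  | unitary _ _ _ h _ _ => h

/-- `0` in the linear case, and `1` when there is a form. -/
def formRank : ClassicalSpace F V → ℕ
  | linear => 0
  | _ => 1

/-- The sign in the symmetry of the form. -/
def sign : ClassicalSpace F V → F
  | symplectic _ _ _ => -1
  | _ => 1

variable (S : ClassicalSpace F V)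

theorem form_apply (v w : V) : S.form v w = S.pairing v w := by
  cases S <;> rfl

theorem sigma_sigma (c : F) : S.sigma (S.sigma c) = c := by
  cases S with
  | unitary σ invol _ _ _ _ => exact invol c
  | _ => rfl

theorem form_swap (v w : V) : S.form w v = S.sign * S.sigma (S.form v w) := by
  cases S with
  | linear => simp [form]
  | symplectic B alt _ =>
    change B w v = -1 * B v w
    rw [neg_one_mul, alt.neg_eq]
  | orthogonal Q _ =>
    change QuadraticMap.polar Q w v = 1 * QuadraticMap.polar Q v w
    rw [one_mul, QuadraticMap.polar_comm]
  | unitary σ _ _ h herm _ =>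
    change h w v = 1 * σ (h v w)
    rw [one_mul, herm.eq]

theorem sign_mul_sign : S.sign * S.sign = 1 := by
  cases S <;> simp [sign]

theorem sigma_sign : S.sigma S.sign = S.sign := by
  cases S <;> simp [sign]

theorem formRank_eq : S.formRank = 0 ∧ S = linear ∨
    S.formRank = 1 ∧ ∀ w, (∀ v, S.form w v = 0) → w = 0 := by
  cases S with
  | linear => exact Or.inl ⟨rfl, rfl⟩
  | symplectic B alt nondeg => exact Or.inr ⟨rfl, nondeg.1⟩
  | orthogonal Q nondeg => exact Or.inr ⟨rfl, nondeg.1⟩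
  | unitary σ _ _ h _ nondeg => exact Or.inr ⟨rfl, nondeg.1⟩

theorem quasiGroup_le_isometryGroup : S.quasiGroup ≤ S.isometryGroup := by
  cases S with
  | linear => exact fun g _ => ⟨fun _ _ => rfl, fun _ => rfl⟩
  | symplectic B alt nondeg => exact le_rfl
  | orthogonal Q nondeg => exact Subgroup.commutator_le_self _
  | unitary σ _ _ h _ nondeg => exact inf_le_left

theorem form_isometry {g : V ≃ₗ[F] V} (hg : g ∈ S.isometryGroup) (v w : V) :
    S.form (g v) (g w) = S.form v w := by
  rw [form_apply, form_apply, hg.1]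

theorem IsTotallySingular.totallyIsotropic {W : Submodule F V} (h : S.IsTotallySingular W) :
    TotallyIsotropic S.form W := fun v hv w hw => by
  rw [form_apply, h.1 v hv w hw]

/-- A singular vector: one that spans a totally singular subspace. -/
def IsSingular (v : V) : Prop := S.form v v = 0 ∧ S.quad v = 0

/-- The trace `d + σ d` is not identically zero: otherwise `d = 1` gives `2 = 0`, and then `σ d = -d
= d` for all `d`. An element of nonzero trace is rescaled by elements fixed by `σ`. -/
theorem exists_add_sigma [Finite F] {σ : F →+* F} (invol : ∀ c, σ (σ c) = c)
    (nontriv : σ ≠ RingHom.id F) {a : F} (ha : σ a = a) : ∃ c, c + σ c = a := by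
  obtain ⟨d, hd⟩ : ∃ d, d + σ d ≠ 0 := by
    by_contra! h
    have h1 := h 1
    rw [map_one] at h1
    refine nontriv (RingHom.ext fun d => ?_)
    have h2 : d + d = 0 := by rw [← mul_one d, ← mul_add, h1, mul_zero]
    rw [RingHom.id_apply, ← sub_eq_zero, ← h d, ← sub_eq_zero, ← neg_eq_zero, ← h2]
    ring
  refine ⟨a * d / (d + σ d), ?_⟩
  rw [map_div₀, map_mul, map_add, invol, ha, add_comm (σ d) d, ← add_div, ← mul_add,
    mul_div_cancel_right₀ _ hd]

theorem quad_add_smul {Q : QuadraticForm F V} (v w : V) (c : F) :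
    Q (v + c • w) = Q v + c * c * Q w + c * QuadraticMap.polar Q v w := by
  rw [QuadraticMap.map_add Q, QuadraticMap.map_smul, QuadraticMap.polar_smul_right, smul_eq_mul,
    smul_eq_mul]

/-- Completes a singular `e` to a hyperbolic pair: adding `l • e` changes `Q f` by `l`, or `h f f`
by `l + σ l`. -/
theorem exists_isSingular_add_smul [Finite F] (hS : S.formRank = 1) {f e : V}
    (he : S.IsSingular e) (hfe : S.form f e = 1) : ∃ l : F, S.IsSingular (f + l • e) := by
  cases S with
  | linear => exact absurd hS (by simp [formRank])
  | symplectic B alt _ => exact ⟨0, alt _, rfl⟩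
  | orthogonal Q _ =>
    have he' : Q e = 0 := he.2
    have hfe' : QuadraticMap.polar Q f e = 1 := hfe
    have h : Q (f + (-Q f) • e) = 0 := by
      rw [quad_add_smul, he', hfe']
      ring
    refine ⟨-Q f, ?_, h⟩
    change QuadraticMap.polar Q _ _ = 0
    rw [QuadraticMap.polar_self, h, smul_zero]
  | unitary σ invol nontriv h herm _ =>
    have he' : h e e = 0 := he.1
    have hfe' : h f e = 1 := hfe
    have hef : h e f = 1 := by rw [← herm.eq, hfe']; exact map_one σ
    obtain ⟨c, hc⟩ := exists_add_sigma invol nontriv (a := -h f f) (by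
      rw [map_neg]; exact congrArg _ (herm.eq f f))
    refine ⟨c, ?_, rfl⟩
    change h (f + c • e) (f + c • e) = 0
    simp only [map_add, h.map_smulₛₗ, LinearMap.add_apply, LinearMap.smul_apply, map_smul, hfe', hef,
      he', smul_eq_mul, mul_one, mul_zero, add_zero]
    linear_combination hc

/-- The Eichler transformation of a singular vector `f` and a vector `u` orthogonal to it. -/
def eichler (f u : V) (c : F) : End F V :=
  LinearMap.id + (S.form f).smulRight u - S.sign • (S.form u).smulRight f +
    c • (S.form f).smulRight f

theorem eichler_apply (f u v : V) (c : F) : S.eichler f u c v =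
    v + S.form f v • u - (S.sign * S.form u v) • f + (c * S.form f v) • f := by
  simp [eichler, mul_smul]

theorem form_eq_zero_comm {v w : V} (h : S.form v w = 0) : S.form w v = 0 := by
  rw [form_swap, h, map_zero, mul_zero]

theorem form_eichler {f u : V} {c : F} (hf : S.form f f = 0) (hu : S.form f u = 0)
    (hc : c * S.sign + S.sigma c + S.form u u = 0) (v w : V) :
    S.form (S.eichler f u c v) (S.eichler f u c w) = S.form v w := by
  have hu' := S.form_eq_zero_comm hu
  have h1 := S.form_swap u v
  have h2 := S.form_swap f v
  have h3 := S.sign_mul_sign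
  have h4 := S.sigma_sign
  simp only [eichler_apply, map_add, map_sub, LinearMap.add_apply, LinearMap.sub_apply, map_smul,
    S.form.map_smulₛₗ, LinearMap.smul_apply, hf, hu, hu', h1, h2, smul_eq_mul, map_mul, h4]
  linear_combination (S.sigma (S.form f v) * S.form f w) * hc - S.form u w * S.sigma (S.form f v) * h3

theorem eichler_injective [FiniteDimensional F V] (hS : S.formRank = 1) {f u : V} {c : F}
    (hf : S.form f f = 0) (hu : S.form f u = 0)
    (hc : c * S.sign + S.sigma c + S.form u u = 0) : Function.Injective (S.eichler f u c) := by
  rw [injective_iff_map_eq_zero]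
  intro v hv
  have h : ∀ w, (∀ v, S.form w v = 0) → w = 0 := by
    rcases S.formRank_eq with h | h
    · rw [h.1] at hS
      exact absurd hS zero_ne_one
    · exact h.2
  refine h v fun w => ?_
  rw [← S.form_eichler hf hu hc, hv, map_zero, LinearMap.zero_apply]

/-- The Eichler transformations are isometries. -/
theorem exists_eichler_mem_isometryGroup [Finite F] [FiniteDimensional F V] (hS : S.formRank = 1)
    {f u : V} (hf : S.IsSingular f) (hu : S.form f u = 0) :
    ∃ c, ∃ g ∈ S.isometryGroup, (g : End F V) = S.eichler f u c := by
  -- The value of `c` is `0` in the symplectic case, `-Q u` in the orthogonal case, and of trace `-h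
  -- u u` in the unitary case. In characteristic 2 the first condition does not determine `c` in the
  -- orthogonal case, so `hq` is a separate requirement.
  obtain ⟨c, hc, hq⟩ : ∃ c, c * S.sign + S.sigma c + S.form u u = 0 ∧
      ∀ v, S.quad (S.eichler f u c v) = S.quad v := by
    cases S with
    | linear => exact absurd hS (by simp [formRank])
    | symplectic B alt _ =>
      refine ⟨0, ?_, fun v => rfl⟩
      change 0 * _ + 0 + B u u = 0
      rw [alt u]
      ring
    | orthogonal Q _ =>
      have hf' : Q f = 0 := hf.2
      have hu' : QuadraticMap.polar Q f u = 0 := hu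
      refine ⟨-Q u, ?_, fun v => ?_⟩
      · change -Q u * 1 + -Q u + QuadraticMap.polar Q u u = 0
        rw [QuadraticMap.polar_self, two_smul]
        ring
      · change Q _ = Q v
        have h1 : (orthogonal Q ‹_›).eichler f u (-Q u) v = v + (QuadraticMap.polar Q f v) • u +
            (-(QuadraticMap.polar Q u v) - Q u * QuadraticMap.polar Q f v) • f := by
          rw [eichler_apply]
          change v + QuadraticMap.polar Q f v • u - (1 * QuadraticMap.polar Q u v) • f +
            (-Q u * QuadraticMap.polar Q f v) • f = _
          module
        rw [h1, quad_add_smul, quad_add_smul, QuadraticMap.polar_add_left,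
          QuadraticMap.polar_smul_left, QuadraticMap.polar_comm Q v f, QuadraticMap.polar_comm Q u f,
          QuadraticMap.polar_comm Q v u, hu', hf', smul_eq_mul]
        ring
    | unitary σ invol nontriv h herm _ =>
      obtain ⟨c, hc⟩ := exists_add_sigma invol nontriv (a := -h u u) (by
        rw [map_neg]; exact congrArg _ (herm.eq u u))
      refine ⟨c, ?_, fun v => rfl⟩
      change c * 1 + σ c + h u u = 0
      linear_combination hc
  refine ⟨c, LinearEquiv.ofInjectiveEndo _ (S.eichler_injective hS hf.1 hu hc),
    ⟨fun v w => ?_, fun v => hq v⟩, rfl⟩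
  rw [← form_apply, ← form_apply]
  exact S.form_eichler hf.1 hu hc v w

/-- The difference sends `V` to the span of `f` and `u`, `u` to a multiple of `f`, and `f` to zero.
This gives determinant 1, needed for `SU(V)`. -/
theorem isNilpotent_eichler_sub_one {f u : V} {c : F} (hf : S.form f f = 0)
    (hu : S.form f u = 0) : IsNilpotent (S.eichler f u c - 1) := by
  have hu' := S.form_eq_zero_comm hu
  refine ⟨3, LinearMap.ext fun v => ?_⟩
  have h0 : ∀ v, (S.eichler f u c - 1) v =
      S.form f v • u - (S.sign * S.form u v) • f + (c * S.form f v) • f := fun v => by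
    rw [LinearMap.sub_apply, eichler_apply, Module.End.one_apply]
    abel
  have h1 : (S.eichler f u c - 1) f = 0 := by rw [h0, hf, hu']; simp
  have h2 : (S.eichler f u c - 1) u = - (S.sign * S.form u u) • f := by rw [h0, hu]; simp
  rw [pow_succ, pow_two, Module.End.mul_apply, Module.End.mul_apply, h0 v]
  simp only [map_add, map_sub, map_smul, h1, h2, smul_zero]
  simp

end ClassicalSpace

theorem le_finrank_rightPerp_add {F V : Type*} [Field F] [AddCommGroup V] [Module F V]
    [FiniteDimensional F V] {σ : F →+* F} (B : V →ₛₗ[σ] V →ₗ[F] F) (W : Submodule F V) :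
    finrank F V ≤ finrank F (rightPerp B W) + finrank F W := by
  let b := finBasis F W
  let f : V →ₗ[F] (Fin (finrank F W) → F) := LinearMap.pi fun j => B (b j)
  have h := LinearMap.finrank_range_add_finrank_ker f
  have h1 : LinearMap.ker f ≤ rightPerp B W := by
    intro v hv w hw
    have h2 : ∀ j, B (b j) v = 0 := fun j => congrFun hv j
    have h3 := congrArg Subtype.val (b.sum_repr ⟨w, hw⟩)
    simp only [Submodule.coe_sum, Submodule.coe_smul] at h3
    rw [← h3, map_sum, LinearMap.sum_apply]
    refine Finset.sum_eq_zero fun j _ => ?_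
    rw [B.map_smulₛₗ, LinearMap.smul_apply, h2, smul_zero]
  have h2 := Submodule.finrank_mono h1
  have h3 := Submodule.finrank_le (LinearMap.range f)
  rw [finrank_fin_fun] at h3
  omega

namespace ClassicalSpace

variable {F V : Type*} [Field F] [Finite F] [AddCommGroup V] [Module F V] [FiniteDimensional F V]

/-! ### ### Siegel transformations in the derived subgroup of the orthogonal group -/

section Orthogonal

variable (Q : QuadraticForm F V) (nondeg : (QuadraticMap.polarBilin Q).Nondegenerate)

theorem exists_mem_isometryGroup_of_quad {T : End F V} (hT : ∀ v, Q (T v) = Q v) :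
    ∃ g ∈ (orthogonal Q nondeg).isometryGroup, (g : End F V) = T := by
  have h : ∀ v w, QuadraticMap.polar Q (T v) (T w) = QuadraticMap.polar Q v w := fun v w => by
    rw [QuadraticMap.polar, ← map_add, hT, hT, hT]
    rfl
  refine ⟨LinearEquiv.ofInjectiveEndo T ?_, ⟨h, hT⟩, rfl⟩
  rw [injective_iff_map_eq_zero]
  refine fun v hv => nondeg.1 v fun w => ?_
  change QuadraticMap.polar Q v w = 0
  rw [← h, hv, QuadraticMap.polar_zero_left]

/-- The Eichler transformation in the orthogonal case. -/
def siegel (f u : V) : End F V :=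
  LinearMap.id + (QuadraticMap.polarBilin Q f).smulRight u -
    (QuadraticMap.polarBilin Q u + Q u • QuadraticMap.polarBilin Q f).smulRight f

theorem siegel_apply (f u v : V) : siegel Q f u v = v + QuadraticMap.polar Q f v • u -
    (QuadraticMap.polar Q u v + Q u * QuadraticMap.polar Q f v) • f := by
  simp [siegel]

theorem eichler_eq_siegel (f u : V) :
    (orthogonal Q nondeg).eichler f u (-Q u) = siegel Q f u := by
  ext v
  rw [eichler_apply, siegel_apply]
  change v + QuadraticMap.polar Q f v • u - (1 * QuadraticMap.polar Q u v) • f +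
    (-Q u * QuadraticMap.polar Q f v) • f = _
  module

variable {Q nondeg} {f : V} (hf : Q f = 0)

include hf

theorem siegel_mul_siegel {u w : V} (hu : QuadraticMap.polar Q f u = 0)
    (hw : QuadraticMap.polar Q f w = 0) :
    siegel Q f u * siegel Q f w = siegel Q f (u + w) := by
  ext v
  have hff : QuadraticMap.polar Q f f = 0 := by rw [QuadraticMap.polar_self, hf, smul_zero]
  have huf : QuadraticMap.polar Q u f = 0 := by rw [QuadraticMap.polar_comm, hu]
  rw [Module.End.mul_apply, siegel_apply, siegel_apply, siegel_apply]
  simp only [sub_eq_add_neg, ← neg_smul, QuadraticMap.polar_add_right, QuadraticMap.polar_add_left,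
    QuadraticMap.polar_smul_right, hw, hff, huf, QuadraticMap.map_add Q, smul_eq_mul]
  module

/-- A commutator of a reflection and a Siegel transformation. -/
theorem exists_siegel_mem_quasiGroup {a e : V} (ha : Q a ≠ 0) (hfa : QuadraticMap.polar Q f a = 0)
    (hfe : QuadraticMap.polar Q f e = 1) :
    ∃ g ∈ (orthogonal Q nondeg).quasiGroup, (g : End F V) = siegel Q f a := by
  have hff : QuadraticMap.polar Q f f = 0 := by rw [QuadraticMap.polar_self, hf, smul_zero]
  have haf : QuadraticMap.polar Q a f = 0 := by rw [QuadraticMap.polar_comm, hfa]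
  have hquad : ∀ (v w : V) (c : F),
      Q (v + c • w) = Q v + c * c * Q w + c * QuadraticMap.polar Q v w :=
    fun v w c => quad_add_smul v w c
  -- If `a` were orthogonal to everything orthogonal to `f`, it would be a multiple of `f`, hence
  -- singular.
  obtain ⟨v, hv, hav⟩ : ∃ v, QuadraticMap.polar Q f v = 0 ∧ QuadraticMap.polar Q a v = -Q a := by
    by_contra! h
    have h1 : ∀ v, QuadraticMap.polar Q f v = 0 → QuadraticMap.polar Q a v = 0 := by
      intro v hv
      by_contra hav
      refine h ((-Q a / QuadraticMap.polar Q a v) • v) ?_ ?_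
      · rw [QuadraticMap.polar_smul_right, hv, smul_zero]
      · rw [QuadraticMap.polar_smul_right, smul_eq_mul, div_mul_cancel₀ _ hav]
    have h2 : a - QuadraticMap.polar Q a e • f = 0 := by
      refine nondeg.1 _ fun v => ?_
      change QuadraticMap.polar Q _ v = 0
      have h3 := h1 (v + (-QuadraticMap.polar Q f v) • e) (by
        rw [QuadraticMap.polar_add_right, QuadraticMap.polar_smul_right, hfe, smul_eq_mul]
        ring)
      rw [QuadraticMap.polar_add_right, QuadraticMap.polar_smul_right, smul_eq_mul] at h3
      rw [sub_eq_add_neg, ← neg_smul, QuadraticMap.polar_add_left, QuadraticMap.polar_smul_left,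
        smul_eq_mul]
      linear_combination h3
    apply ha
    rw [sub_eq_zero.1 h2, QuadraticMap.map_smul, hf, smul_zero]
  have hr : ∀ x, Q (x - (QuadraticMap.polar Q a x / Q a) • a) = Q x := by
    intro x
    rw [sub_eq_add_neg, ← neg_smul, hquad, QuadraticMap.polar_comm Q x a]
    field_simp
    ring
  obtain ⟨r, hrG, hr'⟩ := exists_mem_isometryGroup_of_quad Q nondeg (T := LinearMap.id -
    ((Q a)⁻¹ • QuadraticMap.polarBilin Q a).smulRight a) (fun x => by
      rw [← hr x]
      simp [div_eq_inv_mul])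
  have hrx : ∀ x, r x = x - (QuadraticMap.polar Q a x / Q a) • a := fun x => by
    have := LinearMap.congr_fun hr' x
    simpa [div_eq_inv_mul] using this
  have hsQ : ∀ u, QuadraticMap.polar Q f u = 0 → ∀ x, Q (siegel Q f u x) = Q x := by
    intro u hu x
    have huf : QuadraticMap.polar Q u f = 0 := by rw [QuadraticMap.polar_comm, hu]
    rw [siegel_apply, sub_eq_add_neg, ← neg_smul, hquad, hquad, QuadraticMap.polar_add_left,
      QuadraticMap.polar_smul_left, huf, hf, QuadraticMap.polar_comm Q x u,
      QuadraticMap.polar_comm Q x f, smul_zero]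
    ring
  obtain ⟨s, hsG, hs⟩ := exists_mem_isometryGroup_of_quad Q nondeg (hsQ v hv)
  have hva : r v = v + a := by
    rw [hrx, hav, neg_div, div_self ha, neg_one_smul, sub_neg_eq_add]
  have hfva : QuadraticMap.polar Q f (v + a) = 0 := by
    rw [QuadraticMap.polar_add_right, hv, hfa, add_zero]
  -- Let `s` be the Siegel transformation of `v` and `r` the reflection in `a`. As `r` fixes `f` and
  -- sends `v` to `v + a`, the conjugate `r * s * r⁻¹` belongs to `v + a`, and dividing by `s`
  -- leaves the transformation of `a`.
  refine ⟨r * s * r⁻¹ * s⁻¹, Subgroup.commutator_mem_commutator hrG hsG, ?_⟩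
  have hconj : ((r * s : V ≃ₗ[F] V) : End F V) = siegel Q f (r v) * r := by
    ext x
    change r (s x) = siegel Q f (r v) (r x)
    have h1 : QuadraticMap.polar Q f (r x) = QuadraticMap.polar Q f x := by
      rw [hrx, sub_eq_add_neg, ← neg_smul, QuadraticMap.polar_add_right,
        QuadraticMap.polar_smul_right, hfa, smul_zero, add_zero]
    have h2 : r f = f := by rw [hrx, haf, zero_div, zero_smul, sub_zero]
    have h3 : s x = siegel Q f v x := LinearMap.congr_fun hs x
    have h4 : QuadraticMap.polar Q (r v) (r x) = QuadraticMap.polar Q v x := hrG.1 v x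
    have h5 : Q (r v) = Q v := hrG.2 v
    rw [h3, siegel_apply, siegel_apply, map_sub, map_add, map_smul, map_smul, h1, h2, h4, h5]
  have hmul : siegel Q f (r v) = siegel Q f a * s := by
    rw [hs, siegel_mul_siegel hf hfa hv, hva, add_comm]
  ext x
  have h6 := LinearMap.congr_fun hconj (r⁻¹ (s⁻¹ x))
  have h7 : r (r⁻¹ (s⁻¹ x)) = s⁻¹ x := r.apply_symm_apply _
  have h8 : s (s⁻¹ x) = x := s.apply_symm_apply _
  rw [hmul] at h6
  change r (s (r⁻¹ (s⁻¹ x))) = siegel Q f a x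
  refine h6.trans ?_
  change siegel Q f a (s (r (r⁻¹ (s⁻¹ x)))) = _
  rw [h7, h8]

theorem exists_siegel_add_mem_quasiGroup {u w : V} (hu : QuadraticMap.polar Q f u = 0)
    (hw : QuadraticMap.polar Q f w = 0)
    (hgu : ∃ g ∈ (orthogonal Q nondeg).quasiGroup, (g : End F V) = siegel Q f u)
    (hgw : ∃ g ∈ (orthogonal Q nondeg).quasiGroup, (g : End F V) = siegel Q f w) :
    ∃ g ∈ (orthogonal Q nondeg).quasiGroup, (g : End F V) = siegel Q f (u + w) := by
  obtain ⟨g, hg, hgu⟩ := hgu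
  obtain ⟨h, hh, hhw⟩ := hgw
  refine ⟨g * h, Subgroup.mul_mem _ hg hh, ?_⟩
  rw [← siegel_mul_siegel hf hu hw, ← hgu, ← hhw]
  rfl

end Orthogonal

/-! ### ### Orbits of pointwise stabilizers -/

variable (S : ClassicalSpace F V)

theorem two_mul_finrank_le_of_form_eq_zero (hS : S.formRank = 1) {Z : Submodule F V}
    (hZ : TotallyIsotropic S.form Z) : 2 * finrank F Z ≤ finrank F V := by
  have h := finrank_inf_rightPerp_le S.form ⊤ Z
  have h1 : Z ⊓ leftPerp S.form ⊤ = ⊥ := by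
    rw [Submodule.eq_bot_iff]
    rintro w ⟨-, hw⟩
    rcases S.formRank_eq with h | h
    · rw [h.1] at hS
      exact absurd hS zero_ne_one
    · exact h.2 w fun v => hw v trivial
  rw [h1, finrank_bot, finrank_top, top_inf_eq] at h
  have h2 := Submodule.finrank_mono (hZ.le_rightPerp le_rfl)
  omega

/-- On a large subspace of a given space `Z`, the Eichler transformations lie in the quasisimple
group. -/
theorem exists_eichler_mem_quasiGroup (hS : S.formRank = 1) {f e : V} (hf : S.IsSingular f)
    (hfe : S.form f e = 1) {Z : Submodule F V} (hZ : ∀ u ∈ Z, S.form f u = 0)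
    (hn : finrank F V < 2 * finrank F Z) :
    ∃ Z' ≤ Z, finrank F Z ≤ finrank F Z' + 1 ∧
      ∀ u ∈ Z', ∃ c, ∃ g ∈ S.quasiGroup, (g : End F V) = S.eichler f u c := by
  cases S with
  | linear => exact absurd hS (by simp [formRank])
  | symplectic B alt nondeg =>
    exact ⟨Z, le_rfl, Nat.le_succ _, fun u hu =>
      exists_eichler_mem_isometryGroup _ hS hf (hZ u hu)⟩
  | unitary σ invol nontriv h herm nondeg =>
    refine ⟨Z, le_rfl, Nat.le_succ _, fun u hu => ?_⟩
    obtain ⟨c, g, hg, hgc⟩ := exists_eichler_mem_isometryGroup _ hS hf (hZ u hu)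
    refine ⟨c, g, ⟨hg, ?_⟩, hgc⟩
    change LinearEquiv.det g = 1
    rw [Units.ext_iff, LinearEquiv.coe_det]
    have h1 := LinearMap.det_one_add_of_isNilpotent (isNilpotent_eichler_sub_one
      (unitary σ invol nontriv h herm nondeg) (c := c) hf.1 (hZ u hu))
    rw [add_sub_cancel, ← hgc] at h1
    exact h1
  | orthogonal Q nondeg =>
    have : Finite V := Module.finite_of_finite F
    have hfQ : Q f = 0 := hf.2
    have hfe' : QuadraticMap.polar Q f e = 1 := hfe
    have hZ' : ∀ u ∈ Z, QuadraticMap.polar Q f u = 0 := hZ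
    -- A singular `u` orthogonal to `a` is the sum of the nonsingular vectors `u + a` and `-a`,
    -- whose transformations are commutators. The restriction to vectors orthogonal to `a` costs one
    -- dimension.
    obtain ⟨a, ha, haQ⟩ : ∃ a ∈ Z, Q a ≠ 0 := by
      by_contra! h
      have := (orthogonal Q nondeg).two_mul_finrank_le_of_form_eq_zero hS (Z := Z)
        (fun u hu v hv => by
          change Q (u + v) - Q u - Q v = 0
          rw [h u hu, h v hv, h _ (Z.add_mem hu hv), sub_zero, sub_zero])
      omega
    refine ⟨Z ⊓ LinearMap.ker (QuadraticMap.polarBilin Q a), inf_le_left, ?_, ?_⟩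
    · have h1 := finrank_map_add_finrank_inf_ker (QuadraticMap.polarBilin Q a) Z
      have h2 := Submodule.finrank_le (Z.map (QuadraticMap.polarBilin Q a))
      rw [finrank_self] at h2
      omega
    · rintro u ⟨hu, hau⟩
      have hau' : QuadraticMap.polar Q a u = 0 := hau
      refine ⟨-Q u, ?_⟩
      rw [eichler_eq_siegel]
      by_cases huQ : Q u = 0
      · have h1 := exists_siegel_add_mem_quasiGroup (nondeg := nondeg) hfQ
          (hZ' _ (Z.add_mem hu ha)) (hZ' _ (Z.neg_mem ha))
          (exists_siegel_mem_quasiGroup hfQ (by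
            rw [QuadraticMap.map_add Q, huQ, QuadraticMap.polar_comm, hau']
            simpa using haQ) (hZ' _ (Z.add_mem hu ha)) hfe')
          (exists_siegel_mem_quasiGroup hfQ (by rwa [QuadraticMap.map_neg])
            (hZ' _ (Z.neg_mem ha)) hfe')
        rwa [add_neg_cancel_right] at h1
      · exact exists_siegel_mem_quasiGroup hfQ huQ (hZ' u hu) hfe'

/-- A lower bound for an orbit under the pointwise stabilizer of `W`, when there is a form. -/
theorem le_ncard_orbit_of_form (hS : S.formRank = 1) {W : Submodule F V} {e : V} (he : e ∉ W)
    (hWe : S.IsTotallySingular (W ⊔ F ∙ e)) (hn : 2 * (finrank F W + 1) < finrank F V) :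
    cardPow F (finrank F V - finrank F W - 3) ≤
      {v | ∃ g ∈ S.quasiGroup, (∀ w ∈ W, g w = w) ∧ g e = v}.ncard := by
  have : Finite V := Module.finite_of_finite F
  have heW : e ∈ W ⊔ F ∙ e := Submodule.mem_sup_right (Submodule.mem_span_singleton_self e)
  have hesing : S.IsSingular e := ⟨by rw [form_apply, hWe.1 e heW e heW], hWe.2 e heW⟩
  have hWe0 : ∀ w ∈ W, S.form w e = 0 := fun w hw => by
    rw [form_apply, hWe.1 w (Submodule.mem_sup_left hw) e heW]
  -- By nondegeneracy, the orthogonal complement of `W ⊔ F ∙ e` is strictly smaller than that of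
  -- `W`.
  obtain ⟨f₀, hf₀W, hf₀e⟩ : ∃ f₀, (∀ w ∈ W, S.form w f₀ = 0) ∧ S.form e f₀ ≠ 0 := by
    by_contra! h
    have h1 : rightPerp S.form W ≤ rightPerp S.form (W ⊔ F ∙ e) := by
      intro v hv x hx
      obtain ⟨w, hw, y, hy, rfl⟩ := Submodule.mem_sup.1 hx
      obtain ⟨c, rfl⟩ := Submodule.mem_span_singleton.1 hy
      rw [map_add, LinearMap.add_apply, hv w hw, S.form.map_smulₛₗ, LinearMap.smul_apply, h v hv,
        smul_zero, add_zero]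
    have h2 := Submodule.finrank_mono h1
    have h3 := le_finrank_rightPerp_add S.form W
    have h4 := finrank_inf_rightPerp_le S.form ⊤ (W ⊔ F ∙ e)
    have h5 : (W ⊔ F ∙ e) ⊓ leftPerp S.form ⊤ = ⊥ := by
      rw [Submodule.eq_bot_iff]
      rintro w ⟨-, hw⟩
      rcases S.formRank_eq with h | h
      · rw [h.1] at hS
        exact absurd hS zero_ne_one
      · exact h.2 w fun v => hw v trivial
    rw [h5, finrank_bot, finrank_top, top_inf_eq, finrank_sup_span_singleton he] at h4
    omega
  have hfe₀ : S.form f₀ e ≠ 0 := fun h => hf₀e (S.form_eq_zero_comm h)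
  obtain ⟨f, hf, hfe, hfW⟩ : ∃ f, S.IsSingular f ∧ S.form f e = 1 ∧ ∀ w ∈ W, S.form w f = 0 := by
    have h1 : S.form (S.sigma (S.form f₀ e)⁻¹ • f₀) e = 1 := by
      rw [S.form.map_smulₛₗ, S.sigma_sigma, LinearMap.smul_apply, smul_eq_mul,
        inv_mul_cancel₀ hfe₀]
    obtain ⟨l, hl⟩ := S.exists_isSingular_add_smul hS hesing h1
    refine ⟨_, hl, ?_, fun w hw => ?_⟩
    · rw [map_add, LinearMap.add_apply, h1, S.form.map_smulₛₗ, LinearMap.smul_apply, hesing.1,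
        smul_zero, add_zero]
    · rw [map_add, map_smul, map_smul, hf₀W w hw, hWe0 w hw, smul_zero, smul_zero, add_zero]
  have hZdim := le_finrank_rightPerp_add S.form (W ⊔ F ∙ f)
  have hWf : finrank F (W ⊔ F ∙ f : Submodule F V) ≤ finrank F W + 1 := by
    by_cases h : f ∈ W
    · rw [sup_eq_left.2 (span_le_of_mem h)]
      omega
    · rw [finrank_sup_span_singleton h]
  obtain ⟨Z, hZ, hZd, hZg⟩ := S.exists_eichler_mem_quasiGroup hS hf hfe
    (Z := rightPerp S.form (W ⊔ F ∙ f))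
    (fun u hu => hu f (Submodule.mem_sup_right (Submodule.mem_span_singleton_self f)))
    (by omega)
  choose! c g hg hgc using hZg
  have hge : ∀ u ∈ Z, ∀ v, g u v = v + S.form f v • u - (S.sign * S.form u v) • f +
      (c u * S.form f v) • f := fun u hu v => by
    rw [← eichler_apply, ← hgc u hu]
    rfl
  -- The Eichler transformations of `f` and of `u` in `Z` fix `W`, which is orthogonal to `f` and
  -- `u`, and send `e` to `e + u` plus a multiple of `f`. So the image of `e` determines `u` up to
  -- multiples of `f`.
  have h1 := ncard_le_of_fibers (A := (Z : Set V))
    (T := {v | ∃ g ∈ S.quasiGroup, (∀ w ∈ W, g w = w) ∧ g e = v}) (fun u => g u e)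
    (M := cardPow F 1) (fun u hu => ⟨g u, hg u hu, fun w hw => ?_, rfl⟩) ?_
  · rw [ncard_submodule] at h1
    have h2 : cardPow F (finrank F V - finrank F W - 3) * cardPow F 1 ≤
        cardPow F (finrank F Z) := by
      rw [← cardPow_add]
      apply cardPow_mono
      have h3 : ((finrank F V : ℕ) : ℝ) ≤ (finrank F Z + finrank F W + 2 : ℕ) :=
        Nat.cast_le.2 (by omega)
      push_cast at h3
      linarith
    exact le_of_mul_le_mul_right (h2.trans h1) (cardPow_pos _)
  · rw [hge u hu, S.form_eq_zero_comm (hfW w hw), S.form_eq_zero_comm (hZ hu w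
      (Submodule.mem_sup_left hw))]
    simp
  · rintro v -
    by_cases hne : {u ∈ (Z : Set V) | g u e = v} = ∅
    · rw [hne, Set.ncard_empty, Nat.cast_zero]
      exact (cardPow_pos _).le
    obtain ⟨u₀, hu₀, hu₀v⟩ := Set.nonempty_iff_ne_empty.2 hne
    rw [← Set.ncard_image_of_injective _ (sub_left_injective (b := u₀))]
    refine le_trans (Nat.cast_le.2 (Set.ncard_le_ncard (t := (F ∙ f : Submodule F V)) ?_))
      (ncard_submodule_le ?_)
    · rintro _ ⟨u, ⟨hu, huv⟩, rfl⟩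
      have h2 := huv.trans hu₀v.symm
      rw [hge u hu, hge u₀ hu₀, hfe, one_smul, one_smul] at h2
      refine Submodule.mem_span_singleton.2 ⟨S.sign * S.form u e - c u * 1 -
        (S.sign * S.form u₀ e - c u₀ * 1), ?_⟩
      rw [sub_smul, sub_smul, sub_smul, sub_eq_sub_iff_add_eq_add]
      rw [← sub_eq_zero] at h2 ⊢
      rw [← neg_eq_zero, ← h2]
      abel
    · rw [finrank_span_singleton (fun h => by simp [h] at hfe), Nat.cast_one]

/-- For `u` outside `W ⊔ F ∙ e`, a transvection in the direction of `u` whose functional vanishes on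
`W` and `u` but not on `e` fixes `W` and sends `e` to `e + u`. -/
theorem le_ncard_orbit_linear {W : Submodule F V} {e : V} (he : e ∉ W)
    (hn : finrank F W + 1 < finrank F V) :
    cardPow F (finrank F V - 1) ≤
      {v | ∃ g ∈ (linear : ClassicalSpace F V).quasiGroup,
        (∀ w ∈ W, g w = w) ∧ g e = v}.ncard := by
  have : Finite V := Module.finite_of_finite F
  have h1 := le_ncard_diff (U := ⊤) (K := W ⊔ F ∙ e) (fun h => by
    have h2 := Submodule.finrank_mono h
    rw [finrank_top, finrank_sup_span_singleton he] at h2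
    omega)
  rw [finrank_top] at h1
  refine h1.trans (Nat.cast_le.2 ?_)
  rw [← Set.ncard_image_of_injective _ (add_right_injective e)]
  refine Set.ncard_le_ncard ?_
  rintro _ ⟨u, ⟨-, hu⟩, rfl⟩
  have heu : e ∉ W ⊔ F ∙ u := by
    intro h
    obtain ⟨w, hw, y, hy, hwy⟩ := Submodule.mem_sup.1 h
    obtain ⟨c, rfl⟩ := Submodule.mem_span_singleton.1 hy
    have hc : c ≠ 0 := by
      rintro rfl
      rw [zero_smul, add_zero] at hwy
      exact he (hwy ▸ hw)
    refine hu ?_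
    have h2 : u = -(c⁻¹ • w) + c⁻¹ • e := by
      rw [← hwy, smul_add, smul_smul, inv_mul_cancel₀ hc, one_smul]
      abel
    rw [h2]
    exact Submodule.add_mem_sup (W.neg_mem (W.smul_mem _ hw))
      (Submodule.smul_mem _ _ (Submodule.mem_span_singleton_self e))
  obtain ⟨φ, hφe, hφ⟩ := Submodule.exists_le_ker_of_notMem heu
  have hφu : φ ((φ e)⁻¹ • u) = 0 := by
    rw [map_smul, LinearMap.mem_ker.1 (hφ (Submodule.mem_sup_right
      (Submodule.mem_span_singleton_self u))), smul_zero]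
  refine ⟨LinearEquiv.transvection hφu, LinearEquiv.transvection.det_eq_one hφu, fun w hw => ?_, ?_⟩
  · change w + φ w • ((φ e)⁻¹ • u) = w
    rw [LinearMap.mem_ker.1 (hφ (Submodule.mem_sup_left hw)), zero_smul, add_zero]
  · change e + φ e • ((φ e)⁻¹ • u) = e + u
    rw [smul_smul, mul_inv_cancel₀ hφe, one_smul]

end ClassicalSpace

theorem cardPow_pow {F : Type*} [Field F] [Finite F] (t : ℝ) (k : ℕ) :
    cardPow F t ^ k = cardPow F (k * t) := by
  rw [cardPow, cardPow, mul_comm, Real.rpow_mul_natCast (Nat.cast_nonneg _)]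

/-! ### ### The size of an orbit of totally singular subspaces -/

section Frames

variable {F V : Type*} [Field F] [Finite F] [AddCommGroup V] [Module F V] [FiniteDimensional F V]

/-- A lower bound for an orbit on sequences, from the orbits of the pointwise stabilizers. -/
theorem le_ncard_orbit_sequence [Finite V] (H : Subgroup (V ≃ₗ[F] V)) (e : ℕ → V) (c : ℕ → ℝ)
    (k : ℕ) (hc : ∀ i < k, cardPow F (c i) ≤
      {v | ∃ g ∈ H, (∀ j < i, g (e j) = e j) ∧ g (e i) = v}.ncard) :
    cardPow F (∑ i ∈ Finset.range k, c i) ≤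
      {r : Fin k → V | ∃ g ∈ H, ∀ j : Fin k, g (e j) = r j}.ncard := by
  induction k with
  | zero =>
    rw [Finset.range_zero, Finset.sum_empty, cardPow_zero, Nat.one_le_cast]
    exact (Set.ncard_pos).2 ⟨finZeroElim, 1, H.one_mem, fun j => j.elim0⟩
  | succ k ih =>
    have h := ncard_mul_le_ncard_mul
      (A := {r : Fin k → V | ∃ g ∈ H, ∀ j : Fin k, g (e j) = r j})
      (T := {r : Fin (k + 1) → V | ∃ g ∈ H, ∀ j : Fin (k + 1), g (e j) = r j})
      (fun r => {r' | (∃ g ∈ H, ∀ j : Fin (k + 1), g (e j) = r' j) ∧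
        ∀ j : Fin k, r' j.castSucc = r j})
      (a := cardPow F (c k)) (M := 1) (fun r _ r' hr' => hr'.1) ?_ ?_
    · rw [mul_one] at h
      rw [Finset.sum_range_succ, cardPow_add]
      exact (mul_le_mul_of_nonneg_right (ih fun i hi => hc i (hi.trans (Nat.lt_succ_self k)))
        (cardPow_pos _).le).trans h
    · rintro r ⟨g, hg, hgr⟩
      refine (hc k (Nat.lt_succ_self k)).trans (Nat.cast_le.2 ?_)
      -- If `g` sends the first `k` vectors to `r`, then translation by `g` turns the orbit of `e k`
      -- under their stabilizer into continuations of `r`.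
      have hinj : Function.Injective fun v : V => (Fin.snoc r (g v) : Fin (k + 1) → V) := by
        intro v v' h
        have h1 := congrFun h (Fin.last k)
        simp only [Fin.snoc_last] at h1
        exact g.injective h1
      rw [← Set.ncard_image_of_injective _ hinj]
      refine Set.ncard_le_ncard ?_
      rintro _ ⟨v, ⟨h, hh, hhe, rfl⟩, rfl⟩
      refine ⟨⟨g * h, H.mul_mem hg hh, fun j => ?_⟩, fun j => by simp only [Fin.snoc_castSucc]⟩
      refine Fin.lastCases ?_ (fun j => ?_) j
      · simp only [Fin.snoc_last]
        rfl
      · simp only [Fin.snoc_castSucc]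
        rw [← hgr j, LinearEquiv.mul_apply, Fin.val_castSucc, hhe j j.2]
    · rintro r' -
      have h1 : {r ∈ {r : Fin k → V | ∃ g ∈ H, ∀ j : Fin k, g (e j) = r j} |
          r' ∈ {r' | (∃ g ∈ H, ∀ j : Fin (k + 1), g (e j) = r' j) ∧
            ∀ j : Fin k, r' j.castSucc = r j}} ⊆ {fun j => r' j.castSucc} := by
        rintro r ⟨-, -, hr⟩
        exact funext fun j => (hr j).symm
      exact_mod_cast (Set.ncard_le_ncard h1).trans (Set.ncard_singleton _).le

namespace ClassicalSpace

variable (S : ClassicalSpace F V)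

theorem le_ncard_orbit_pointwise {W : Submodule F V} {e : V} (he : e ∉ W)
    (hWe : S.IsTotallySingular (W ⊔ F ∙ e)) {i : ℕ} (hi : finrank F W ≤ i)
    (hn : 2 * (i + 1) < finrank F V) :
    cardPow F (finrank F V - S.formRank * i - 4) ≤
      {v | ∃ g ∈ S.quasiGroup, (∀ w ∈ W, g w = w) ∧ g e = v}.ncard := by
  have hi' : (finrank F W : ℝ) ≤ i := Nat.cast_le.2 hi
  rcases S.formRank_eq with ⟨h, rfl⟩ | ⟨h, -⟩
  · refine (cardPow_mono ?_).trans (le_ncard_orbit_linear he (by omega))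
    rw [h]
    push_cast
    linarith
  · refine (cardPow_mono ?_).trans (S.le_ncard_orbit_of_form h he hWe (by omega))
    rw [h]
    push_cast
    linarith

/-- The lower bound for the number of totally singular subspaces in an orbit. -/
theorem le_ncard_orbit {W : Submodule F V} (hW : S.IsTotallySingular W) {m : ℕ}
    (hm : finrank F W = m) (hm1 : 1 ≤ m) (hmn : 2 * m ≤ finrank F V) :
    cardPow F (m * finrank F V - (1 + S.formRank / 2) * m ^ 2 - 6 * m) ≤ (S.orbit W).ncard := by
  have : Finite V := Module.finite_of_finite F
  -- Only the first `k` basis vectors of `W` are moved. In the extreme case `n = 2 * m` the bound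
  -- for the last one is not available, and omitting it costs only a linear term in `m`.
  obtain ⟨k, hkm, hk, hkn⟩ : ∃ k ≤ m, (∀ i < k, 2 * (i + 1) < finrank F V) ∧
      (k = m ∨ k + 1 = m ∧ finrank F V = 2 * m) := by
    by_cases h : 2 * m < finrank F V
    · exact ⟨m, le_rfl, fun i hi => by omega, Or.inl rfl⟩
    · exact ⟨m - 1, by omega, fun i hi => by omega, Or.inr (by omega)⟩
  let b : Basis (Fin m) F W := finBasisOfFinrankEq F W hm
  let v : Fin m → V := fun j => b j
  have hv : LinearIndependent F v := b.linearIndependent.map' W.subtype W.ker_subtype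
  have hvW : ∀ j, v j ∈ W := fun j => (b j).2
  let e : ℕ → V := fun j => if h : j < m then v ⟨j, h⟩ else 0
  have he : ∀ j : Fin m, e j = v j := fun j => dif_pos j.2
  have heW : ∀ j, e j ∈ W := fun j => by
    by_cases h : j < m
    · rw [he ⟨j, h⟩]
      exact hvW _
    · simp only [e, dif_neg h, W.zero_mem]
  have h1 := le_ncard_orbit_sequence S.quasiGroup e
    (fun i => (finrank F V : ℝ) - S.formRank * i - 4) k (fun i hi => ?_)
  · have h2 := ncard_mul_le_ncard_mul
      (A := {r : Fin k → V | ∃ g ∈ S.quasiGroup, ∀ j : Fin k, g (e j) = r j}) (T := S.orbit W)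
      (fun r => {U | U ∈ S.orbit W ∧ ∀ j, r j ∈ U}) (a := 1) (M := cardPow F (m ^ 2))
      (fun r _ U hU => hU.1) ?_ ?_
    · rw [mul_one] at h2
      have h3 := h1.trans h2
      have h4 : cardPow F (m * finrank F V - (1 + S.formRank / 2) * m ^ 2 - 6 * m) *
          cardPow F (m ^ 2) ≤
            cardPow F (∑ i ∈ Finset.range k, ((finrank F V : ℝ) - S.formRank * i - 4)) := by
        rw [← cardPow_add]
        apply cardPow_mono
        have h5 : ∀ k : ℕ, ∑ i ∈ Finset.range k, ((finrank F V : ℝ) - S.formRank * i - 4) =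
            k * finrank F V - S.formRank * (k * (k - 1) / 2) - 4 * k := by
          intro k
          induction k with
          | zero => simp
          | succ k ih =>
            rw [Finset.sum_range_succ, ih]
            push_cast
            ring
        rw [h5]
        have hε : (0 : ℝ) ≤ S.formRank := Nat.cast_nonneg _
        have hm0 : (1 : ℝ) ≤ m := by exact_mod_cast hm1
        rcases hkn with rfl | ⟨hk1, hn⟩
        · nlinarith only [mul_nonneg hε (zero_le_one.trans hm0), hm0]
        · have hkR : (k : ℝ) = m - 1 := by
            rw [← hk1]
            push_cast
            ring
          rw [hkR, hn]
          push_cast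
          nlinarith only [mul_nonneg hε (sub_nonneg.2 hm0), hm0, hε]
      exact le_of_mul_le_mul_right (h4.trans h3) (cardPow_pos _)
    · rintro r ⟨g, hg, hgr⟩
      refine Nat.one_le_cast.2 ((Set.ncard_pos).2 ⟨S.submodulePerm ⟨g, hg⟩ W, ⟨_, rfl⟩, fun j => ?_⟩)
      rw [← hgr]
      exact ⟨e j, heW j, rfl⟩
    · rintro _ ⟨g, rfl⟩
      set U := S.submodulePerm g W with hU
      have hUm : finrank F U = m := by
        rw [hU, submodulePerm_apply, ← hm]
        exact LinearEquiv.finrank_map_eq (g : V ≃ₗ[F] V) W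
      have h3 : {r ∈ {r : Fin k → V | ∃ g ∈ S.quasiGroup, ∀ j : Fin k, g (e j) = r j} |
          U ∈ {U | U ∈ S.orbit W ∧ ∀ j, r j ∈ U}} ⊆
          Set.range (fun (r : Fin k → U) j => (r j : V)) := by
        rintro r ⟨-, -, hr⟩
        exact ⟨fun j => ⟨r j, hr j⟩, rfl⟩
      have h4 := Set.ncard_le_ncard h3
      rw [← Set.image_univ] at h4
      have h5 := h4.trans (Set.ncard_image_le)
      rw [Set.ncard_univ, Nat.card_fun, Nat.card_fin] at h5
      have h6 : (Nat.card U : ℝ) ^ k = cardPow F (k * m) := by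
        rw [natCard_submodule, hUm, cardPow_pow]
      refine (Nat.cast_le.2 h5).trans ?_
      push_cast
      rw [h6]
      apply cardPow_mono
      rw [pow_two]
      exact mul_le_mul_of_nonneg_right (Nat.cast_le.2 hkm) (Nat.cast_nonneg _)
  · have him : i < m := hi.trans_le hkm
    let Wi := Submodule.span F (v '' {j : Fin m | (j : ℕ) < i})
    have hWi : Wi ≤ W := Submodule.span_le.2 (by rintro _ ⟨j, -, rfl⟩; exact hvW j)
    have h2 := S.le_ncard_orbit_pointwise (W := Wi) (e := e i) (i := i) ?_ ?_ ?_ (hk i hi)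
    · refine h2.trans (Nat.cast_le.2 (Set.ncard_le_ncard ?_))
      rintro x ⟨g, hg, hgW, hge⟩
      refine ⟨g, hg, fun j hj => hgW _ ?_, hge⟩
      have := he ⟨j, hj.trans him⟩
      simp only at this
      rw [this]
      exact Submodule.subset_span ⟨_, hj, rfl⟩
    · rw [he ⟨i, him⟩]
      exact hv.notMem_span_image (by simp)
    · have hle : Wi ⊔ F ∙ e i ≤ W := sup_le hWi (span_le_of_mem (heW i))
      exact ⟨fun x hx y hy => hW.1 x (hle hx) y (hle hy), fun x hx => hW.2 x (hle hx)⟩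
    · classical
      refine (finrank_span_le_card _).trans ?_
      rw [← Set.ncard_eq_toFinset_card']
      refine (Set.ncard_image_le).trans ?_
      rw [← Set.ncard_image_of_injective _ Fin.val_injective]
      refine (Set.ncard_le_ncard (t := Set.Iio i) ?_).trans ?_
      · rintro _ ⟨j, hj, rfl⟩
        exact hj
      · rw [← Finset.coe_Iio, Set.ncard_coe_finset, Nat.card_Iio]

end ClassicalSpace

end Frames

/-! ### ### Combination of the exponents -/

namespace ClassicalSpace

variable {F V : Type*} [Field F] [AddCommGroup V] [Module F V] (S : ClassicalSpace F V)

theorem exponentFour_eq (n m : ℝ) : S.exponentFour n m =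
    S.delta * (m * n / 4 - (1 / 4 + S.formRank / 4 - S.formRank / 8) * m ^ 2) := by
  cases S <;> simp only [exponentFour, delta, formRank] <;> push_cast <;> ring

theorem exponentKlein_eq (n m : ℝ) : S.exponentKlein n m =
    S.delta * (m * n / 4 - (1 / 4 + S.formRank / 4 - S.formRank / 44) * m ^ 2) := by
  cases S <;> simp only [exponentKlein, delta, formRank] <;> push_cast <;> ring

theorem one_le_delta : (1 : ℝ) ≤ S.delta := by
  cases S <;> norm_num [delta]

theorem delta_le_two : (S.delta : ℝ) ≤ 2 := by
  cases S <;> norm_num [delta]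

theorem formRank_le_one : (S.formRank : ℝ) ≤ 1 := by
  cases S <;> norm_num [formRank]

/-- As `n ≥ 2m` and `h ≤ 21/44 < 1/2`, the surplus of `m * n / 4 - h * m ^ 2` over `n / 4` is at
least `m ^ 2 / 44 - m / 2`, and this absorbs `c * m`. The constant `11 * (c + 1) ^ 2` is the maximum
of `(c + 1) * m - m ^ 2 / 44`. -/
theorem neg_exponent_add_lt {h δ n m c : ℝ} (hδ : 1 ≤ δ) (hδ' : δ ≤ 2) (hh : h ≤ 21 / 44)
    (hm : 1 ≤ m) (hmn : 2 * m ≤ n) :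
    -(δ * (m * n / 4 - h * m ^ 2)) + c * m < -(δ * n / 4) + (11 * (c + 1) ^ 2 + 1) := by
  have h1 : m ^ 2 / 44 - m / 2 ≤ m * n / 4 - h * m ^ 2 - n / 4 := by
    nlinarith only [mul_nonneg (sub_nonneg.2 hm) (sub_nonneg.2 hmn),
      mul_nonneg (sub_nonneg.2 hh) (sq_nonneg m)]
  have h2 : δ * (m ^ 2 / 44 - m / 2) ≤ δ * (m * n / 4 - h * m ^ 2 - n / 4) :=
    mul_le_mul_of_nonneg_left h1 (by linarith)
  have h3 : m ^ 2 / 44 - m ≤ δ * (m ^ 2 / 44 - m / 2) := by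
    nlinarith only [mul_nonneg (sub_nonneg.2 hδ) (sq_nonneg m),
      mul_nonneg (sub_nonneg.2 hδ') (zero_le_one.trans hm)]
  nlinarith only [h2, h3, sq_nonneg (c + 1 - m / 22)]

variable {S} [Finite F] [FiniteDimensional F V]

/-- The conversion of the counting bounds into the bound for the sum. -/
theorem finsum_subgroupConjugates_lt {q m : ℕ} (hq : Nat.card F = q ^ S.delta)
    {W : Submodule F V} (hW : S.IsTotallySingular W) (hm : finrank F W = m) (hm1 : 1 ≤ m)
    (hmn : 2 * m ≤ finrank F V) {r r' : Subgroup S.simpleGroup → ℝ} {a a' s s' h : ℝ}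
    (ha0 : 0 ≤ a) (hr0 : ∀ U, 0 ≤ r' U)
    (hr : ∀ U ∈ S.orbit W, r (S.stabilizer U) ≤ a / (S.orbit W).ncard)
    (hr' : ∀ U ∈ S.orbit W, r' (S.stabilizer U) ≤ a' / (S.orbit W).ncard)
    (ha : a ≤ cardPow F (m * (finrank F V / 2 + s) - (1 / 2 + S.formRank / 4) * m ^ 2 + 3 * m))
    (ha' : a' ≤ cardPow F (m * (finrank F V / 4 + s') - (1 / 4 + h) * m ^ 2 + 9 * m + 3))
    {c : ℝ} (hc0 : 0 ≤ s + s') (hc : 2 * (s + s' + 22) ≤ c) :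
    ∑ᶠ M' ∈ subgroupConjugates (S.stabilizer W), r M' * r' M' <
      (q : ℝ) ^ (-(S.delta * (m * (finrank F V : ℝ) / 4 -
        (1 / 4 + S.formRank / 4 - h) * m ^ 2)) + c * m) := by
  have hN := S.le_ncard_orbit hW hm hm1 hmn
  have hN0 := orbit_ncard_pos (S := S) W
  have hm0 : (1 : ℝ) ≤ m := by exact_mod_cast hm1
  have hδ := S.one_le_delta
  have hδ' := S.delta_le_two
  have hq0 : (0 : ℝ) ≤ q := Nat.cast_nonneg q
  have hcard : ∀ t, cardPow F t = (q : ℝ) ^ (S.delta * t) := fun t => by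
    rw [cardPow, hq, Nat.cast_pow, ← Real.rpow_natCast, ← Real.rpow_mul hq0]
  have hq1 : (1 : ℝ) < q := by
    have h2 := two_le_natCard (F := F)
    rw [hq, Nat.cast_pow] at h2
    by_contra! h
    linarith [pow_le_one₀ (n := S.delta) hq0 h]
  have hprod := mul_le_mul ha ha' ((mul_nonneg_iff_of_pos_right (inv_pos.2 hN0)).1
    ((hr0 _).trans (hr' W ⟨1, by simp⟩))) (cardPow_pos _).le
  rw [← cardPow_add] at hprod
  refine (finsum_subgroupConjugates_le ha0 hr0 hr hr').trans_lt ?_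
  rw [div_lt_iff₀ hN0]
  refine hprod.trans_lt (lt_of_lt_of_le ?_ (mul_le_mul_of_nonneg_left hN (by positivity)))
  rw [hcard, hcard, ← Real.rpow_add (by linarith)]
  apply Real.rpow_lt_rpow_of_exponent_lt hq1
  -- The linear terms are `3` and `9` from the fixed subspaces and `6` from the orbit, besides `s +
  -- s'` from the trivial summands; `δ ≤ 2` and `m ≥ 1` explain the hypothesis on `c`.
  have h1 : (S.delta : ℝ) * (m * (s + s' + 18) + 3) < c * m := by
    nlinarith only [mul_nonneg (sub_nonneg.2 hδ') (mul_nonneg (zero_le_one.trans hm0) hc0), hm0,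
      mul_le_mul_of_nonneg_right hc (zero_le_one.trans hm0), hδ', hδ,
      mul_nonneg (sub_nonneg.2 hδ') (zero_le_one.trans hm0)]
  nlinarith only [h1]

theorem finrank_eq_and_totallyIsotropic_of_mem_orbit {W U : Submodule F V}
    (hW : S.IsTotallySingular W) (hU : U ∈ S.orbit W) :
    TotallyIsotropic S.form U ∧ finrank F U = finrank F W := by
  obtain ⟨g, rfl⟩ := hU
  refine ⟨?_, LinearEquiv.finrank_map_eq (g : V ≃ₗ[F] V) W⟩
  rintro _ ⟨u, hu, rfl⟩ _ ⟨v, hv, rfl⟩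
  exact (S.form_isometry (S.quasiGroup_le_isometryGroup g.2) u v).trans
    (hW.totallyIsotropic S u hu v hv)

theorem mem_of_submodulePerm_eq {g : S.quasiGroup} {U : Submodule F V}
    (h : S.submodulePerm g U = U) : ∀ u ∈ U, (g : V ≃ₗ[F] V) u ∈ U := fun u hu => by
  have h1 : (g : V ≃ₗ[F] V) u ∈ S.submodulePerm g U := ⟨u, hu, rfl⟩
  rwa [h] at h1

theorem formRank_eq_zero_or : S.formRank = 0 ∨ S.formRank = 1 ∧
    ∀ w, (∀ v, S.form w v = 0) → w = 0 :=
  S.formRank_eq.imp (fun h => h.1) id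

section AlmostFree

variable {A : Type*} [Group A] [Finite A] {ρ : A →* S.quasiGroup} {W : Submodule F V}
  (hρ : S.IsAlmostFree ρ) (hW : S.IsTotallySingular W)

include hρ hW

theorem ncard_fixed_orbit_of_orderOf_two {x : A} (hx : orderOf x = 2) :
    ({U ∈ S.orbit W | S.submodulePerm (ρ x) U = U}.ncard : ℝ) ≤
      cardPow F (finrank F W * (finrank F V / 2 + (2 * Nat.card A + 1)) -
        (1 / 2 + S.formRank / 4) * (finrank F W : ℝ) ^ 2 + 3 * finrank F W) := by
  have : Finite V := Module.finite_of_finite F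
  obtain ⟨t, s, b, -, -, hs, hb, hb', -⟩ := hρ
  have hs' : (s : ℝ) ≤ 2 * Nat.card A + 1 := by exact_mod_cast Nat.lt_succ_iff.1 hs
  refine le_trans (Nat.cast_le.2 (Set.ncard_le_ncard ?_)) ((ncard_fixed_of_orderOf_two
    (ρ := S.quasiGroup.subtype.comp ρ) (B := S.form) hb hb' S.sigma_sigma
    (fun g => S.form_isometry (S.quasiGroup_le_isometryGroup (ρ g).2))
    S.formRank_eq_zero_or hx (finrank F W)).trans (cardPow_mono ?_))
  · rintro U ⟨hU, hxU⟩
    exact ⟨mem_of_submodulePerm_eq hxU, finrank_eq_and_totallyIsotropic_of_mem_orbit hW hU⟩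
  · gcongr

theorem ncard_fixed_orbit_of_orderOf_four {y : A} (hy : orderOf y = 4) :
    ({U ∈ S.orbit W | S.submodulePerm (ρ y) U = U}.ncard : ℝ) ≤
      cardPow F (finrank F W * (finrank F V / 4 + (2 * Nat.card A + 1)) -
        (1 / 4 + S.formRank / 8) * (finrank F W : ℝ) ^ 2 + 9 * finrank F W + 3) := by
  have : Finite V := Module.finite_of_finite F
  obtain ⟨t, s, b, -, -, hs, hb, hb', -⟩ := hρ
  have hs' : (s : ℝ) ≤ 2 * Nat.card A + 1 := by exact_mod_cast Nat.lt_succ_iff.1 hs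
  refine le_trans (Nat.cast_le.2 (Set.ncard_le_ncard ?_)) ((ncard_fixed_of_orderOf_four
    (ρ := S.quasiGroup.subtype.comp ρ) (B := S.form) hb hb' S.sigma_sigma
    (fun g => S.form_isometry (S.quasiGroup_le_isometryGroup (ρ g).2))
    S.formRank_eq_zero_or hy (finrank F W)).trans (cardPow_mono ?_))
  · rintro U ⟨hU, hyU⟩
    exact ⟨mem_of_submodulePerm_eq hyU, finrank_eq_and_totallyIsotropic_of_mem_orbit hW hU⟩
  · gcongr
    norm_num

theorem ncard_fixed_orbit_of_isKleinFour {K : Subgroup A} (hK : IsKleinFour K) :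
    ({U ∈ S.orbit W | ∀ g ∈ K.map ρ, S.submodulePerm g U = U}.ncard : ℝ) ≤
      cardPow F (finrank F W * (finrank F V / 4 + (2 * Nat.card A + 1)) -
        (1 / 4 + S.formRank / 44) * (finrank F W : ℝ) ^ 2 + 9 * finrank F W + 3) := by
  have : Finite V := Module.finite_of_finite F
  obtain ⟨t, s, b, -, -, hs, hb, hb', -⟩ := hρ
  have hs' : (s : ℝ) ≤ 2 * Nat.card A + 1 := by exact_mod_cast Nat.lt_succ_iff.1 hs
  refine le_trans (Nat.cast_le.2 (Set.ncard_le_ncard ?_)) ((ncard_fixed_of_isKleinFour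
    (ρ := S.quasiGroup.subtype.comp ρ) (B := S.form) hb hb' S.sigma_sigma
    (fun g => S.form_isometry (S.quasiGroup_le_isometryGroup (ρ g).2))
    S.formRank_eq_zero_or hK (finrank F W)).trans (cardPow_mono ?_))
  · rintro U ⟨hU, hKU⟩
    exact ⟨fun g hg => mem_of_submodulePerm_eq (hKU _ ⟨g, hg, rfl⟩),
      finrank_eq_and_totallyIsotropic_of_mem_orbit hW hU⟩
  · gcongr

end AlmostFree

end ClassicalSpace

theorem mainTheorem8 {A B : Type*} [Group A] [Finite A] [Group B] [Finite B]
    (hA : IsPGroup 2 A) (hB : IsPGroup 2 B) :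
    (∃ c c' : ℝ, ∀ (F V : Type*) [Field F] [Finite F] [AddCommGroup V] [Module F V]
        [FiniteDimensional F V] (S : ClassicalSpace F V) (q : ℕ), Nat.card F = q ^ S.delta →
      ∀ (ρ : A →* S.quasiGroup) (τ : B →* S.quasiGroup), S.IsAlmostFree ρ → S.IsAlmostFree τ →
      ∀ x : A, orderOf x = 2 → ∀ y : B, orderOf y = 4 →
      ∀ m : ℕ, 1 ≤ m → 2 * m ≤ Module.finrank F V →
      ∀ M : Subgroup S.simpleGroup, S.IsMaximalParabolic m M →
        ∑ᶠ M' ∈ subgroupConjugates M,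
            classRatio (S.proj (ρ x)) M' * classRatio (S.proj (τ y)) M'
          < (q : ℝ) ^ (-S.exponentFour (Module.finrank F V) m + c * m) ∧
        -S.exponentFour (Module.finrank F V) m + c * m
          < -((S.delta : ℝ) * (Module.finrank F V : ℝ) / 4) + c') ∧
    (∃ c c' : ℝ, ∀ (F V : Type*) [Field F] [Finite F] [AddCommGroup V] [Module F V]
        [FiniteDimensional F V] (S : ClassicalSpace F V) (q : ℕ), Nat.card F = q ^ S.delta →
      ∀ (ρ : A →* S.quasiGroup) (τ : B →* S.quasiGroup), S.IsAlmostFree ρ → S.IsAlmostFree τ →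
      ∀ x : A, orderOf x = 2 → ∀ K : Subgroup B, IsKleinFour K →
      ∀ m : ℕ, 1 ≤ m → 2 * m ≤ Module.finrank F V →
      ∀ M : Subgroup S.simpleGroup, S.IsMaximalParabolic m M →
        ∑ᶠ M' ∈ subgroupConjugates M,
            classRatio (S.proj (ρ x)) M' * subgroupRatio (K.map (S.proj.comp τ)) M'
          < (q : ℝ) ^ (-S.exponentKlein (Module.finrank F V) m + c * m) ∧
        -S.exponentKlein (Module.finrank F V) m + c * m
          < -((S.delta : ℝ) * (Module.finrank F V : ℝ) / 4) + c') := by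
  have hA0 : (0 : ℝ) ≤ 2 * Nat.card A + 1 := by positivity
  have hB0 : (0 : ℝ) ≤ 2 * Nat.card B + 1 := by positivity
  -- The trivial summands have dimension at most `2|A| + 1` and `2|B| + 1`, which makes `c` depend
  -- only on the two groups.
  obtain ⟨c, hc⟩ : ∃ c : ℝ, 2 * ((2 * Nat.card A + 1) + (2 * Nat.card B + 1) + 22) ≤ c := ⟨_, le_rfl⟩
  refine ⟨⟨c, 11 * (c + 1) ^ 2 + 1, ?_⟩, c, 11 * (c + 1) ^ 2 + 1, ?_⟩
  · intro F V _ _ _ _ _ S q hq ρ τ hρ hτ x hx y hy m hm hmn M hM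
    obtain ⟨-, W, hW, rfl, rfl⟩ := hM
    have hm' : (1 : ℝ) ≤ finrank F W := by exact_mod_cast hm
    have hmn' : 2 * (finrank F W : ℝ) ≤ finrank F V := by exact_mod_cast hmn
    have hh : (1 / 4 + S.formRank / 4 - S.formRank / 8 : ℝ) ≤ 21 / 44 := by
      linarith [S.formRank_le_one]
    rw [S.exponentFour_eq]
    refine ⟨ClassicalSpace.finsum_subgroupConjugates_lt (r := classRatio (S.proj (ρ x)))
      (r' := classRatio (S.proj (τ y))) hq hW rfl hm hmn (Nat.cast_nonneg _)
      (fun U => div_nonneg (Nat.cast_nonneg _) (Nat.cast_nonneg _))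
        (fun U hU => ClassicalSpace.classRatio_le hU) (fun U hU => ClassicalSpace.classRatio_le hU)
        (ClassicalSpace.ncard_fixed_orbit_of_orderOf_two hρ hW hx)
        (ClassicalSpace.ncard_fixed_orbit_of_orderOf_four hτ hW hy) (add_nonneg hA0 hB0) hc,
      ClassicalSpace.neg_exponent_add_lt S.one_le_delta S.delta_le_two hh hm' hmn'⟩
  · intro F V _ _ _ _ _ S q hq ρ τ hρ hτ x hx K hK m hm hmn M hM
    obtain ⟨-, W, hW, rfl, rfl⟩ := hM
    have hm' : (1 : ℝ) ≤ finrank F W := by exact_mod_cast hm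
    have hmn' : 2 * (finrank F W : ℝ) ≤ finrank F V := by exact_mod_cast hmn
    have hh : (1 / 4 + S.formRank / 4 - S.formRank / 44 : ℝ) ≤ 21 / 44 := by
      linarith [S.formRank_le_one]
    rw [S.exponentKlein_eq, ← Subgroup.map_map]
    refine ⟨ClassicalSpace.finsum_subgroupConjugates_lt (r := classRatio (S.proj (ρ x)))
      (r' := subgroupRatio ((K.map τ).map S.proj)) hq hW rfl hm hmn (Nat.cast_nonneg _)
      (fun U => div_nonneg (Nat.cast_nonneg _) (Nat.cast_nonneg _))
        (fun U hU => ClassicalSpace.classRatio_le hU)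
        (fun U hU => ClassicalSpace.subgroupRatio_le hU)
        (ClassicalSpace.ncard_fixed_orbit_of_orderOf_two hρ hW hx)
        (ClassicalSpace.ncard_fixed_orbit_of_isKleinFour hτ hW hK) (add_nonneg hA0 hB0) hc,
      ClassicalSpace.neg_exponent_add_lt S.one_le_delta S.delta_le_two hh hm' hmn'⟩
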